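/- Let $\mathbb{A}$ be a countably infinite set of atoms, acted on by the group of all permutations of $\mathbb A$, and let the alphabet $\Sigma$ be an orbit-finite nominal set (a set with an action of $\mathrm{Perm}(\mathbb{A})$ that is a finite union of orbits and all of whose elements have a finite support). A nominal automaton over $\Sigma$ is a nondeterministic automaton whose states form an orbit-finite nominal set $Q$ and whose sets of initial states, final states and transitions are equivariant subsets of $Q$, $Q$ and $Q\times\Sigma\times Q$. It is residual if each state $q$ has a characterising word, i.e. a word $w$ such that the language of $q$ is $w^{-1}\mathcal{L}=\{v\mid wv\in\mathcal{L}\}$, where $\mathcal{L}$ is the language of the automaton. A language is residual if a residual nominal automaton accepts it. For a set $X$ of finitely supported sets, $\mathrm{JI}(X)$ is the set of non-empty $x\in X$ such that $x=\bigcup F$ with $F\subseteq X$ finitely supported implies $x\in F$. The canonical residual automaton of $\mathcal{L}$ has state set $\mathrm{JI}(\{u^{-1}\mathcal{L}\mid u\in\Sigma^*\})$, initial states the states $q\subseteq\mathcal{L}$, final states the states $q\ni\varepsilon$, and a transition $(q,a,q')$ whenever $q'\subseteq a^{-1}q$. The modified $\nu\mathsf{NL}^*$ algorithm learns an equivariant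 language $\mathcal{L}\subseteq\Sigma^*$ as follows. It maintains a table $T=(S,E)$ of sets of words, initially $S=E=\{\varepsilon\}$, with rows $\mathrm{row}(t)=\{e\in E\mid te\in\mathcal{L}\}$ for $t\in S\cup S\Sigma$; let $R=\{\mathrm{row}(t)\mid t\in S\cup S\Sigma\}$, $R^\uparrow=\{\mathrm{row}(s)\mid s\in S\}$ and $Q_T=\mathrm{JI}(R)\cap R^\uparrow$. The table is join-closed if each $\mathrm{row}(sa)$ with $s\in S$, $a\in\Sigma$ is the union of the $r\in Q_T$ with $r\subseteq\mathrm{row}(sa)$, and join-consistent if for $s_1,s_2\in S$, $a\in\Sigma$, $\mathrm{row}(s_1)\subseteq\mathrm{row}(s_2)$ implies $\mathrm{row}(s_1a)\subseteq\mathrm{row}(s_2a)$. 1. While $T$ is not both join-closed and join-consistent: (i) if $T$ is not join-closed, find $s\in S$, $a\in\Sigma$ with $\mathrm{row}(sa)\in\mathrm{JI}(R)\setminus R^\uparrow$ and add all words of length $\le|sa|$ to $S$; then (ii) if $T$ is not join-consistent, find $s_1,s_2\in S$, $a\in\Sigma$, $e\in E$ with $\mathrm{row}(s_1)\subseteq\mathrm{row}(s_2)$,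 $e\in\mathrm{row}(s_1a)$, $e\notin\mathrm{row}(s_2a)$ and add the orbit of $ae$ to $E$. 2. Ask an equivalence query for the hypothesis $\mathcal{A}(T)$ with states $Q_T$, initial states the $r\in Q_T$ with $r\subseteq\mathrm{row}(\varepsilon)$, final states the $r\in Q_T$ with $\varepsilon\in r$, and transitions $(\mathrm{row}(s),a,r')$ for $s\in S$ with $\mathrm{row}(s)\in Q_T$, and $r'\in Q_T$ with $r'\subseteq\mathrm{row}(sa)$. If $\mathcal A(T)$ accepts exactly $\mathcal{L}$, return $\mathcal{A}(T)$. Otherwise the teacher gives some word $t$ in the symmetric difference; add the orbits of all suffixes of $t$ to $E$ and go to 1. Theorem. The algorithm learns exactly the residual nominal languages: - if $\mathcal{L}$ is residual, then every run (for all choices of the learner and all counterexamples of the teacher) is finite and returns an automaton, and at each moment the set $SE\cup S\Sigma E$ of queried words is orbit-finite; - whenever a run on an equivariant language $\mathcal{L}$ returns an automaton, this is a residual nominal automaton that accepts $\mathcal{L}$; so no run returns if $\mathcal{L}$ is not residual. Moreover, for each alphabet $\Sigma$ there is a constant $C$ such that on every residual language $\mathcal{L}$ every run asks at most $$C\cdot\bigl(l+|\Sigma^{\le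 l}|^2\cdot p(dl)\bigr)$$ equivalence queries. Here $l$ is the length of the longest shortest characterising word, i.e. the least $l$ such that $\Sigma^{\le l}$ contains a characterising word for each state of the canonical residual automaton of $\mathcal{L}$; $|X|$ is the number of orbits of $X$; $d$ is the least number such that each letter has a support of size at most $d$; and $p(k)$ is the number of orbits of $\mathbb{A}^{(k)}\times\mathbb{A}^{(k)}$, where $\mathbb{A}^{(k)}$ is the set of $k$-tuples of pairwise distinct atoms. -/

import Mathlib

open scoped Pointwise

universe u v

namespace NominalLearning

/-! ### Nominal sets

The atoms are a type `𝔸`; permutations of atoms are elements of `Equiv.Perm 𝔸`, and a set with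
permutation action is a type with `MulAction (Equiv.Perm 𝔸)`.  Subsets carry the pointwise action
`π • U = {π • x | x ∈ U}` and pairs the componentwise one. -/

/-- Permutations act on words letterwise. -/
instance listMulAction {G : Type*} {α : Type*} [Monoid G] [MulAction G α] :
    MulAction G (List α) where
  smul g w := w.map (fun a => g • a)
  one_smul w := by
    change w.map (fun a => (1 : G) • a) = w
    simp
  mul_smul g h w := by
    change w.map (fun a => (g * h) • a) = (w.map (fun a => h • a)).map (fun a => g • a)
    simp [mul_smul]

section Nominal

variable (𝔸 : Type v) {X : Type u} [MulAction (Equiv.Perm 𝔸) X]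

/-- `x` has a finite support. -/
def FinitelySupported (x : X) : Prop :=
  ∃ s : Finset 𝔸, MulAction.Supports (Equiv.Perm 𝔸) (s : Set 𝔸) x

/-- A subset is equivariant if it is fixed by all permutations. -/
def Equivariant (U : Set X) : Prop :=
  ∀ π : Equiv.Perm 𝔸, π • U = U

/-- `U` is a finite union of orbits. -/
def OrbitFinite (U : Set X) : Prop :=
  ∃ F : Finset X, U = ⋃ x ∈ F, MulAction.orbit (Equiv.Perm 𝔸) x

/-- The orbit-count `|U|` of an orbit-finite set. -/
noncomputable def orbitCount (U : Set X) : ℕ :=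
  ((fun x => MulAction.orbit (Equiv.Perm 𝔸) x) '' U).ncard

/-- The atom-dimension of `U`: the smallest `k` such that each element of `U` has a support of size
at most `k`. -/
noncomputable def atomDim (U : Set X) : ℕ :=
  sInf {k | ∀ x ∈ U, ∃ s : Finset 𝔸, s.card ≤ k ∧
    MulAction.Supports (Equiv.Perm 𝔸) (s : Set 𝔸) x}

end Nominal

/-- `p k` is the number of orbits of `𝔸^(k) × 𝔸^(k)`, where `𝔸^(k)` is the set of `k`-tuples of
pairwise distinct atoms. -/
noncomputable def pairOrbits (𝔸 : Type v) (k : ℕ) : ℕ :=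
  orbitCount 𝔸 {x : (Fin k → 𝔸) × (Fin k → 𝔸) |
    Function.Injective x.1 ∧ Function.Injective x.2}

/-- The join-irreducible elements of a set `X` of finitely supported subsets of `Z`: the non-empty
`x ∈ X` such that `x ∈ F` for every finitely supported `F ⊆ X` with union `x`. -/
def joinIrreducibles (𝔸 : Type v) {Z : Type u} [MulAction (Equiv.Perm 𝔸) Z] (X : Set (Set Z)) :
    Set (Set Z) :=
  {x | x ∈ X ∧ x.Nonempty ∧
    ∀ F : Set (Set Z), F ⊆ X → FinitelySupported 𝔸 F → x = ⋃₀ F → x ∈ F}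

/-! ### Languages and automata -/

/-- `Σ^{≤ n}`, the words of length at most `n`. -/
def wordsUpTo (α : Type u) (n : ℕ) : Set (List α) :=
  {w | w.length ≤ n}

/-- The derivative `w⁻¹ L`. -/
def derivative {α : Type u} (L : Set (List α)) (w : List α) : Set (List α) :=
  {v | w ++ v ∈ L}

/-- The set of all derivatives of `L`. -/
def derivatives {α : Type u} (L : Set (List α)) : Set (Set (List α)) :=
  Set.range (derivative L)

/-- An automaton whose set of states is a subset `states` of `X`. -/
structure Automaton (α : Type u) (X : Type u) extends NFA α X where
  /-- the set `Q` of states -/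
  states : Set X

namespace Automaton

variable {α X : Type u} (A : Automaton α X)

/-- The language accepted by the automaton. -/
def language : Set (List α) := A.toNFA.accepts

/-- The language accepted by a state. -/
def languageFrom (q : X) : Set (List α) := A.toNFA.acceptsFrom {q}

/-- `w` is a characterising word for the state `q`. -/
def IsCharacterisingWord (q : X) (w : List α) : Prop :=
  A.languageFrom q = derivative A.language w

/-- Each state accepts a derivative of the language of the automaton. -/
def IsResidual : Prop :=
  ∀ q ∈ A.states, ∃ w : List α, A.IsCharacterisingWord q w

/-- A nominal automaton: the states form an orbit-finite nominal set, and the initial states, the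
final states and the transition relation are equivariant subsets of `Q`, `Q` and `Q × Σ × Q`.
(The alphabet is assumed to be an orbit-finite nominal set separately.) -/
structure IsNominal (𝔸 : Type v) [MulAction (Equiv.Perm 𝔸) α] [MulAction (Equiv.Perm 𝔸) X] :
    Prop where
  states_supported : ∀ q ∈ A.states, FinitelySupported 𝔸 q
  states_orbitFinite : OrbitFinite 𝔸 A.states
  start_subset : A.start ⊆ A.states
  accept_subset : A.accept ⊆ A.states
  step_subset : ∀ q a q', q' ∈ A.step q a → q ∈ A.states ∧ q' ∈ A.states
  start_equivariant : Equivariant 𝔸 A.start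
  accept_equivariant : Equivariant 𝔸 A.accept
  step_equivariant : Equivariant 𝔸 {t : X × α × X | t.2.2 ∈ A.step t.1 t.2.1}

end Automaton

/-- `L` is accepted by a residual nominal automaton. -/
def IsResidualLanguage (𝔸 : Type v) {α : Type u} [MulAction (Equiv.Perm 𝔸) α]
    (L : Set (List α)) : Prop :=
  ∃ (X : Type u) (_ : MulAction (Equiv.Perm 𝔸) X) (A : Automaton α X),
    A.IsNominal 𝔸 ∧ A.IsResidual ∧ A.language = L

/-- The canonical residual automaton: its states are the join-irreducible derivatives of `L`. -/
def canonicalAutomaton (𝔸 : Type v) {α : Type u} [MulAction (Equiv.Perm 𝔸) α]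
    (L : Set (List α)) : Automaton α (Set (List α)) where
  states := joinIrreducibles 𝔸 (derivatives L)
  start := {q | q ∈ joinIrreducibles 𝔸 (derivatives L) ∧ q ⊆ L}
  accept := {q | q ∈ joinIrreducibles 𝔸 (derivatives L) ∧ [] ∈ q}
  step q a := {q' | q ∈ joinIrreducibles 𝔸 (derivatives L) ∧
    q' ∈ joinIrreducibles 𝔸 (derivatives L) ∧ q' ⊆ derivative q [a]}

/-- The length of the longest among the shortest characterising words: the least `l` such that
`Σ^{≤ l}` contains a characterising word for each state of the canonical residual automaton. -/
noncomputable def charLength (𝔸 : Type v) {α : Type u} [MulAction (Equiv.Perm 𝔸) α]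
    (L : Set (List α)) : ℕ :=
  sInf {l | ∀ q ∈ (canonicalAutomaton 𝔸 L).states,
    ∃ w ∈ wordsUpTo α l, (canonicalAutomaton 𝔸 L).IsCharacterisingWord q w}

/-! ### Observation tables -/

/-- An observation table, given by its row indices `S` and its column indices `E`.  Its entries are
determined by the target language. -/
structure Table (α : Type u) where
  S : Set (List α)
  E : Set (List α)

namespace Table

variable {α : Type u} (L : Set (List α)) (T : Table α)

/-- `S ∪ SΣ` -/
def rowIndices : Set (List α) :=
  T.S ∪ {w | ∃ s ∈ T.S, ∃ a : α, w = s ++ [a]}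

/-- The words `S E ∪ S Σ E` whose membership in `L` is queried to fill the table. -/
def membershipQueries : Set (List α) :=
  {w | ∃ t ∈ T.rowIndices, ∃ e ∈ T.E, w = t ++ e}

/-- The content of the row of `t`. -/
def row (t : List α) : Set (List α) :=
  {e | e ∈ T.E ∧ t ++ e ∈ L}

def rows : Set (Set (List α)) := T.row L '' T.rowIndices

def upperRows : Set (Set (List α)) := T.row L '' T.S

variable (𝔸 : Type v) [MulAction (Equiv.Perm 𝔸) α]

/-- The join-irreducible rows which are upper rows. -/
def upperJoinIrreducibles : Set (Set (List α)) :=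
  joinIrreducibles 𝔸 (T.rows L) ∩ T.upperRows L

def JoinClosed : Prop :=
  ∀ s ∈ T.S, ∀ a : α,
    T.row L (s ++ [a]) = ⋃₀ {r | r ∈ T.upperJoinIrreducibles L 𝔸 ∧ r ⊆ T.row L (s ++ [a])}

def JoinConsistent : Prop :=
  ∀ s₁ ∈ T.S, ∀ s₂ ∈ T.S, ∀ a : α,
    T.row L s₁ ⊆ T.row L s₂ → T.row L (s₁ ++ [a]) ⊆ T.row L (s₂ ++ [a])

/-- The hypothesis automaton constructed from a table. -/
def hypothesis : Automaton α (Set (List α)) where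
  states := T.upperJoinIrreducibles L 𝔸
  start := {r | r ∈ T.upperJoinIrreducibles L 𝔸 ∧ r ⊆ T.row L []}
  accept := {r | r ∈ T.upperJoinIrreducibles L 𝔸 ∧ [] ∈ r}
  step r a := {r' | r ∈ T.upperJoinIrreducibles L 𝔸 ∧ r' ∈ T.upperJoinIrreducibles L 𝔸 ∧
    ∃ s ∈ T.S, r = T.row L s ∧ r' ⊆ T.row L (s ++ [a])}

end Table

/-! ### The modified nominal `NL*` algorithm

The choices of the learner ("find ...") and the choice of counterexamples by the teacher are
nondeterministic, so that the algorithm is given by a transition relation. -/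

section Algorithm

variable (𝔸 : Type v) {α : Type u} [MulAction (Equiv.Perm 𝔸) α] (L : Set (List α))

/-- First conditional statement in the body of the inner loop: if the table is not join-closed,
find a missing join-irreducible row `row (s a)` and add all words of length at most `|s a|`. -/
inductive ClosePhase : Table α → Table α → Prop
  | skip (T : Table α) : T.JoinClosed L 𝔸 → ClosePhase T T
  | extend (T : Table α) (s : List α) (a : α) : ¬ T.JoinClosed L 𝔸 → s ∈ T.S →
      T.row L (s ++ [a]) ∈ joinIrreducibles 𝔸 (T.rows L) \ T.upperRows L →
      ClosePhase T ⟨T.S ∪ wordsUpTo α (s ++ [a]).length, T.E⟩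

/-- Second conditional statement in the body of the inner loop: if the table is not
join-consistent, find a witness and add the orbit of `a e` to the columns. -/
inductive ConsistencyPhase : Table α → Table α → Prop
  | skip (T : Table α) : T.JoinConsistent L → ConsistencyPhase T T
  | extend (T : Table α) (s₁ s₂ : List α) (a : α) (e : List α) : ¬ T.JoinConsistent L →
      s₁ ∈ T.S → s₂ ∈ T.S → e ∈ T.E → T.row L s₁ ⊆ T.row L s₂ →
      e ∈ T.row L (s₁ ++ [a]) → e ∉ T.row L (s₂ ++ [a]) →
      ConsistencyPhase T ⟨T.S, T.E ∪ MulAction.orbit (Equiv.Perm 𝔸) (a :: e)⟩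

/-- A configuration of the algorithm: the current table, the number of equivalence queries asked so
far, and the returned automaton (if the algorithm has returned). -/
structure Config (α : Type u) where
  table : Table α
  queries : ℕ
  output : Option (Automaton α (Set (List α)))

/-- The initial configuration, with `S = E = {ε}`. -/
def initialConfig (α : Type u) : Config α := ⟨⟨{[]}, {[]}⟩, 0, none⟩

/-- One step of the algorithm: either one execution of the body of the inner loop, or an equivalence
query with a negative answer and a counterexample `t`, or an equivalence query with a positive
answer. -/
inductive Step : Config α → Config α → Prop
  | body (T T₁ T₂ : Table α) (n : ℕ) : ¬ (T.JoinClosed L 𝔸 ∧ T.JoinConsistent L) →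
      ClosePhase 𝔸 L T T₁ → ConsistencyPhase 𝔸 L T₁ T₂ →
      Step ⟨T, n, none⟩ ⟨T₂, n, none⟩
  | counterexample (T : Table α) (n : ℕ) (t : List α) : T.JoinClosed L 𝔸 → T.JoinConsistent L →
      ¬ (t ∈ L ↔ t ∈ (T.hypothesis L 𝔸).language) →
      Step ⟨T, n, none⟩
        ⟨⟨T.S, T.E ∪ ⋃ t₀ ∈ {t₀ | t₀ <:+ t}, MulAction.orbit (Equiv.Perm 𝔸) t₀⟩, n + 1, none⟩
  | accept (T : Table α) (n : ℕ) : T.JoinClosed L 𝔸 → T.JoinConsistent L →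
      (T.hypothesis L 𝔸).language = L →
      Step ⟨T, n, none⟩ ⟨T, n + 1, some (T.hypothesis L 𝔸)⟩

/-- The configurations that occur in runs of the algorithm on the target language `L`. -/
def Reachable (c : Config α) : Prop :=
  Relation.ReflTransGen (Step 𝔸 L) (initialConfig α) c

/-- Every run of the algorithm is finite, and it can only end by returning an automaton. -/
def EveryRunReturns : Prop :=
  (¬ ∃ f : ℕ → Config α, f 0 = initialConfig α ∧ ∀ i, Step 𝔸 L (f i) (f (i + 1))) ∧
  ∀ c : Config α, Reachable 𝔸 L c → (∀ c', ¬ Step 𝔸 L c c') → ∃ H, c.output = some H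

end Algorithm

end NominalLearning

/-! Correctness: for a join-closed table with suffix-closed columns, the state r of the hypothesis
accepts a column e exactly when e ∈ r. If the table is also join-consistent and the hypothesis
accepts L, then a state row(s) is the union of the states reached by s. Being join-irreducible, it
is one of them, and being the largest, it accepts s⁻¹L. So a returned automaton is residual
(`isResidual_hypothesis`), and only residual languages can be learned.

Termination: S is always Σ^{≤n} for some n. If L is residual, the derivatives by words of length at
most l generate all derivatives, so for n ≥ l the upper rows generate all rows and every
join-irreducible row is an upper row. Hence n never exceeds l. New columns can only refute
inclusions between rows, and pairs of row indices form finitely many orbits; repairing an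
inconsistency refutes at least one new orbit of inclusions.

Equivalence queries: the hypothesis depends only on the inclusions between rows and on the set of
join-irreducible upper rows (`language_hypothesis_subset`), and it is correct on all columns. Once a
counterexample has become a column, this data must therefore have changed by the next query. A row
can lose irreducibility, but for fixed n only if it gets separated from another row. Counting
refuted inclusions twice, irreducible indices once, and adding a compensation for each growth of n
gives a potential that increases strictly between queries (`Table.potential_lt`). It is bounded by a
constant times the number of orbits of Σ^{≤l} × Σ^{≤l+1}, plus terms of order |Σ^{≤l}|², since l ≤
|Σ^{≤l}| when there is a letter and l = 0 otherwise.

Counting: the extra letter in Σ^{≤l+1} naively costs a factor of order (dl)^d, which is not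
constant. If both words have supports of size at most d(l-1), the factor is absorbed by the growth
from p(d(l-1)) to p(dl) (`pairOrbits_add`). Words with a larger support are so rare that their
number times this factor is O(|Σ^{≤l}|) (`exists_large_support_bound`): almost all of their letters
share no atom with the others, and replacing d of these by copies of the first letter gives many
other words. -/

namespace NominalLearning

/-! ### Permutations of atoms and least supports -/

section Support

variable {𝔸 : Type v} {X : Type u} [MulAction (Equiv.Perm 𝔸) X]

/-- Two finite tuples of atoms with the same equality pattern are related by a permutation of
finite order. -/
theorem exists_perm_of_pattern {ι : Type*} [Finite ι] (x y : ι → 𝔸)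
    (h : ∀ i j, x i = x j ↔ y i = y j) :
    ∃ π : Equiv.Perm 𝔸, (∀ i, π (x i) = y i) ∧ ∃ n, 0 < n ∧ π ^ n = 1 := by
  classical
  -- The map x i ↦ y i is extended to a permutation of the finite set t and by the identity outside
  -- it. This is what makes the order finite.
  let t : Set 𝔸 := Set.range x ∪ Set.range y
  have : Finite t := ((Set.finite_range x).union (Set.finite_range y)).to_subtype
  have : Fintype t := Fintype.ofFinite t
  let p : t → Prop := fun a => a.1 ∈ Set.range x
  let q : t → Prop := fun a => a.1 ∈ Set.range y
  let f : {a // p a} → {a // q a} := fun a =>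
    ⟨⟨y a.2.choose, Or.inr ⟨_, rfl⟩⟩, ⟨_, rfl⟩⟩
  have hf : ∀ i (hi : p ⟨x i, Or.inl ⟨i, rfl⟩⟩), (f ⟨⟨x i, Or.inl ⟨i, rfl⟩⟩, hi⟩).1.1 = y i := by
    intro i hi
    exact (h _ _).1 hi.choose_spec
  have hbij : Function.Bijective f := by
    constructor
    · rintro ⟨⟨a, ha⟩, ⟨i, hi⟩⟩ ⟨⟨b, hb⟩, ⟨j, hj⟩⟩ hab
      obtain rfl : x i = a := hi
      obtain rfl : x j = b := hj
      have hy : y i = y j := (hf i ⟨i, rfl⟩).symm.trans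
        ((congrArg (fun z => z.1.1) hab).trans (hf j ⟨j, rfl⟩))
      exact Subtype.ext (Subtype.ext ((h i j).2 hy))
    · rintro ⟨⟨a, ha⟩, ⟨i, hi⟩⟩
      obtain rfl : y i = a := hi
      refine ⟨⟨⟨x i, Or.inl ⟨i, rfl⟩⟩, ⟨i, rfl⟩⟩, ?_⟩
      apply Subtype.ext
      apply Subtype.ext
      exact hf _ _
  let e : {a // p a} ≃ {a // q a} := Equiv.ofBijective f hbij
  let g : Equiv.Perm t := e.extendSubtype
  refine ⟨Equiv.Perm.ofSubtype g, fun i => ?_, orderOf g, orderOf_pos g, ?_⟩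
  · have hi : x i ∈ t := Or.inl ⟨i, rfl⟩
    rw [Equiv.Perm.ofSubtype_apply_of_mem g hi]
    have : g ⟨x i, hi⟩ = (e ⟨⟨x i, hi⟩, ⟨i, rfl⟩⟩).1 :=
      Equiv.extendSubtype_apply_of_mem e _ ⟨i, rfl⟩
    rw [this]
    exact hf i _
  · rw [← map_pow, pow_orderOf_eq_one, map_one]

theorem supports_smul {s : Finset 𝔸} {x : X} (h : MulAction.Supports (Equiv.Perm 𝔸) (s : Set 𝔸) x)
    (g : Equiv.Perm 𝔸) :
    MulAction.Supports (Equiv.Perm 𝔸) (s.map g.toEmbedding : Set 𝔸) (g • x) := by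
  intro k hk
  have := h (g⁻¹ * k * g) (fun a ha => by
    have := hk (a := g a) (by simpa using ha)
    simp only [Equiv.Perm.smul_def, Equiv.Perm.mul_apply] at this ⊢
    rw [this]; simp)
  rw [mul_smul, mul_smul, inv_smul_eq_iff] at this
  exact this

theorem FinitelySupported.smul {x : X} (h : FinitelySupported 𝔸 x) (g : Equiv.Perm 𝔸) :
    FinitelySupported 𝔸 (g • x) :=
  let ⟨_, hs⟩ := h
  ⟨_, supports_smul hs g⟩

theorem smul_eq_smul_of_eqOn {s : Set 𝔸} {x : X} (h : MulAction.Supports (Equiv.Perm 𝔸) s x)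
    {g k : Equiv.Perm 𝔸} (hgk : ∀ a ∈ s, g a = k a) : g • x = k • x := by
  have := h (k⁻¹ * g) (fun a ha => by
    simp [Equiv.Perm.smul_def, Equiv.Perm.mul_apply, hgk a ha])
  rwa [mul_smul, inv_smul_eq_iff] at this

theorem exists_fresh [Infinite 𝔸] (ι : Type*) [Finite ι] (t : Finset 𝔸) :
    ∃ e : ι → 𝔸, Function.Injective e ∧ ∀ i, e i ∉ t := by
  have : Infinite ((t : Set 𝔸)ᶜ : Set 𝔸) := (t.finite_toSet.infinite_compl).to_subtype
  obtain ⟨n, ⟨f⟩⟩ := Finite.exists_equiv_fin ι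
  let c := Infinite.natEmbedding ((t : Set 𝔸)ᶜ : Set 𝔸)
  refine ⟨fun i => (c (f i)).1, fun i j hij => ?_, fun i h => (c (f i)).2 h⟩
  have := c.injective (Subtype.ext hij)
  exact f.injective (Fin.ext this)

/-- Let π fix s ∩ t. A permutation ρ fixing t moves s \ t to fresh atoms, and η acts as π on s while
fixing the fresh atoms. Then η fixes ρ(s), so η * ρ and ρ agree on s. With ρ • x = x this gives η •
x = x, and π agrees with η on s. -/
theorem supports_inter [Infinite 𝔸] {s t : Finset 𝔸} {x : X}
    (hs : MulAction.Supports (Equiv.Perm 𝔸) (s : Set 𝔸) x)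
    (ht : MulAction.Supports (Equiv.Perm 𝔸) (t : Set 𝔸) x) :
    MulAction.Supports (Equiv.Perm 𝔸) ((s : Set 𝔸) ∩ t) x := by
  classical
  intro π hπ
  obtain ⟨e, he, het⟩ := exists_fresh (𝔸 := 𝔸) s (s ∪ t ∪ s.map π.toEmbedding)
  simp only [Finset.mem_union, not_or, Finset.mem_map_equiv] at het
  have het2 : ∀ i, ∀ a ∈ s, e i ≠ π a := by
    intro i a ha hia
    apply (het i).2
    rw [hia]; simpa using ha
  obtain ⟨ρ, hρ, -⟩ := exists_perm_of_pattern
    (Sum.elim (fun a : s => a.1) (fun a : t => a.1))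
    (Sum.elim (fun a : s => if a.1 ∈ t then a.1 else e a) (fun a : t => a.1)) (by
      rintro (⟨a, ha⟩ | ⟨a, ha⟩) (⟨b, hb⟩ | ⟨b, hb⟩)
      · simp only [Sum.elim_inl]
        split_ifs with h1 h2 h2
        · rfl
        · exact ⟨fun h => absurd (h ▸ h1) h2, fun h => absurd (h ▸ h1) (het _).1.2⟩
        · exact ⟨fun h => absurd (h ▸ h2) h1, fun h => absurd (h ▸ h2) (het _).1.2⟩
        · rw [he.eq_iff]; simp
      · simp only [Sum.elim_inl, Sum.elim_inr]
        split_ifs with h1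
        · rfl
        · exact ⟨fun h => absurd (h ▸ hb) h1, fun h => absurd (h ▸ hb) (het _).1.2⟩
      · simp only [Sum.elim_inl, Sum.elim_inr]
        split_ifs with h1
        · rfl
        · exact ⟨fun h => absurd (h ▸ ha) h1, fun h => absurd (h ▸ ha) (het _).1.2⟩
      · rfl)
  obtain ⟨η, hη, -⟩ := exists_perm_of_pattern
    (Sum.elim (fun a : s => a.1) (fun a : s => e a))
    (Sum.elim (fun a : s => π a.1) (fun a : s => e a)) (by
      rintro (⟨a, ha⟩ | ⟨a, ha⟩) (⟨b, hb⟩ | ⟨b, hb⟩)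
      · simp
      · simp only [Sum.elim_inl, Sum.elim_inr]
        exact ⟨fun h => absurd (h ▸ ha) (het _).1.1, fun h => absurd h.symm (het2 _ _ ha)⟩
      · simp only [Sum.elim_inl, Sum.elim_inr]
        exact ⟨fun h => absurd (h ▸ hb) (het _).1.1, fun h => absurd h (het2 _ _ hb)⟩
      · rfl)
  have hρx : ρ • x = x := ht ρ (fun a ha => hρ (Sum.inr ⟨a, ha⟩))
  have hηρ : (η * ρ) • x = ρ • x := by
    refine smul_eq_smul_of_eqOn hs (fun a ha => ?_)
    have h1 : ρ a = if a ∈ t then a else e ⟨a, ha⟩ := hρ (Sum.inl ⟨a, ha⟩)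
    rw [Equiv.Perm.mul_apply, h1]
    split_ifs with hat
    · have h2 : η a = π a := hη (Sum.inl ⟨a, ha⟩)
      rw [h2]
      exact hπ ⟨ha, hat⟩
    · exact hη (Sum.inr ⟨a, ha⟩)
  rw [mul_smul, hρx] at hηρ
  have : π • x = η • x := smul_eq_smul_of_eqOn hs (fun a ha => (hη (Sum.inl ⟨a, ha⟩)).symm)
  rw [this, hηρ]

/-- A support of least cardinality lies in every other finite support, as the intersection is a
support too. -/
theorem exists_least_support [Infinite 𝔸] {x : X} (hx : FinitelySupported 𝔸 x) :
    ∃ s : Finset 𝔸, MulAction.Supports (Equiv.Perm 𝔸) (s : Set 𝔸) x ∧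
      ∀ t : Finset 𝔸, MulAction.Supports (Equiv.Perm 𝔸) (t : Set 𝔸) x → s ⊆ t := by
  classical
  obtain ⟨s, hs, hmin⟩ := WellFounded.has_min (measure (Finset.card (α := 𝔸))).wf
    {s : Finset 𝔸 | MulAction.Supports (Equiv.Perm 𝔸) (s : Set 𝔸) x} hx
  refine ⟨s, hs, fun t ht => ?_⟩
  by_contra hst
  have h1 : s ∩ t ⊂ s := Finset.ssubset_iff_subset_ne.2
    ⟨Finset.inter_subset_left, fun h => hst (Finset.inter_eq_left.1 h)⟩
  refine hmin (s ∩ t) ?_ (Finset.card_lt_card h1)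
  have := supports_inter hs ht
  simpa using this

open Classical in
/-- The least finite support of `x` (empty if `x` has no finite support). -/
noncomputable def supp (𝔸 : Type v) [Infinite 𝔸] {X : Type u} [MulAction (Equiv.Perm 𝔸) X]
    (x : X) : Finset 𝔸 :=
  if h : FinitelySupported 𝔸 x then (exists_least_support h).choose else ∅

variable [Infinite 𝔸]

theorem supp_supports {x : X} (hx : FinitelySupported 𝔸 x) :
    MulAction.Supports (Equiv.Perm 𝔸) (supp 𝔸 x : Set 𝔸) x := by
  rw [supp, dif_pos hx]
  exact (exists_least_support hx).choose_spec.1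

theorem supp_subset {x : X} {t : Finset 𝔸}
    (ht : MulAction.Supports (Equiv.Perm 𝔸) (t : Set 𝔸) x) : supp 𝔸 x ⊆ t := by
  rw [supp, dif_pos ⟨t, ht⟩]
  exact (exists_least_support ⟨t, ht⟩).choose_spec.2 t ht

theorem supp_smul {x : X} (hx : FinitelySupported 𝔸 x) (g : Equiv.Perm 𝔸) :
    supp 𝔸 (g • x) = (supp 𝔸 x).map g.toEmbedding := by
  apply subset_antisymm
  · exact supp_subset (supports_smul (supp_supports hx) g)
  · have := supp_subset (supports_smul (supp_supports (hx.smul g)) g⁻¹)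
    rw [inv_smul_smul] at this
    intro a ha
    rw [Finset.mem_map_equiv] at ha
    have := this ha
    rw [Finset.mem_map_equiv] at this
    rwa [Equiv.Perm.inv_def, Equiv.symm_symm, Equiv.apply_symm_apply] at this

theorem mem_supp_smul {x : X} (hx : FinitelySupported 𝔸 x) {g : Equiv.Perm 𝔸} {a : 𝔸}
    (ha : a ∈ supp 𝔸 x) : g a ∈ supp 𝔸 (g • x) := by
  rw [supp_smul hx, Finset.mem_map_equiv]
  simpa using ha

theorem smul_eq_smul_of_eqOn_supp {x : X} (hx : FinitelySupported 𝔸 x)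
    {g k : Equiv.Perm 𝔸} (hgk : ∀ a ∈ supp 𝔸 x, g a = k a) : g • x = k • x :=
  smul_eq_smul_of_eqOn (supp_supports hx) hgk

/-- Permutations which act compatibly on the components of a tuple can be glued. -/
theorem exists_perm_glue {ι : Type*} [Finite ι] (x : ι → X) (hx : ∀ i, FinitelySupported 𝔸 (x i))
    (g : ι → Equiv.Perm 𝔸)
    (h : ∀ i j, ∀ a ∈ supp 𝔸 (x i), ∀ b ∈ supp 𝔸 (x j), a = b ↔ g i a = g j b) :
    ∃ π : Equiv.Perm 𝔸, ∀ i, π • x i = g i • x i := by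
  obtain ⟨π, hπ, -⟩ := exists_perm_of_pattern
    (fun z : (i : ι) × supp 𝔸 (x i) => z.2.1) (fun z : (i : ι) × supp 𝔸 (x i) => g z.1 z.2.1)
    (fun z w => h _ _ _ z.2.2 _ w.2.2)
  exact ⟨π, fun i => smul_eq_smul_of_eqOn_supp (hx i) (fun a ha => hπ ⟨i, ⟨a, ha⟩⟩)⟩

end Support

/-! ### Finitely supported elements and equivariant sets -/

section Closure

variable {𝔸 : Type v}

theorem FinitelySupported.prodMk {X Y : Type*} [MulAction (Equiv.Perm 𝔸) X]
    [MulAction (Equiv.Perm 𝔸) Y] {x : X} {y : Y} (hx : FinitelySupported 𝔸 x)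
    (hy : FinitelySupported 𝔸 y) : FinitelySupported 𝔸 (x, y) := by
  classical
  obtain ⟨s, hs⟩ := hx
  obtain ⟨t, ht⟩ := hy
  refine ⟨s ∪ t, fun g hg => ?_⟩
  exact Prod.ext (hs g fun a ha => hg (by simp [Finset.mem_coe.1 ha]))
    (ht g fun a ha => hg (by simp [Finset.mem_coe.1 ha]))

/-- The image of a finitely supported element under an equivariant function. -/
theorem FinitelySupported.map {X Y : Type*} [MulAction (Equiv.Perm 𝔸) X]
    [MulAction (Equiv.Perm 𝔸) Y] {x : X} (hx : FinitelySupported 𝔸 x) (f : X → Y)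
    (hf : ∀ (g : Equiv.Perm 𝔸) x, f (g • x) = g • f x) : FinitelySupported 𝔸 (f x) :=
  let ⟨s, hs⟩ := hx
  ⟨s, fun g hg => by rw [← hf, hs g hg]⟩

/-- A set that is mapped into itself by all permutations is equivariant. -/
theorem equivariant_of_smul_mem {X : Type*} [MulAction (Equiv.Perm 𝔸) X] {U : Set X}
    (h : ∀ (g : Equiv.Perm 𝔸), ∀ x ∈ U, g • x ∈ U) : Equivariant 𝔸 U := by
  intro g
  apply subset_antisymm
  · rintro _ ⟨x, hx, rfl⟩
    exact h g x hx
  · intro x hx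
    exact Set.mem_smul_set_iff_inv_smul_mem.2 (h _ _ hx)

theorem Equivariant.smul_mem {X : Type*} [MulAction (Equiv.Perm 𝔸) X] {U : Set X}
    (h : Equivariant 𝔸 U) (g : Equiv.Perm 𝔸) {x : X} (hx : x ∈ U) : g • x ∈ U := by
  rw [← h g]
  exact Set.smul_mem_smul_set hx

theorem Equivariant.smul_mem_iff {X : Type*} [MulAction (Equiv.Perm 𝔸) X] {U : Set X}
    (h : Equivariant 𝔸 U) (g : Equiv.Perm 𝔸) {x : X} : g • x ∈ U ↔ x ∈ U :=
  ⟨fun hx => by simpa using h.smul_mem g⁻¹ hx, h.smul_mem g⟩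

variable {α : Type u} [MulAction (Equiv.Perm 𝔸) α]

theorem smul_cons (g : Equiv.Perm 𝔸) (a : α) (w : List α) : g • (a :: w) = g • a :: g • w := rfl

theorem smul_append (g : Equiv.Perm 𝔸) (w w' : List α) : g • (w ++ w') = g • w ++ g • w' :=
  List.map_append

theorem length_smul (g : Equiv.Perm 𝔸) (w : List α) : (g • w).length = w.length :=
  List.length_map _

theorem finitelySupported_list (hα : ∀ a : α, FinitelySupported 𝔸 a) (w : List α) :
    FinitelySupported 𝔸 w := by
  induction w with
  | nil => exact ⟨∅, fun g _ => rfl⟩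
  | cons a w ih =>
    exact ((hα a).prodMk ih).map (fun p => p.1 :: p.2) (fun g x => rfl)

/-- A set defined from finitely supported data is finitely supported. -/
theorem finitelySupported_setOf {X Y : Type*} [MulAction (Equiv.Perm 𝔸) X]
    [MulAction (Equiv.Perm 𝔸) Y] {x : X} (hx : FinitelySupported 𝔸 x) (P : X → Y → Prop)
    (hP : ∀ (g : Equiv.Perm 𝔸) x y, P x y → P (g • x) (g • y)) :
    FinitelySupported 𝔸 {y | P x y} := by
  refine hx.map (fun x => {y | P x y}) (fun g x => ?_)
  ext y
  rw [Set.mem_smul_set_iff_inv_smul_mem]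
  refine ⟨fun h => ?_, fun h => ?_⟩
  · have := hP g⁻¹ _ _ h
    rwa [inv_smul_smul] at this
  · have := hP g _ _ h
    rwa [smul_inv_smul] at this

end Closure

/-! ### Counting orbits -/

section Orbits

variable {𝔸 : Type v}

section Basic

variable {X : Type*} [MulAction (Equiv.Perm 𝔸) X]

/-- The set of orbits of elements of `U`. -/
def orbits (𝔸 : Type v) {X : Type*} [MulAction (Equiv.Perm 𝔸) X] (U : Set X) : Set (Set X) :=
  (fun x => MulAction.orbit (Equiv.Perm 𝔸) x) '' U

theorem orbitCount_eq {X : Type u} [MulAction (Equiv.Perm 𝔸) X] (U : Set X) :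
    orbitCount 𝔸 U = (orbits 𝔸 U).ncard := rfl

theorem orbit_eq_iff_exists {x y : X} :
    MulAction.orbit (Equiv.Perm 𝔸) x = MulAction.orbit (Equiv.Perm 𝔸) y ↔
      ∃ g : Equiv.Perm 𝔸, x = g • y := by
  rw [MulAction.orbit_eq_iff, MulAction.mem_orbit_iff]
  exact exists_congr fun g => eq_comm

theorem orbits_mono {U V : Set X} (h : U ⊆ V) : orbits 𝔸 U ⊆ orbits 𝔸 V := Set.image_mono h

theorem mem_of_orbit_mem_orbits {U : Set X} (hU : Equivariant 𝔸 U) {x : X}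
    (h : MulAction.orbit (Equiv.Perm 𝔸) x ∈ orbits 𝔸 U) : x ∈ U := by
  obtain ⟨y, hy, hxy⟩ := h
  obtain ⟨g, rfl⟩ := orbit_eq_iff_exists.1 hxy.symm
  exact hU.smul_mem g hy

theorem orbitFinite_iff {U : Set X} :
    OrbitFinite 𝔸 U ↔ Equivariant 𝔸 U ∧ (orbits 𝔸 U).Finite := by
  classical
  constructor
  · rintro ⟨F, rfl⟩
    constructor
    · refine equivariant_of_smul_mem fun g x hx => ?_
      simp only [Set.mem_iUnion] at hx ⊢
      obtain ⟨y, hy, hxy⟩ := hx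
      exact ⟨y, hy, MulAction.mapsTo_smul_orbit g y hxy⟩
    · refine (F.finite_toSet.image (fun x => MulAction.orbit (Equiv.Perm 𝔸) x)).subset ?_
      rintro _ ⟨x, hx, rfl⟩
      simp only [Set.mem_iUnion] at hx
      obtain ⟨y, hy, hxy⟩ := hx
      exact ⟨y, hy, (MulAction.orbit_eq_iff.2 hxy).symm⟩
  · rintro ⟨hU, hfin⟩
    obtain ⟨F, hFU, hF⟩ := Set.exists_subset_bijOn U
      (fun x => MulAction.orbit (Equiv.Perm 𝔸) x)
    have hFfin : F.Finite := Set.Finite.of_finite_image (hF.image_eq ▸ hfin) hF.injOn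
    refine ⟨hFfin.toFinset, ?_⟩
    ext x
    simp only [Set.mem_iUnion, Set.Finite.mem_toFinset]
    constructor
    · intro hx
      have : MulAction.orbit (Equiv.Perm 𝔸) x ∈ orbits 𝔸 U := ⟨x, hx, rfl⟩
      rw [orbits, ← hF.image_eq] at this
      obtain ⟨y, hy, hxy⟩ := this
      exact ⟨y, hy, MulAction.orbit_eq_iff.1 hxy.symm⟩
    · rintro ⟨y, hy, g, rfl⟩
      exact hU.smul_mem g (hFU hy)

/-- Tool for upper bounds. The function f need not be invariant: it suffices that each value is
taken on a single orbit only. -/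
theorem orbits_separating {Y : Type*} {U : Set X} {T : Set Y} (f : X → Y) (hT : T.Finite)
    (hf : ∀ x ∈ U, f x ∈ T)
    (hsep : ∀ x ∈ U, ∀ y ∈ U, f x = f y → ∃ g : Equiv.Perm 𝔸, x = g • y) :
    (orbits 𝔸 U).Finite ∧ (orbits 𝔸 U).ncard ≤ T.ncard := by
  classical
  let F : Y → Set X := fun y =>
    if h : ∃ x ∈ U, f x = y then MulAction.orbit (Equiv.Perm 𝔸) h.choose else ∅
  have hF : orbits 𝔸 U ⊆ F '' T := by
    rintro _ ⟨x, hx, rfl⟩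
    refine ⟨f x, hf x hx, ?_⟩
    have h : ∃ x' ∈ U, f x' = f x := ⟨x, hx, rfl⟩
    simp only [F, dif_pos h]
    exact orbit_eq_iff_exists.2 (hsep _ h.choose_spec.1 _ hx h.choose_spec.2)
  exact ⟨(hT.image F).subset hF,
    (Set.ncard_le_ncard hF (hT.image F)).trans (Set.ncard_image_le hT)⟩

/-- Tool for lower bounds: an invariant function is constant on orbits, so each of its values needs
an orbit of its own. -/
theorem ncard_le_orbits_of_invariant {Y : Type*} {U : Set X} {T : Set Y} (f : X → Y)
    (hU : (orbits 𝔸 U).Finite) (hT : T ⊆ f '' U)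
    (hf : ∀ (g : Equiv.Perm 𝔸) x, f (g • x) = f x) :
    T.ncard ≤ (orbits 𝔸 U).ncard := by
  classical
  let F : Set X → Set Y := fun O => f '' O
  have hF : T.ncard = ((fun y => ({y} : Set Y)) '' T).ncard :=
    (Set.ncard_image_of_injective _ Set.singleton_injective).symm
  have hsub : (fun y => ({y} : Set Y)) '' T ⊆ F '' (orbits 𝔸 U) := by
    rintro _ ⟨y, hy, rfl⟩
    obtain ⟨x, hx, rfl⟩ := hT hy
    refine ⟨_, ⟨x, hx, rfl⟩, ?_⟩
    ext z
    constructor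
    · rintro ⟨_, ⟨g, rfl⟩, rfl⟩
      exact hf g x
    · rintro rfl
      exact ⟨x, MulAction.mem_orbit_self x, rfl⟩
  rw [hF]
  exact (Set.ncard_le_ncard hsub (hU.image F)).trans (Set.ncard_image_le hU)

theorem orbits_image {Y : Type*} [MulAction (Equiv.Perm 𝔸) Y] {U : Set X} (f : X → Y)
    (hf : ∀ (g : Equiv.Perm 𝔸) x, f (g • x) = g • f x) (hU : (orbits 𝔸 U).Finite) :
    (orbits 𝔸 (f '' U)).Finite ∧ (orbits 𝔸 (f '' U)).ncard ≤ (orbits 𝔸 U).ncard := by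
  have h : orbits 𝔸 (f '' U) ⊆ (fun O => f '' O) '' orbits 𝔸 U := by
    rintro _ ⟨_, ⟨x, hx, rfl⟩, rfl⟩
    refine ⟨_, ⟨x, hx, rfl⟩, ?_⟩
    ext y
    constructor
    · rintro ⟨_, ⟨g, rfl⟩, rfl⟩
      exact ⟨g, (hf g x).symm⟩
    · rintro ⟨g, rfl⟩
      exact ⟨_, ⟨g, rfl⟩, hf g x⟩
  exact ⟨(hU.image _).subset h, (Set.ncard_le_ncard h (hU.image _)).trans (Set.ncard_image_le hU)⟩

theorem Equivariant.image {Y : Type*} [MulAction (Equiv.Perm 𝔸) Y] {U : Set X}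
    (hU : Equivariant 𝔸 U) (f : X → Y) (hf : ∀ (g : Equiv.Perm 𝔸) x, f (g • x) = g • f x) :
    Equivariant 𝔸 (f '' U) := by
  refine equivariant_of_smul_mem ?_
  rintro g _ ⟨x, hx, rfl⟩
  exact ⟨g • x, hU.smul_mem g hx, hf g x⟩

theorem OrbitFinite.image {Y : Type*} [MulAction (Equiv.Perm 𝔸) Y] {U : Set X}
    (hU : OrbitFinite 𝔸 U) (f : X → Y) (hf : ∀ (g : Equiv.Perm 𝔸) x, f (g • x) = g • f x) :
    OrbitFinite 𝔸 (f '' U) := by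
  rw [orbitFinite_iff] at hU ⊢
  exact ⟨hU.1.image f hf, (orbits_image f hf hU.2).1⟩

theorem OrbitFinite.union {U V : Set X} (hU : OrbitFinite 𝔸 U) (hV : OrbitFinite 𝔸 V) :
    OrbitFinite 𝔸 (U ∪ V) := by
  rw [orbitFinite_iff] at hU hV ⊢
  refine ⟨fun g => ?_, ?_⟩
  · rw [Set.smul_set_union, hU.1, hV.1]
  · rw [orbits, Set.image_union]
    exact hU.2.union hV.2

theorem OrbitFinite.subset {U V : Set X} (hV : OrbitFinite 𝔸 V) (hU : Equivariant 𝔸 U)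
    (h : U ⊆ V) : OrbitFinite 𝔸 U :=
  orbitFinite_iff.2 ⟨hU, (orbitFinite_iff.1 hV).2.subset (orbits_mono h)⟩

theorem orbitFinite_orbit (x : X) : OrbitFinite 𝔸 (MulAction.orbit (Equiv.Perm 𝔸) x) :=
  ⟨{x}, by simp⟩

end Basic

/-! ### Tuples of distinct atoms -/

/-- Pairs of tuples of pairwise distinct atoms. -/
def injectivePairs (𝔸 : Type v) (k m : ℕ) : Set ((Fin k → 𝔸) × (Fin m → 𝔸)) :=
  {x | Function.Injective x.1 ∧ Function.Injective x.2}

theorem pairOrbits_eq (k : ℕ) : pairOrbits 𝔸 k = (orbits 𝔸 (injectivePairs 𝔸 k k)).ncard := rfl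

/-- The orbit of a pair is determined by which entries coincide. Each of the m entries of the second
tuple either equals one of the k entries of the first or none of them. -/
theorem injectivePairs_orbits (k m : ℕ) :
    (orbits 𝔸 (injectivePairs 𝔸 k m)).Finite ∧
      (orbits 𝔸 (injectivePairs 𝔸 k m)).ncard ≤ (k + 1) ^ m := by
  classical
  let f : (Fin k → 𝔸) × (Fin m → 𝔸) → Fin m → Option (Fin k) := fun x j =>
    if h : ∃ i, x.1 i = x.2 j then some h.choose else none
  have key : ∀ x ∈ injectivePairs 𝔸 k m, ∀ i j, f x j = some i ↔ x.1 i = x.2 j := by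
    intro x hx i j
    simp only [f]
    split_ifs with h
    · rw [Option.some_inj]
      exact ⟨fun hi => hi ▸ h.choose_spec, fun hi => hx.1 (h.choose_spec.trans hi.symm)⟩
    · exact ⟨fun h' => by simp at h', fun hi => absurd ⟨i, hi⟩ h⟩
  have := orbits_separating (𝔸 := 𝔸) (U := injectivePairs 𝔸 k m) f Set.finite_univ
    (fun _ _ => Set.mem_univ _) (by
      intro x hx y hy hxy
      have hp : ∀ i j, x.1 i = x.2 j ↔ y.1 i = y.2 j := fun i j => by
        rw [← key x hx, hxy, key y hy]
      obtain ⟨π, hπ, -⟩ := exists_perm_of_pattern (Sum.elim y.1 y.2) (Sum.elim x.1 x.2) (by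
        rintro (i | i) (j | j)
        · simp only [Sum.elim_inl]; rw [hx.1.eq_iff, hy.1.eq_iff]
        · simpa using (hp i j).symm
        · simpa [eq_comm] using (hp j i).symm
        · simp only [Sum.elim_inr]; rw [hx.2.eq_iff, hy.2.eq_iff])
      refine ⟨π, Prod.ext (funext fun i => ?_) (funext fun i => ?_)⟩
      · exact (hπ (Sum.inl i)).symm
      · exact (hπ (Sum.inr i)).symm)
  refine ⟨this.1, this.2.trans ?_⟩
  rw [Set.ncard_univ, Nat.card_eq_fintype_card]
  simp

/-- The head of the second tuple has k + 2 possible positions relative to the first: equal to one of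
its k + 1 entries, or to none. Deleting the head and the matched entry (entry 0 if there is none)
leaves a pair of k-tuples, whose orbit can be prescribed independently of that position. -/
theorem pairOrbits_succ [Infinite 𝔸] (k : ℕ) :
    (k + 2) * pairOrbits 𝔸 k ≤ pairOrbits 𝔸 (k + 1) := by
  classical
  let pos : (Fin (k + 1) → Prop) → Option (Fin (k + 1)) := fun p =>
    if h : ∃ i, p i then some h.choose else none
  let f : (Fin (k + 1) → 𝔸) × (Fin (k + 1) → 𝔸) →
      Option (Fin (k + 1)) × Set ((Fin k → 𝔸) × (Fin k → 𝔸)) := fun x =>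
    (pos fun i => x.1 i = x.2 0, MulAction.orbit (Equiv.Perm 𝔸)
      (fun i => x.1 (((pos fun i => x.1 i = x.2 0).getD 0).succAbove i), fun i => x.2 i.succ))
  have := ncard_le_orbits_of_invariant (𝔸 := 𝔸) (U := injectivePairs 𝔸 (k + 1) (k + 1))
    (T := Set.univ ×ˢ orbits 𝔸 (injectivePairs 𝔸 k k)) f (injectivePairs_orbits _ _).1 (by
      rintro ⟨o, _⟩ ⟨-, ⟨⟨x, y⟩, ⟨hx, hy⟩, rfl⟩⟩
      simp only at hx hy
      obtain ⟨e, he, het⟩ := exists_fresh (𝔸 := 𝔸) Bool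
        (Finset.univ.image x ∪ Finset.univ.image y)
      simp only [Finset.mem_union, not_or, Finset.mem_image, Finset.mem_univ, true_and,
        not_exists] at het
      -- The inserted entry is the fresh atom `e true`. The new head is the same atom if a match is
      -- prescribed and the other fresh atom `e false` if not.
      let x' : Fin (k + 1) → 𝔸 := Fin.insertNth (α := fun _ => 𝔸) (o.getD 0) (e true) x
      let y' : Fin (k + 1) → 𝔸 := Fin.cons (e o.isSome) y
      have hx0 : x' (o.getD 0) = e true := by simp [x']
      have hxs : ∀ i, x' ((o.getD 0).succAbove i) = x i := by simp [x']
      have hx' : Function.Injective x' := by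
        intro i j
        induction i using Fin.succAboveCases (o.getD 0) <;>
          induction j using Fin.succAboveCases (o.getD 0)
        · simp
        · rw [hx0, hxs]; exact fun h => absurd h.symm ((het _).1 _)
        · rw [hx0, hxs]; exact fun h => absurd h ((het _).1 _)
        · rw [hxs, hxs]; exact fun h => congrArg _ (hx h)
      have hy' : Function.Injective y' :=
        Fin.cons_injective_iff.2 ⟨by rintro ⟨i, hi⟩; exact (het _).2 _ hi, hy⟩
      have hpos : (pos fun i => x' i = y' 0) = o := by
        have hpi : ∀ i, x' i = y' 0 ↔ o = some i := by
          intro i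
          cases o with
          | none =>
            simp only [y', Option.isSome_none, Fin.cons_zero, reduceCtorEq, iff_false]
            induction i using Fin.succAboveCases ((none : Option (Fin (k + 1))).getD 0)
            · rw [hx0]; exact fun h => by simpa using he h
            · rw [hxs]; exact (het _).1 _
          | some j =>
            simp only [y', Option.isSome_some, Fin.cons_zero, Option.some_inj]
            rw [← hx0, hx'.eq_iff, eq_comm]
            rfl
        simp only [pos]
        split_ifs with h
        · exact ((hpi _).1 h.choose_spec).symm
        · cases o with
          | none => rfl
          | some j => exact absurd ⟨j, (hpi j).2 rfl⟩ h
      refine ⟨(x', y'), ⟨hx', hy'⟩, ?_⟩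
      simp only [f, hpos, hxs, y', Fin.cons_succ])
    (by
      intro g x
      have hp : (fun i => (g • x).1 i = (g • x).2 0) = fun i => x.1 i = x.2 0 := by
        funext i
        simp
      simp only [f, hp, Prod.mk.injEq, true_and]
      exact orbit_eq_iff_exists.2 ⟨g, rfl⟩)
  rw [Set.ncard_prod, Set.ncard_univ, Nat.card_eq_fintype_card] at this
  rw [pairOrbits_eq, pairOrbits_eq]
  simpa using this

theorem pairOrbits_add [Infinite 𝔸] (k d : ℕ) :
    (k + 2) ^ d * pairOrbits 𝔸 k ≤ pairOrbits 𝔸 (k + d) := by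
  induction d with
  | zero => simp
  | succ d ih =>
    calc (k + 2) ^ (d + 1) * pairOrbits 𝔸 k = (k + 2) * ((k + 2) ^ d * pairOrbits 𝔸 k) := by ring
      _ ≤ (k + d + 2) * pairOrbits 𝔸 (k + d) := Nat.mul_le_mul (by omega) ih
      _ ≤ _ := pairOrbits_succ _

theorem pairOrbits_pos [Infinite 𝔸] (k : ℕ) : 0 < pairOrbits 𝔸 k := by
  rw [pairOrbits_eq, Set.ncard_pos (injectivePairs_orbits k k).1]
  obtain ⟨e, he, -⟩ := exists_fresh (𝔸 := 𝔸) (Fin k) ∅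
  exact ⟨_, ⟨(e, e), ⟨he, he⟩, rfl⟩⟩

/-! ### Products -/

/-- `x` has a support with at most `k` elements. -/
def SupportedBy (𝔸 : Type v) (k : ℕ) {X : Type*} [MulAction (Equiv.Perm 𝔸) X] (x : X) : Prop :=
  ∃ s : Finset 𝔸, s.card ≤ k ∧ MulAction.Supports (Equiv.Perm 𝔸) (s : Set 𝔸) x

section Product

variable {X Y : Type*} [MulAction (Equiv.Perm 𝔸) X] [MulAction (Equiv.Perm 𝔸) Y]

theorem SupportedBy.mono {k m : ℕ} {x : X} (h : SupportedBy 𝔸 k x) (hkm : k ≤ m) :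
    SupportedBy 𝔸 m x :=
  let ⟨s, hs, hx⟩ := h
  ⟨s, hs.trans hkm, hx⟩

theorem SupportedBy.smul {k : ℕ} {x : X} (h : SupportedBy 𝔸 k x) (g : Equiv.Perm 𝔸) :
    SupportedBy 𝔸 k (g • x) :=
  let ⟨s, hs, hx⟩ := h
  ⟨s.map g.toEmbedding, by simpa using hs, supports_smul hx g⟩

theorem SupportedBy.prodMk {k m : ℕ} {x : X} {y : Y} (hx : SupportedBy 𝔸 k x)
    (hy : SupportedBy 𝔸 m y) : SupportedBy 𝔸 (k + m) (x, y) := by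
  classical
  obtain ⟨s, hsk, hs⟩ := hx
  obtain ⟨t, htm, ht⟩ := hy
  refine ⟨s ∪ t, (Finset.card_union_le _ _).trans (by omega), fun g hg => ?_⟩
  exact Prod.ext (hs g fun a ha => hg (by simp [Finset.mem_coe.1 ha]))
    (ht g fun a ha => hg (by simp [Finset.mem_coe.1 ha]))

theorem SupportedBy.exists_tuple [Infinite 𝔸] {k : ℕ} {x : X} (h : SupportedBy 𝔸 k x) :
    ∃ z : Fin k → 𝔸, Function.Injective z ∧
      MulAction.Supports (Equiv.Perm 𝔸) (Set.range z) x := by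
  obtain ⟨s, hs, hx⟩ := h
  obtain ⟨t, hst, ht⟩ := Infinite.exists_superset_card_eq s k hs
  refine ⟨fun i => (t.equivFinOfCardEq ht).symm i, fun i j hij => ?_, hx.mono ?_⟩
  · exact (t.equivFinOfCardEq ht).symm.injective (Subtype.ext hij)
  · intro a ha
    exact ⟨t.equivFinOfCardEq ht ⟨a, hst ha⟩, by simp⟩

/-- The orbits of a product of orbit-finite sets. -/
theorem orbits_prod [Infinite 𝔸] {U : Set X} {V : Set Y} {k m : ℕ}
    (hU : (orbits 𝔸 U).Finite) (hV : (orbits 𝔸 V).Finite)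
    (hUk : ∀ x ∈ U, SupportedBy 𝔸 k x) (hVm : ∀ y ∈ V, SupportedBy 𝔸 m y) :
    (orbits 𝔸 (U ×ˢ V)).Finite ∧ (orbits 𝔸 (U ×ˢ V)).ncard ≤
      (orbits 𝔸 U).ncard * (orbits 𝔸 V).ncard * (orbits 𝔸 (injectivePairs 𝔸 k m)).ncard := by
  classical
  -- Every element is a permuted orbit representative, and each representative needed carries a
  -- fixed supporting tuple of distinct atoms. The orbit of the pair of permuted tuples records what
  -- the separate orbits of x and y forget.
  let rX : X → X := fun x => (Quotient.mk (MulAction.orbitRel (Equiv.Perm 𝔸) X) x).out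
  let rY : Y → Y := fun y => (Quotient.mk (MulAction.orbitRel (Equiv.Perm 𝔸) Y) y).out
  have hrX : ∀ x, ∃ g : Equiv.Perm 𝔸, x = g • rX x := fun x => by
    obtain ⟨g, hg⟩ := (Quotient.mk_out (s := MulAction.orbitRel (Equiv.Perm 𝔸) X) x)
    exact ⟨g⁻¹, (inv_smul_eq_iff.2 hg.symm).symm⟩
  have hrY : ∀ y, ∃ g : Equiv.Perm 𝔸, y = g • rY y := fun y => by
    obtain ⟨g, hg⟩ := (Quotient.mk_out (s := MulAction.orbitRel (Equiv.Perm 𝔸) Y) y)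
    exact ⟨g⁻¹, (inv_smul_eq_iff.2 hg.symm).symm⟩
  have hrX' : ∀ x x', MulAction.orbit (Equiv.Perm 𝔸) x = MulAction.orbit (Equiv.Perm 𝔸) x' →
      rX x = rX x' := fun x x' h => congrArg Quotient.out
    (Quotient.sound (s := MulAction.orbitRel (Equiv.Perm 𝔸) X) (MulAction.orbit_eq_iff.1 h))
  have hrY' : ∀ y y', MulAction.orbit (Equiv.Perm 𝔸) y = MulAction.orbit (Equiv.Perm 𝔸) y' →
      rY y = rY y' := fun y y' h => congrArg Quotient.out
    (Quotient.sound (s := MulAction.orbitRel (Equiv.Perm 𝔸) Y) (MulAction.orbit_eq_iff.1 h))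
  choose gX hgX using hrX
  choose gY hgY using hrY
  obtain ⟨e, -, -⟩ := exists_fresh (𝔸 := 𝔸) (Fin k) ∅
  obtain ⟨e', -, -⟩ := exists_fresh (𝔸 := 𝔸) (Fin m) ∅
  let zX : X → Fin k → 𝔸 := fun x => if h : SupportedBy 𝔸 k x then h.exists_tuple.choose else e
  let zY : Y → Fin m → 𝔸 := fun y => if h : SupportedBy 𝔸 m y then h.exists_tuple.choose else e'
  have hzX : ∀ x ∈ U, Function.Injective (zX (rX x)) ∧
      MulAction.Supports (Equiv.Perm 𝔸) (Set.range (zX (rX x))) (rX x) := by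
    intro x hx
    have h : SupportedBy 𝔸 k (rX x) := by
      have := (hUk x hx).smul (gX x)⁻¹
      rwa [inv_smul_eq_iff.2 (hgX x)] at this
    simp only [zX, dif_pos h]
    exact h.exists_tuple.choose_spec
  have hzY : ∀ x ∈ V, Function.Injective (zY (rY x)) ∧
      MulAction.Supports (Equiv.Perm 𝔸) (Set.range (zY (rY x))) (rY x) := by
    intro x hx
    have h : SupportedBy 𝔸 m (rY x) := by
      have := (hVm x hx).smul (gY x)⁻¹
      rwa [inv_smul_eq_iff.2 (hgY x)] at this
    simp only [zY, dif_pos h]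
    exact h.exists_tuple.choose_spec
  let f : X × Y → (Set X × Set Y) × Set ((Fin k → 𝔸) × (Fin m → 𝔸)) := fun p =>
    ((MulAction.orbit (Equiv.Perm 𝔸) p.1, MulAction.orbit (Equiv.Perm 𝔸) p.2),
      MulAction.orbit (Equiv.Perm 𝔸) (gX p.1 • zX (rX p.1), gY p.2 • zY (rY p.2)))
  have := orbits_separating (𝔸 := 𝔸) (U := U ×ˢ V)
    (T := (orbits 𝔸 U ×ˢ orbits 𝔸 V) ×ˢ orbits 𝔸 (injectivePairs 𝔸 k m)) f
    ((hU.prod hV).prod (injectivePairs_orbits k m).1) (by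
      rintro ⟨x, y⟩ ⟨hx, hy⟩
      refine ⟨⟨⟨x, hx, rfl⟩, ⟨y, hy, rfl⟩⟩, ⟨_, ⟨?_, ?_⟩, rfl⟩⟩
      · exact (MulAction.injective (gX x)).comp (hzX x hx).1
      · exact (MulAction.injective (gY y)).comp (hzY y hy).1) (by
      rintro ⟨x, y⟩ ⟨hx, hy⟩ ⟨x', y'⟩ ⟨hx', hy'⟩ h
      simp only [f, Prod.mk.injEq] at h
      obtain ⟨⟨h1, h2⟩, h3⟩ := h
      have e1 := hrX' _ _ h1
      have e2 := hrY' _ _ h2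
      obtain ⟨π, hπ⟩ := orbit_eq_iff_exists.1 h3
      rw [Prod.smul_mk, Prod.mk.injEq] at hπ
      refine ⟨π, Prod.ext ?_ ?_⟩
      · change x = π • x'
        rw [hgX x, hgX x', smul_smul, ← e1]
        refine smul_eq_smul_of_eqOn (hzX x hx).2 ?_
        rintro _ ⟨i, rfl⟩
        have := congrFun hπ.1 i
        rw [← e1] at this
        exact this
      · change y = π • y'
        rw [hgY y, hgY y', smul_smul, ← e2]
        refine smul_eq_smul_of_eqOn (hzY y hy).2 ?_
        rintro _ ⟨i, rfl⟩
        have := congrFun hπ.2 i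
        rw [← e2] at this
        exact this)
  rw [Set.ncard_prod, Set.ncard_prod] at this
  exact this

/-- The elements of an orbit-finite nominal set have supports of bounded size. -/
theorem OrbitFinite.exists_supportedBy {U : Set X} (hU : OrbitFinite 𝔸 U)
    (hfs : ∀ x ∈ U, FinitelySupported 𝔸 x) : ∃ k, ∀ x ∈ U, SupportedBy 𝔸 k x := by
  obtain ⟨F, rfl⟩ := hU
  have : ∀ x ∈ F, ∃ k, SupportedBy 𝔸 k x := fun x hx => by
    obtain ⟨s, hs⟩ := hfs x (Set.mem_biUnion hx (MulAction.mem_orbit_self x))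
    exact ⟨s.card, s, le_rfl, hs⟩
  choose! k hk using this
  refine ⟨F.sup k, fun y hy => ?_⟩
  simp only [Set.mem_iUnion] at hy
  obtain ⟨x, hx, g, rfl⟩ := hy
  exact ((hk x hx).mono (Finset.le_sup hx)).smul g

theorem OrbitFinite.prod [Infinite 𝔸] {U : Set X} {V : Set Y} (hU : OrbitFinite 𝔸 U)
    (hV : OrbitFinite 𝔸 V) (hUs : ∀ x ∈ U, FinitelySupported 𝔸 x)
    (hVs : ∀ y ∈ V, FinitelySupported 𝔸 y) : OrbitFinite 𝔸 (U ×ˢ V) := by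
  obtain ⟨k, hk⟩ := hU.exists_supportedBy hUs
  obtain ⟨m, hm⟩ := hV.exists_supportedBy hVs
  rw [orbitFinite_iff] at hU hV ⊢
  refine ⟨equivariant_of_smul_mem ?_, (orbits_prod hU.2 hV.2 hk hm).1⟩
  rintro g ⟨x, y⟩ ⟨hx, hy⟩
  exact ⟨hU.1.smul_mem g hx, hV.1.smul_mem g hy⟩

end Product

end Orbits

/-! ### Join-irreducible elements -/

section JoinIrreducible

variable {𝔸 : Type v} {Z : Type u} [MulAction (Equiv.Perm 𝔸) Z]

theorem joinIrreducibles_subset (X : Set (Set Z)) : joinIrreducibles 𝔸 X ⊆ X := fun _ hx => hx.1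

theorem finitelySupported_below {Y : Set (Set Z)} (hY : Equivariant 𝔸 Y) {x : Set Z}
    (hx : FinitelySupported 𝔸 x) : FinitelySupported 𝔸 {y | y ∈ Y ∧ y ⊆ x} :=
  finitelySupported_setOf hx (fun x y => y ∈ Y ∧ y ⊆ x) (fun g _ _ h =>
    ⟨hY.smul_mem g h.1, Set.smul_set_mono h.2⟩)

/-- If `Y ⊆ X` generates `X` under unions, then both have the same join-irreducible elements. -/
theorem joinIrreducibles_eq_of_generates {X Y : Set (Set Z)} (hXs : ∀ x ∈ X, FinitelySupported 𝔸 x)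
    (hY : Equivariant 𝔸 Y) (hYX : Y ⊆ X)
    (hgen : ∀ x ∈ X, ∀ z ∈ x, ∃ y ∈ Y, y ⊆ x ∧ z ∈ y) :
    joinIrreducibles 𝔸 X = joinIrreducibles 𝔸 Y := by
  apply subset_antisymm
  · rintro x ⟨hxX, hne, hx⟩
    refine ⟨?_, hne, fun F hF => hx F (hF.trans hYX)⟩
    -- An irreducible x is the union of the members of Y below it, hence one of them.
    refine (hx {y | y ∈ Y ∧ y ⊆ x} (fun y hy => hYX hy.1)
      (finitelySupported_below hY (hXs x hxX)) ?_).1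
    ext z
    constructor
    · intro hz
      obtain ⟨y, hy, hyx, hzy⟩ := hgen x hxX z hz
      exact ⟨y, ⟨hy, hyx⟩, hzy⟩
    · rintro ⟨y, hy, hzy⟩
      exact hy.2 hzy
  · rintro x ⟨hxY, hne, hx⟩
    refine ⟨hYX hxY, hne, fun F hF hFs hxF => ?_⟩
    -- Replacing F by the members of Y below some element of F keeps the union and finite support.
    -- If x is such a member, it lies below some f ∈ F and therefore equals f.
    have := hx {y | y ∈ Y ∧ ∃ f ∈ F, y ⊆ f} (fun y hy => hy.1)
      (finitelySupported_setOf hFs (fun F y => y ∈ Y ∧ ∃ f ∈ F, y ⊆ f) ?_) ?_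
    · obtain ⟨-, f, hf, hxf⟩ := this
      have : x = f := subset_antisymm hxf (hxF ▸ Set.subset_sUnion_of_mem hf)
      exact this ▸ hf
    · rintro g F y ⟨hy, f, hf, hyf⟩
      exact ⟨hY.smul_mem g hy, g • f, Set.smul_mem_smul_set hf, Set.smul_set_mono hyf⟩
    · ext z
      constructor
      · intro hz
        rw [hxF] at hz
        obtain ⟨f, hf, hzf⟩ := hz
        obtain ⟨y, hy, hyf, hzy⟩ := hgen f (hF hf) z hzf
        exact ⟨y, ⟨hy, f, hf, hyf⟩, hzy⟩
      · rintro ⟨y, ⟨-, f, hf, hyf⟩, hzy⟩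
        rw [hxF]
        exact ⟨f, hf, hyf hzy⟩

theorem equivariant_joinIrreducibles {X : Set (Set Z)} (hX : Equivariant 𝔸 X) :
    Equivariant 𝔸 (joinIrreducibles 𝔸 X) := by
  refine equivariant_of_smul_mem ?_
  rintro g x ⟨hxX, hne, hx⟩
  refine ⟨hX.smul_mem g hxX, hne.smul_set, fun F hF hFs hxF => ?_⟩
  have := hx (g⁻¹ • F) ?_ (hFs.smul g⁻¹) ?_
  · rwa [Set.mem_smul_set_iff_inv_smul_mem, inv_inv] at this
  · rw [← hX g⁻¹]
    exact Set.smul_set_mono hF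
  · rw [← inv_smul_smul g x, hxF]
    ext z
    simp only [Set.mem_smul_set_iff_inv_smul_mem, Set.mem_sUnion, inv_inv]
    constructor
    · rintro ⟨f, hf, hz⟩
      exact ⟨g⁻¹ • f, by simpa using hf, by simpa [Set.mem_smul_set_iff_inv_smul_mem] using hz⟩
    · rintro ⟨f, hf, hz⟩
      exact ⟨g • f, hf, by simpa using hz⟩

/-- A finitely supported set is not properly contained in an element of its orbit. -/
theorem eq_of_subset_smul {x : Set Z} (hx : FinitelySupported 𝔸 x) (π : Equiv.Perm 𝔸)
    (h : x ⊆ π • x) : x = π • x := by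
  obtain ⟨s, hs⟩ := hx
  -- Since ρ has finite order n and acts on x as π does, the chain x ⊆ ρ • x ⊆ … ⊆ ρ ^ n • x = x
  -- closes up.
  obtain ⟨ρ, hρ, n, hn, hρn⟩ := exists_perm_of_pattern (fun a : s => a.1) (fun a : s => π a.1)
    (fun a b => by simp)
  have hρx : ρ • x = π • x := smul_eq_smul_of_eqOn hs (fun a ha => hρ ⟨a, ha⟩)
  rw [← hρx] at h ⊢
  have hk : ∀ k, ρ • x ⊆ ρ ^ (k + 1) • x := by
    intro k
    induction k with
    | zero => simp
    | succ k ih =>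
      refine ih.trans ?_
      rw [pow_succ (n := k + 1), mul_smul]
      exact Set.smul_set_mono h
  refine subset_antisymm h ?_
  have := hk (n - 1)
  rwa [Nat.sub_add_cancel hn, hρn, one_smul] at this

/-- In an orbit-finite set, each element is the union of the join-irreducible elements below it. -/
theorem exists_joinIrreducible_below {X : Set (Set Z)} (hX : OrbitFinite 𝔸 X)
    (hXs : ∀ x ∈ X, FinitelySupported 𝔸 x) (x : Set Z) (hx : x ∈ X) (z : Z) (hz : z ∈ x) :
    ∃ y ∈ joinIrreducibles 𝔸 X, y ⊆ x ∧ z ∈ y := by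
  rw [orbitFinite_iff] at hX
  -- Descent on the number of orbits met strictly below x. Passing to f ⊂ x loses at least the orbit
  -- of f: by `eq_of_subset_smul` no element of that orbit lies strictly inside f.
  let below : Set Z → Set (Set (Set Z)) := fun x => orbits 𝔸 {y | y ∈ X ∧ y ⊂ x}
  have hbelow : ∀ x, (below x).Finite := fun x => hX.2.subset (orbits_mono fun y hy => hy.1)
  induction hn : (below x).ncard using Nat.strong_induction_on generalizing x with
  | _ n ih =>
    by_cases hxJ : x ∈ joinIrreducibles 𝔸 X
    · exact ⟨x, hxJ, subset_rfl, hz⟩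
    have : ∃ F : Set (Set Z), F ⊆ X ∧ x = ⋃₀ F ∧ x ∉ F := by
      by_contra hcon
      refine hxJ ⟨hx, ⟨z, hz⟩, fun F hF _ hxF => ?_⟩
      by_contra hxF'
      exact hcon ⟨F, hF, hxF, hxF'⟩
    obtain ⟨F, hF, hxF, hxF'⟩ := this
    have hz' := hz
    rw [hxF] at hz'
    obtain ⟨f, hf, hzf⟩ := hz'
    have hfx : f ⊂ x := (hxF ▸ Set.subset_sUnion_of_mem hf : f ⊆ x).ssubset_of_ne
      (fun h => hxF' (h ▸ hf))
    have hlt : (below f).ncard < (below x).ncard := by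
      refine Set.ncard_lt_ncard ⟨orbits_mono fun y hy => ⟨hy.1, hy.2.trans hfx⟩, fun hsub => ?_⟩
        (hbelow x)
      obtain ⟨y, ⟨hyX, hyf⟩, hyo⟩ := hsub ⟨f, ⟨hF hf, hfx⟩, rfl⟩
      obtain ⟨g, rfl⟩ := orbit_eq_iff_exists.1 hyo.symm
      have := eq_of_subset_smul (hXs y hyX) g hyf.subset
      exact hyf.ne this
    obtain ⟨y, hy, hyf, hzy⟩ := ih _ (hn ▸ hlt) f (hF hf) hzf rfl
    exact ⟨y, hy, hyf.trans hfx.subset, hzy⟩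

end JoinIrreducible

/-! ### Languages of automata -/

namespace Automaton

variable {α X : Type u} {A : Automaton α X}

theorem mem_language_iff {v : List α} :
    v ∈ A.language ↔ ∃ q ∈ A.start, v ∈ A.languageFrom q := by
  change (∃ s ∈ A.accept, s ∈ A.toNFA.evalFrom A.start v) ↔
    ∃ q ∈ A.start, ∃ s ∈ A.accept, s ∈ A.toNFA.evalFrom {q} v
  constructor
  · rintro ⟨s, hs, h⟩
    obtain ⟨q, hq, h⟩ := NFA.mem_evalFrom_iff_exists.1 h
    exact ⟨q, hq, s, hs, h⟩
  · rintro ⟨q, hq, s, hs, h⟩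
    exact ⟨s, hs, NFA.mem_evalFrom_iff_exists.2 ⟨q, hq, h⟩⟩

theorem nil_mem_languageFrom {q : X} : [] ∈ A.languageFrom q ↔ q ∈ A.accept := by
  change (∃ s ∈ A.accept, s ∈ A.toNFA.evalFrom {q} []) ↔ _
  simp

theorem cons_mem_languageFrom {q : X} {a : α} {v : List α} :
    a :: v ∈ A.languageFrom q ↔ ∃ q' ∈ A.step q a, v ∈ A.languageFrom q' := by
  change (∃ s ∈ A.accept, s ∈ A.toNFA.evalFrom {q} (a :: v)) ↔
    ∃ q' ∈ A.step q a, ∃ s ∈ A.accept, s ∈ A.toNFA.evalFrom {q'} v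
  rw [NFA.evalFrom_cons, NFA.stepSet_singleton]
  constructor
  · rintro ⟨s, hs, h⟩
    obtain ⟨q', hq, h⟩ := NFA.mem_evalFrom_iff_exists.1 h
    exact ⟨q', hq, s, hs, h⟩
  · rintro ⟨q', hq, s, hs, h⟩
    exact ⟨s, hs, NFA.mem_evalFrom_iff_exists.2 ⟨q', hq, h⟩⟩

theorem append_mem_language_iff {w v : List α} :
    w ++ v ∈ A.language ↔ ∃ q ∈ A.toNFA.eval w, v ∈ A.languageFrom q := by
  change (∃ s ∈ A.accept, s ∈ A.toNFA.evalFrom A.start (w ++ v)) ↔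
    ∃ q ∈ A.toNFA.eval w, ∃ s ∈ A.accept, s ∈ A.toNFA.evalFrom {q} v
  rw [NFA.evalFrom_append]
  constructor
  · rintro ⟨s, hs, h⟩
    obtain ⟨q', hq, h⟩ := NFA.mem_evalFrom_iff_exists.1 h
    exact ⟨q', hq, s, hs, h⟩
  · rintro ⟨q', hq, s, hs, h⟩
    exact ⟨s, hs, NFA.mem_evalFrom_iff_exists.2 ⟨q', hq, h⟩⟩

section Nominal

variable {𝔸 : Type v} [MulAction (Equiv.Perm 𝔸) α] [MulAction (Equiv.Perm 𝔸) X]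

theorem IsNominal.smul_mem_step (hA : A.IsNominal 𝔸) (g : Equiv.Perm 𝔸) {q q' : X} {a : α}
    (h : q' ∈ A.step q a) : g • q' ∈ A.step (g • q) (g • a) :=
  hA.step_equivariant.smul_mem g
    (show (q, a, q') ∈ {t : X × α × X | t.2.2 ∈ A.step t.1 t.2.1} from h)

theorem IsNominal.smul_mem_evalFrom (hA : A.IsNominal 𝔸) (g : Equiv.Perm 𝔸) {S : Set X}
    {w : List α} {q : X} (h : q ∈ A.toNFA.evalFrom S w) :
    g • q ∈ A.toNFA.evalFrom (g • S) (g • w) := by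
  induction w generalizing S with
  | nil => exact Set.smul_mem_smul_set h
  | cons a w ih =>
    rw [NFA.evalFrom_cons] at h
    rw [smul_cons, NFA.evalFrom_cons]
    have := ih h
    obtain ⟨q₀, hq₀, h₀⟩ := NFA.mem_evalFrom_iff_exists.1 this
    refine NFA.mem_evalFrom_iff_exists.2 ⟨q₀, ?_, h₀⟩
    obtain ⟨q₁, hq₁, rfl⟩ := hq₀
    obtain ⟨q₂, hq₂, h₂⟩ := NFA.mem_stepSet.1 hq₁
    exact NFA.mem_stepSet.2 ⟨g • q₂, Set.smul_mem_smul_set hq₂, hA.smul_mem_step g h₂⟩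

theorem IsNominal.smul_mem_eval (hA : A.IsNominal 𝔸) (g : Equiv.Perm 𝔸)
    {w : List α} {q : X} (h : q ∈ A.toNFA.eval w) : g • q ∈ A.toNFA.eval (g • w) := by
  have := hA.smul_mem_evalFrom g h
  rwa [hA.start_equivariant] at this

theorem IsNominal.smul_mem_languageFrom (hA : A.IsNominal 𝔸) (g : Equiv.Perm 𝔸) {q : X}
    {v : List α} (h : v ∈ A.languageFrom q) : g • v ∈ A.languageFrom (g • q) := by
  obtain ⟨s, hs, h⟩ := h
  refine ⟨g • s, hA.accept_equivariant.smul_mem g hs, ?_⟩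
  have := hA.smul_mem_evalFrom g h
  rwa [Set.smul_set_singleton] at this

theorem IsNominal.languageFrom_smul (hA : A.IsNominal 𝔸) (g : Equiv.Perm 𝔸) (q : X) :
    A.languageFrom (g • q) = g • A.languageFrom q := by
  ext v
  rw [Set.mem_smul_set_iff_inv_smul_mem]
  constructor
  · intro h
    have := hA.smul_mem_languageFrom g⁻¹ h
    rwa [inv_smul_smul] at this
  · intro h
    have := hA.smul_mem_languageFrom g h
    rwa [smul_inv_smul] at this

theorem IsNominal.eval_subset (hA : A.IsNominal 𝔸) (w : List α) :
    A.toNFA.eval w ⊆ A.states := by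
  induction w using List.reverseRecOn with
  | nil => exact hA.start_subset
  | append_singleton w a ih =>
    rw [NFA.eval_append_singleton]
    intro q hq
    obtain ⟨q', -, h⟩ := NFA.mem_stepSet.1 hq
    exact (hA.step_subset _ _ _ h).2

end Nominal

end Automaton

/-! ### Words and derivatives of equivariant languages -/

section Words

variable {𝔸 : Type v} {α : Type u} [MulAction (Equiv.Perm 𝔸) α]

theorem equivariant_wordsUpTo (n : ℕ) : Equivariant 𝔸 (wordsUpTo α n) :=
  equivariant_of_smul_mem fun g w hw => by
    change (g • w).length ≤ n
    rw [length_smul]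
    exact hw

theorem wordsUpTo_mono {m n : ℕ} (h : m ≤ n) : wordsUpTo α m ⊆ wordsUpTo α n :=
  fun _ hw => le_trans hw h

theorem wordsUpTo_succ (n : ℕ) :
    wordsUpTo α n ∪ {w | ∃ s ∈ wordsUpTo α n, ∃ a : α, w = s ++ [a]} = wordsUpTo α (n + 1) := by
  ext w
  constructor
  · rintro (h | ⟨s, hs, a, rfl⟩)
    · exact wordsUpTo_mono n.le_succ h
    · have hs' : s.length ≤ n := hs
      change (s ++ [a]).length ≤ n + 1
      simpa using hs'
  · intro hw
    induction w using List.reverseRecOn with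
    | nil => exact Or.inl (Nat.zero_le n)
    | append_singleton s a =>
      refine Or.inr ⟨s, ?_, a, rfl⟩
      change (s ++ [a]).length ≤ n + 1 at hw
      change s.length ≤ n
      simpa using hw

theorem orbitFinite_wordsUpTo [Infinite 𝔸] (hα : ∀ a : α, FinitelySupported 𝔸 a)
    (hfin : OrbitFinite 𝔸 (Set.univ : Set α)) (n : ℕ) : OrbitFinite 𝔸 (wordsUpTo α n) := by
  induction n with
  | zero =>
    refine ⟨{[]}, ?_⟩
    ext w
    simp only [wordsUpTo, Nat.le_zero, Set.mem_ofPred_eq, List.length_eq_zero_iff,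
      Finset.mem_singleton, Set.iUnion_iUnion_eq_left, MulAction.mem_orbit_iff]
    exact ⟨fun h => ⟨1, by rw [one_smul, h]⟩, fun ⟨_, h⟩ => h ▸ rfl⟩
  | succ n ih =>
    rw [← wordsUpTo_succ]
    refine ih.union ?_
    have := (ih.prod hfin (fun w _ => finitelySupported_list hα w) (fun a _ => hα a)).image
      (fun p => p.1 ++ [p.2]) (fun g p => (smul_append g p.1 [p.2]).symm)
    convert this using 1
    ext w
    constructor
    · rintro ⟨s, hs, a, rfl⟩
      exact ⟨(s, a), ⟨hs, trivial⟩, rfl⟩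
    · rintro ⟨⟨s, a⟩, ⟨hs, -⟩, rfl⟩
      exact ⟨s, hs, a, rfl⟩

theorem derivative_smul {L : Set (List α)} (hL : Equivariant 𝔸 L) (g : Equiv.Perm 𝔸)
    (w : List α) : derivative L (g • w) = g • derivative L w := by
  ext v
  rw [Set.mem_smul_set_iff_inv_smul_mem]
  change g • w ++ v ∈ L ↔ w ++ g⁻¹ • v ∈ L
  rw [← hL.smul_mem_iff g⁻¹, smul_append, inv_smul_smul]

theorem derivative_append (L : Set (List α)) (w v : List α) :
    derivative L (w ++ v) = derivative (derivative L w) v := by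
  ext z
  simp [derivative, List.append_assoc]

theorem finitelySupported_derivative (hα : ∀ a : α, FinitelySupported 𝔸 a) {L : Set (List α)}
    (hL : Equivariant 𝔸 L) (w : List α) : FinitelySupported 𝔸 (derivative L w) :=
  (finitelySupported_list hα w).map _ (derivative_smul hL)

end Words

/-! ### Observation tables over equivariant languages -/

namespace Table

/-- The tables that the algorithm maintains: the row indices are the words of length at most `n` and
the column indices form an orbit-finite suffix-closed set. -/
structure IsRegular (𝔸 : Type v) {α : Type u} [MulAction (Equiv.Perm 𝔸) α] (T : Table α)
    (n : ℕ) : Prop where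
  S_eq : T.S = wordsUpTo α n
  nil_mem : [] ∈ T.E
  suffix_mem : ∀ a e, a :: e ∈ T.E → e ∈ T.E
  orbitFinite : OrbitFinite 𝔸 T.E

variable {𝔸 : Type v} {α : Type u} [MulAction (Equiv.Perm 𝔸) α] {L : Set (List α)} {T : Table α}
  {n : ℕ}

theorem IsRegular.equivariant (hT : T.IsRegular 𝔸 n) : Equivariant 𝔸 T.E :=
  (orbitFinite_iff.1 hT.orbitFinite).1

theorem IsRegular.nil_mem_S (hT : T.IsRegular 𝔸 n) : [] ∈ T.S := by
  rw [hT.S_eq]; exact Nat.zero_le n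

theorem IsRegular.rowIndices_eq (hT : T.IsRegular 𝔸 n) : T.rowIndices = wordsUpTo α (n + 1) := by
  rw [rowIndices, hT.S_eq, wordsUpTo_succ]

theorem subset_rowIndices : T.S ⊆ T.rowIndices := Set.subset_union_left

theorem append_mem_rowIndices {s : List α} (hs : s ∈ T.S) (a : α) : s ++ [a] ∈ T.rowIndices :=
  Or.inr ⟨s, hs, a, rfl⟩

theorem upperRows_subset : T.upperRows L ⊆ T.rows L := Set.image_mono subset_rowIndices

theorem row_smul (hL : Equivariant 𝔸 L) (hE : Equivariant 𝔸 T.E) (g : Equiv.Perm 𝔸)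
    (t : List α) : T.row L (g • t) = g • T.row L t := by
  ext e
  rw [Set.mem_smul_set_iff_inv_smul_mem]
  change (e ∈ T.E ∧ g • t ++ e ∈ L) ↔ (g⁻¹ • e ∈ T.E ∧ t ++ g⁻¹ • e ∈ L)
  rw [hE.smul_mem_iff, ← hL.smul_mem_iff g⁻¹ (x := g • t ++ e), smul_append, inv_smul_smul]

theorem finitelySupported_row (hα : ∀ a : α, FinitelySupported 𝔸 a) (hL : Equivariant 𝔸 L)
    (hE : Equivariant 𝔸 T.E) (t : List α) : FinitelySupported 𝔸 (T.row L t) :=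
  (finitelySupported_list hα t).map _ (row_smul hL hE)

theorem finitelySupported_of_mem_rows (hα : ∀ a : α, FinitelySupported 𝔸 a)
    (hL : Equivariant 𝔸 L) (hE : Equivariant 𝔸 T.E) : ∀ r ∈ T.rows L, FinitelySupported 𝔸 r := by
  rintro _ ⟨t, -, rfl⟩
  exact finitelySupported_row hα hL hE t

theorem IsRegular.equivariant_upperRows (hT : T.IsRegular 𝔸 n) (hL : Equivariant 𝔸 L) :
    Equivariant 𝔸 (T.upperRows L) := by
  rw [upperRows, hT.S_eq]
  exact (equivariant_wordsUpTo n).image _ (row_smul hL hT.equivariant)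

section Infinite

variable [Infinite 𝔸]

theorem IsRegular.orbitFinite_rows (hT : T.IsRegular 𝔸 n) (hα : ∀ a : α, FinitelySupported 𝔸 a)
    (hfin : OrbitFinite 𝔸 (Set.univ : Set α)) (hL : Equivariant 𝔸 L) :
    OrbitFinite 𝔸 (T.rows L) := by
  rw [rows, hT.rowIndices_eq]
  exact (orbitFinite_wordsUpTo hα hfin _).image _ (row_smul hL hT.equivariant)

theorem IsRegular.orbitFinite_membershipQueries (hT : T.IsRegular 𝔸 n)
    (hα : ∀ a : α, FinitelySupported 𝔸 a) (hfin : OrbitFinite 𝔸 (Set.univ : Set α)) :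
    OrbitFinite 𝔸 T.membershipQueries := by
  have := ((orbitFinite_wordsUpTo hα hfin (n + 1)).prod hT.orbitFinite
    (fun w _ => finitelySupported_list hα w) (fun w _ => finitelySupported_list hα w)).image
      (fun p => p.1 ++ p.2) (fun g p => (smul_append g p.1 p.2).symm)
  convert this using 1
  rw [membershipQueries, hT.rowIndices_eq]
  ext w
  constructor
  · rintro ⟨s, hs, a, ha, rfl⟩
    exact ⟨(s, a), ⟨hs, ha⟩, rfl⟩
  · rintro ⟨⟨s, a⟩, ⟨hs, ha⟩, rfl⟩
    exact ⟨s, hs, a, ha, rfl⟩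

/-- A table is join-closed exactly when all join-irreducible rows are upper rows. -/
theorem IsRegular.joinClosed_iff (hT : T.IsRegular 𝔸 n) (hα : ∀ a : α, FinitelySupported 𝔸 a)
    (hfin : OrbitFinite 𝔸 (Set.univ : Set α)) (hL : Equivariant 𝔸 L) :
    T.JoinClosed L 𝔸 ↔ joinIrreducibles 𝔸 (T.rows L) ⊆ T.upperRows L := by
  have hfs := finitelySupported_of_mem_rows hα hL hT.equivariant (T := T)
  constructor
  · rintro hcl r hr
    obtain ⟨t, (ht | ⟨s, hs, a, rfl⟩), rfl⟩ := hr.1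
    · exact ⟨t, ht, rfl⟩
    · have hQ : Equivariant 𝔸 (T.upperJoinIrreducibles L 𝔸) := equivariant_of_smul_mem
        fun g x hx => ⟨(equivariant_joinIrreducibles
          (orbitFinite_iff.1 (hT.orbitFinite_rows hα hfin hL)).1).smul_mem g hx.1,
          (hT.equivariant_upperRows hL).smul_mem g hx.2⟩
      have := hr.2.2 _ (fun r hr => hr.1.1.1)
        (finitelySupported_below hQ (hfs _ hr.1)) (hcl s hs a)
      exact this.1.2
  · intro hJ s hs a
    ext e
    constructor
    · intro he
      obtain ⟨y, hy, hyx, hey⟩ := exists_joinIrreducible_below (hT.orbitFinite_rows hα hfin hL) hfs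
        _ ⟨_, append_mem_rowIndices hs a, rfl⟩ e he
      exact ⟨y, ⟨⟨hy, hJ hy⟩, hyx⟩, hey⟩
    · rintro ⟨y, hy, hey⟩
      exact hy.2 hey

theorem IsRegular.upperJoinIrreducibles_eq (hT : T.IsRegular 𝔸 n)
    (hα : ∀ a : α, FinitelySupported 𝔸 a)
    (hfin : OrbitFinite 𝔸 (Set.univ : Set α)) (hL : Equivariant 𝔸 L) (hcl : T.JoinClosed L 𝔸) :
    T.upperJoinIrreducibles L 𝔸 = joinIrreducibles 𝔸 (T.rows L) :=
  Set.inter_eq_left.2 ((hT.joinClosed_iff hα hfin hL).1 hcl)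

theorem IsRegular.exists_below (hT : T.IsRegular 𝔸 n)
    (hα : ∀ a : α, FinitelySupported 𝔸 a)
    (hfin : OrbitFinite 𝔸 (Set.univ : Set α)) (hL : Equivariant 𝔸 L) (hcl : T.JoinClosed L 𝔸)
    {t : List α} (ht : t ∈ T.rowIndices) {e : List α} (he : e ∈ T.row L t) :
    ∃ r ∈ T.upperJoinIrreducibles L 𝔸, r ⊆ T.row L t ∧ e ∈ r := by
  rw [hT.upperJoinIrreducibles_eq hα hfin hL hcl]
  exact exists_joinIrreducible_below (hT.orbitFinite_rows hα hfin hL)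
    (finitelySupported_of_mem_rows hα hL hT.equivariant) _ ⟨t, ht, rfl⟩ e he

/-- In a join-closed table, the states of the hypothesis are determined by the upper rows. -/
theorem IsRegular.upperJoinIrreducibles_eq_upper (hT : T.IsRegular 𝔸 n)
    (hα : ∀ a : α, FinitelySupported 𝔸 a)
    (hfin : OrbitFinite 𝔸 (Set.univ : Set α)) (hL : Equivariant 𝔸 L) (hcl : T.JoinClosed L 𝔸) :
    T.upperJoinIrreducibles L 𝔸 = joinIrreducibles 𝔸 (T.upperRows L) := by
  rw [hT.upperJoinIrreducibles_eq hα hfin hL hcl]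
  refine joinIrreducibles_eq_of_generates (finitelySupported_of_mem_rows hα hL hT.equivariant)
    (hT.equivariant_upperRows hL) upperRows_subset ?_
  rintro _ ⟨t, ht, rfl⟩ e he
  obtain ⟨r, hr, hrt, her⟩ := hT.exists_below hα hfin hL hcl ht he
  exact ⟨r, hr.2, hrt, her⟩

end Infinite

end Table

/-! ### The hypothesis automaton of a table -/

namespace Table

variable {𝔸 : Type v} {α : Type u} [MulAction (Equiv.Perm 𝔸) α] {L : Set (List α)}
  {T : Table α} {n : ℕ}

theorem append_singleton_mem_row {α : Type u} {L : Set (List α)} {T : Table α} {s e : List α} {a : α} (he : a :: e ∈ T.E) (he' : e ∈ T.E) :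
    e ∈ T.row L (s ++ [a]) ↔ a :: e ∈ T.row L s := by
  change (e ∈ T.E ∧ s ++ [a] ++ e ∈ L) ↔ (a :: e ∈ T.E ∧ s ++ a :: e ∈ L)
  rw [List.append_assoc, List.singleton_append]
  exact ⟨fun h => ⟨he, h.2⟩, fun h => ⟨he', h.2⟩⟩

theorem IsRegular.equivariant_upperJoinIrreducibles [Infinite 𝔸] (hT : T.IsRegular 𝔸 n)
    (hα : ∀ a : α, FinitelySupported 𝔸 a) (hfin : OrbitFinite 𝔸 (Set.univ : Set α))
    (hL : Equivariant 𝔸 L) : Equivariant 𝔸 (T.upperJoinIrreducibles L 𝔸) :=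
  equivariant_of_smul_mem fun g _ hx => ⟨(equivariant_joinIrreducibles
    (orbitFinite_iff.1 (hT.orbitFinite_rows hα hfin hL)).1).smul_mem g hx.1,
    (hT.equivariant_upperRows hL).smul_mem g hx.2⟩

theorem IsRegular.isNominal_hypothesis [Infinite 𝔸] (hT : T.IsRegular 𝔸 n)
    (hα : ∀ a : α, FinitelySupported 𝔸 a) (hfin : OrbitFinite 𝔸 (Set.univ : Set α))
    (hL : Equivariant 𝔸 L) : (T.hypothesis L 𝔸).IsNominal 𝔸 := by
  have hQ := hT.equivariant_upperJoinIrreducibles hα hfin hL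
  refine ⟨fun q hq => finitelySupported_of_mem_rows hα hL hT.equivariant q hq.1.1,
    (hT.orbitFinite_rows hα hfin hL).subset hQ (fun q hq => hq.1.1), fun q hq => hq.1,
    fun q hq => hq.1, fun q a q' h => ⟨h.1, h.2.1⟩, ?_, ?_, ?_⟩
  · refine equivariant_of_smul_mem fun g q hq => ⟨hQ.smul_mem g hq.1, ?_⟩
    have := Set.smul_set_mono (a := g) hq.2
    rwa [← row_smul hL hT.equivariant] at this
  · refine equivariant_of_smul_mem fun g q hq => ⟨hQ.smul_mem g hq.1, ?_⟩
    exact Set.smul_mem_smul_set (a := g) hq.2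
  · refine equivariant_of_smul_mem ?_
    rintro g ⟨q, a, q'⟩ ⟨hq, hq', s, hs, rfl, hsub⟩
    refine ⟨hQ.smul_mem g hq, hQ.smul_mem g hq', g • s, ?_, ?_, ?_⟩
    · rw [hT.S_eq] at hs ⊢
      exact (equivariant_wordsUpTo n).smul_mem g hs
    · exact (row_smul hL hT.equivariant g s).symm
    · have := Set.smul_set_mono (a := g) hsub
      rwa [← row_smul hL hT.equivariant, smul_append] at this

/-- Induction on e stays inside the suffix-closed set of columns. The entry of row s at a :: e is
the entry of row s a at e, and join-closedness supplies a state below row s a that contains e. -/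
theorem IsRegular.mem_languageFrom_iff [Infinite 𝔸] (hT : T.IsRegular 𝔸 n)
    (hα : ∀ a : α, FinitelySupported 𝔸 a) (hfin : OrbitFinite 𝔸 (Set.univ : Set α))
    (hL : Equivariant 𝔸 L) (hcl : T.JoinClosed L 𝔸) {e : List α} (he : e ∈ T.E)
    {r : Set (List α)} (hr : r ∈ T.upperJoinIrreducibles L 𝔸) :
    e ∈ (T.hypothesis L 𝔸).languageFrom r ↔ e ∈ r := by
  induction e generalizing r with
  | nil =>
    rw [Automaton.nil_mem_languageFrom]
    exact ⟨fun h => h.2, fun h => ⟨hr, h⟩⟩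
  | cons a e ih =>
    have he' := hT.suffix_mem a e he
    rw [Automaton.cons_mem_languageFrom]
    constructor
    · rintro ⟨r', ⟨-, hr', s, hs, rfl, hsub⟩, her'⟩
      rw [ih he' hr'] at her'
      exact (append_singleton_mem_row he he').1 (hsub her')
    · intro hae
      obtain ⟨s, hs, rfl⟩ := hr.2
      obtain ⟨r', hr', hsub, her'⟩ := hT.exists_below hα hfin hL hcl (append_mem_rowIndices hs a)
        ((append_singleton_mem_row he he').2 hae)
      exact ⟨r', ⟨hr, hr', s, hs, rfl, hsub⟩, (ih he' hr').2 her'⟩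

/-- The hypothesis of a join-closed table agrees with the target language on the columns. -/
theorem IsRegular.mem_language_iff [Infinite 𝔸] (hT : T.IsRegular 𝔸 n)
    (hα : ∀ a : α, FinitelySupported 𝔸 a) (hfin : OrbitFinite 𝔸 (Set.univ : Set α))
    (hL : Equivariant 𝔸 L) (hcl : T.JoinClosed L 𝔸) {e : List α} (he : e ∈ T.E) :
    e ∈ (T.hypothesis L 𝔸).language ↔ e ∈ L := by
  rw [Automaton.mem_language_iff]
  constructor
  · rintro ⟨r, ⟨hr, hsub⟩, her⟩
    rw [hT.mem_languageFrom_iff hα hfin hL hcl he hr] at her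
    exact (hsub her).2
  · intro heL
    obtain ⟨r, hr, hsub, her⟩ := hT.exists_below hα hfin hL hcl
      (subset_rowIndices hT.nil_mem_S) (show e ∈ T.row L [] from ⟨he, heL⟩)
    exact ⟨r, ⟨hr, hsub⟩, (hT.mem_languageFrom_iff hα hfin hL hcl he hr).2 her⟩

/-- By join-consistency every transition from the smaller row is also one from the larger row, so
only the first letter has to be inspected. -/
theorem languageFrom_mono (hco : T.JoinConsistent L) {r₁ r₂ : Set (List α)}
    (hr₁ : r₁ ∈ T.upperJoinIrreducibles L 𝔸) (hr₂ : r₂ ∈ T.upperJoinIrreducibles L 𝔸)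
    (h : r₁ ⊆ r₂) :
    (T.hypothesis L 𝔸).languageFrom r₁ ⊆ (T.hypothesis L 𝔸).languageFrom r₂ := by
  intro v hv
  cases v with
  | nil =>
    rw [Automaton.nil_mem_languageFrom] at hv ⊢
    exact ⟨hr₂, h hv.2⟩
  | cons a v =>
    rw [Automaton.cons_mem_languageFrom] at hv ⊢
    obtain ⟨r', ⟨-, hr', s, hs, rfl, hsub⟩, hv⟩ := hv
    obtain ⟨s₂, hs₂, rfl⟩ := hr₂.2
    exact ⟨r', ⟨hr₂, hr', s₂, hs₂, rfl, hsub.trans (hco s hs s₂ hs₂ a h)⟩, hv⟩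

/-- Join-consistency carries the inclusion along each letter. The prefixes of s needed for this lie
in S because S is all of Σ^{≤n}. -/
theorem IsRegular.subset_row_of_mem_eval (hT : T.IsRegular 𝔸 n)
    (hco : T.JoinConsistent L) {s : List α} (hs : s ∈ T.S) {r : Set (List α)}
    (hr : r ∈ (T.hypothesis L 𝔸).toNFA.eval s) : r ⊆ T.row L s := by
  induction s using List.reverseRecOn generalizing r with
  | nil => exact hr.2
  | append_singleton s a ih =>
    have hs' : s ∈ T.S := by
      rw [hT.S_eq] at hs ⊢
      change (s ++ [a]).length ≤ n at hs
      change s.length ≤ n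
      simp only [List.length_append, List.length_singleton] at hs
      omega
    rw [NFA.eval_append_singleton] at hr
    obtain ⟨r₀, hr₀, h⟩ := NFA.mem_stepSet.1 hr
    have h₀ := ih hs' hr₀
    obtain ⟨-, -, s₀, hs₀, rfl, hsub⟩ := h
    exact hsub.trans (hco s₀ hs₀ s hs' a h₀)

/-- A hypothesis that accepts the target language is residual. -/
theorem IsRegular.isResidual_hypothesis [Infinite 𝔸] (hT : T.IsRegular 𝔸 n)
    (hα : ∀ a : α, FinitelySupported 𝔸 a) (hfin : OrbitFinite 𝔸 (Set.univ : Set α))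
    (hL : Equivariant 𝔸 L) (hcl : T.JoinClosed L 𝔸) (hco : T.JoinConsistent L)
    (hlang : (T.hypothesis L 𝔸).language = L) : (T.hypothesis L 𝔸).IsResidual := by
  intro q hq
  have hnom := hT.isNominal_hypothesis hα hfin hL
  obtain ⟨s, hs, rfl⟩ := hq.2
  -- The states reached by s lie below row s and cover it, because the hypothesis accepts L and is
  -- correct on columns from each state. An irreducible row must be one of them.
  have hmem : T.row L s ∈ (T.hypothesis L 𝔸).toNFA.eval s := by
    refine hq.1.2.2 _ (fun r hr => (hnom.eval_subset s hr).1.1)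
      (finitelySupported_setOf (finitelySupported_list hα s)
        (fun w q => q ∈ (T.hypothesis L 𝔸).toNFA.eval w) (fun g _ _ h => hnom.smul_mem_eval g h)) ?_
    ext e
    constructor
    · rintro ⟨he, hse⟩
      rw [← hlang, Automaton.append_mem_language_iff] at hse
      obtain ⟨r, hr, her⟩ := hse
      exact ⟨r, hr, (hT.mem_languageFrom_iff hα hfin hL hcl he (hnom.eval_subset s hr)).1 her⟩
    · rintro ⟨r, hr, her⟩
      exact hT.subset_row_of_mem_eval hco hs hr her
  -- As row s is the largest state reached by s, its language contains those of all the others.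
  refine ⟨s, ?_⟩
  ext v
  change _ ↔ s ++ v ∈ (T.hypothesis L 𝔸).language
  rw [Automaton.append_mem_language_iff]
  constructor
  · intro hv
    exact ⟨_, hmem, hv⟩
  · rintro ⟨r, hr, hv⟩
    exact languageFrom_mono hco (hnom.eval_subset s hr) hq
      (hT.subset_row_of_mem_eval hco hs hr) hv

/-- The hypothesis depends only on the inclusions between rows and on which upper rows are
join-irreducible. -/
theorem language_hypothesis_subset {T₀ T₁ : Table α} (hS : T₀.S = T₁.S) (h₀ : [] ∈ T₀.S)
    (hE₁ : [] ∈ T₁.E)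
    (hle : ∀ s ∈ T₀.S, ∀ t ∈ T₀.rowIndices, T₀.row L s ⊆ T₀.row L t ↔ T₁.row L s ⊆ T₁.row L t)
    (hJ : ∀ s ∈ T₀.S, T₀.row L s ∈ T₀.upperJoinIrreducibles L 𝔸 ↔
      T₁.row L s ∈ T₁.upperJoinIrreducibles L 𝔸) :
    (T₀.hypothesis L 𝔸).language ⊆ (T₁.hypothesis L 𝔸).language := by
  have key : ∀ v, ∀ s ∈ T₀.S, T₀.row L s ∈ T₀.upperJoinIrreducibles L 𝔸 →
      v ∈ (T₀.hypothesis L 𝔸).languageFrom (T₀.row L s) →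
      v ∈ (T₁.hypothesis L 𝔸).languageFrom (T₁.row L s) := by
    intro v
    induction v with
    | nil =>
      intro s hs hJs hv
      rw [Automaton.nil_mem_languageFrom] at hv ⊢
      exact ⟨(hJ s hs).1 hJs, hE₁, hv.2.2⟩
    | cons a v ih =>
      intro s hs hJs hv
      rw [Automaton.cons_mem_languageFrom] at hv ⊢
      obtain ⟨r', ⟨-, hr', s₁, hs₁, hss₁, hsub⟩, hv⟩ := hv
      obtain ⟨s', hs', rfl⟩ := hr'.2
      refine ⟨T₁.row L s', ⟨(hJ s hs).1 hJs, (hJ s' hs').1 hr', s₁, hS ▸ hs₁, ?_, ?_⟩,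
        ih s' hs' hr' hv⟩
      · exact subset_antisymm ((hle s hs s₁ (subset_rowIndices hs₁)).1 hss₁.subset)
          ((hle s₁ hs₁ s (subset_rowIndices hs)).1 hss₁.symm.subset)
      · exact (hle s' hs' _ (append_mem_rowIndices hs₁ a)).1 hsub
  intro v hv
  rw [Automaton.mem_language_iff] at hv ⊢
  obtain ⟨r, ⟨hr, hsub⟩, hv⟩ := hv
  obtain ⟨s, hs, rfl⟩ := hr.2
  exact ⟨T₁.row L s, ⟨(hJ s hs).1 hr, (hle s hs [] (subset_rowIndices h₀)).1 hsub⟩,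
    key v s hs hr hv⟩

end Table

/-! ### Residual languages -/

section Residual

variable {𝔸 : Type v} {α : Type u} [MulAction (Equiv.Perm 𝔸) α] {L : Set (List α)}

/-- The derivatives of a residual language are generated by the join-irreducible ones, of which
there are only finitely many orbits. -/
theorem IsResidualLanguage.generates (hα : ∀ a : α, FinitelySupported 𝔸 a)
    (hL : Equivariant 𝔸 L) (hres : IsResidualLanguage 𝔸 L) :
    OrbitFinite 𝔸 (joinIrreducibles 𝔸 (derivatives L)) ∧
      ∀ w v, w ++ v ∈ L → ∃ q ∈ joinIrreducibles 𝔸 (derivatives L), q ⊆ derivative L w ∧ v ∈ q := by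
  obtain ⟨X, _, A, hA, hAres, rfl⟩ := hres
  have hfs : ∀ x ∈ derivatives A.language, FinitelySupported 𝔸 x := by
    rintro _ ⟨w, rfl⟩
    exact finitelySupported_derivative hα hL w
  -- A derivative by w is the union of the languages of the states reached by w, and residuality
  -- makes these languages derivatives themselves. So Y generates, and it inherits orbit-finiteness
  -- from the states.
  let Y : Set (Set (List α)) := A.languageFrom '' A.states
  have hY : OrbitFinite 𝔸 Y := hA.states_orbitFinite.image _ hA.languageFrom_smul
  have hYD : Y ⊆ derivatives A.language := by
    rintro _ ⟨q, hq, rfl⟩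
    obtain ⟨w, hw⟩ := hAres q hq
    exact ⟨w, hw.symm⟩
  have hgen : ∀ x ∈ derivatives A.language, ∀ z ∈ x, ∃ y ∈ Y, y ⊆ x ∧ z ∈ y := by
    rintro _ ⟨w, rfl⟩ v hv
    obtain ⟨q, hq, hv⟩ := Automaton.append_mem_language_iff.1 hv
    exact ⟨_, ⟨q, hA.eval_subset w hq, rfl⟩,
      fun z hz => Automaton.append_mem_language_iff.2 ⟨q, hq, hz⟩, hv⟩
  have hJ := joinIrreducibles_eq_of_generates hfs (orbitFinite_iff.1 hY).1 hYD hgen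
  rw [hJ]
  refine ⟨hY.subset (equivariant_joinIrreducibles (orbitFinite_iff.1 hY).1)
    (joinIrreducibles_subset Y), fun w v hv => ?_⟩
  obtain ⟨y, hy, hyw, hvy⟩ := hgen _ ⟨w, rfl⟩ v hv
  obtain ⟨q, hq, hqy, hvq⟩ := exists_joinIrreducible_below hY (fun y hy => hfs y (hYD hy)) y hy v hvy
  exact ⟨q, hq, hqy.trans hyw, hvq⟩

/-- Same induction as for the hypothesis; generation by join-irreducible derivatives takes the role
of join-closedness. -/
theorem mem_languageFrom_canonicalAutomaton
    (hgen : ∀ w v, w ++ v ∈ L →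
      ∃ q ∈ joinIrreducibles 𝔸 (derivatives L), q ⊆ derivative L w ∧ v ∈ q)
    {q : Set (List α)} (hq : q ∈ joinIrreducibles 𝔸 (derivatives L)) (v : List α) :
    v ∈ (canonicalAutomaton 𝔸 L).languageFrom q ↔ v ∈ q := by
  induction v generalizing q with
  | nil =>
    rw [Automaton.nil_mem_languageFrom]
    exact ⟨fun h => h.2, fun h => ⟨hq, h⟩⟩
  | cons a v ih =>
    rw [Automaton.cons_mem_languageFrom]
    constructor
    · rintro ⟨q', ⟨-, hq', hsub⟩, hv⟩
      exact hsub ((ih hq').1 hv)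
    · intro hv
      obtain ⟨w, rfl⟩ := hq.1
      obtain ⟨q', hq', hsub, hv'⟩ := hgen (w ++ [a]) v (by simpa [derivative] using hv)
      rw [derivative_append] at hsub
      exact ⟨q', ⟨hq, hq', hsub⟩, (ih hq').2 hv'⟩

theorem language_canonicalAutomaton [Infinite 𝔸]
    (hgen : ∀ w v, w ++ v ∈ L →
      ∃ q ∈ joinIrreducibles 𝔸 (derivatives L), q ⊆ derivative L w ∧ v ∈ q) :
    (canonicalAutomaton 𝔸 L).language = L := by
  ext v
  rw [Automaton.mem_language_iff]
  constructor
  · rintro ⟨q, ⟨hq, hqL⟩, hv⟩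
    exact hqL ((mem_languageFrom_canonicalAutomaton hgen hq v).1 hv)
  · intro hv
    obtain ⟨q, hq, hsub, hvq⟩ := hgen [] v hv
    exact ⟨q, ⟨hq, hsub⟩, (mem_languageFrom_canonicalAutomaton hgen hq v).2 hvq⟩

/-- The join-irreducible derivatives of a residual language are derivatives by words of length at
most `charLength 𝔸 L`. -/
theorem IsResidualLanguage.exists_charWord [Infinite 𝔸] (hα : ∀ a : α, FinitelySupported 𝔸 a)
    (hL : Equivariant 𝔸 L) (hres : IsResidualLanguage 𝔸 L) {q : Set (List α)}
    (hq : q ∈ joinIrreducibles 𝔸 (derivatives L)) :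
    ∃ w ∈ wordsUpTo α (charLength 𝔸 L), q = derivative L w := by
  obtain ⟨⟨F, hF⟩, hgen⟩ := hres.generates hα hL
  have hchar : ∀ q ∈ joinIrreducibles 𝔸 (derivatives L), ∀ w,
      (canonicalAutomaton 𝔸 L).IsCharacterisingWord q w ↔ q = derivative L w := by
    intro q hq w
    have : (canonicalAutomaton 𝔸 L).languageFrom q = q :=
      Set.ext (mem_languageFrom_canonicalAutomaton hgen hq)
    rw [Automaton.IsCharacterisingWord, language_canonicalAutomaton hgen, this]
  -- The infimum in `charLength` is attained only if the set is non-empty. Finitely many orbit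
  -- representatives suffice for a bound, as permutations preserve the length of words.
  have hne : {l | ∀ q ∈ (canonicalAutomaton 𝔸 L).states,
      ∃ w ∈ wordsUpTo α l, (canonicalAutomaton 𝔸 L).IsCharacterisingWord q w}.Nonempty := by
    have hFw : ∀ x ∈ F, ∃ w, x = derivative L w := fun x hx => by
      have : x ∈ joinIrreducibles 𝔸 (derivatives L) := by
        rw [hF]
        exact Set.mem_biUnion hx (MulAction.mem_orbit_self x)
      obtain ⟨w, hw⟩ := this.1
      exact ⟨w, hw.symm⟩
    choose! w hw using hFw
    refine ⟨F.sup fun x => (w x).length, fun q hq => ?_⟩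
    have hq' := hq
    change q ∈ joinIrreducibles 𝔸 (derivatives L) at hq'
    rw [hF] at hq'
    simp only [Set.mem_iUnion] at hq'
    obtain ⟨x, hx, g, rfl⟩ := hq'
    refine ⟨g • w x, ?_, (hchar _ hq _).2 ?_⟩
    · change (g • w x).length ≤ _
      rw [length_smul]
      exact Finset.le_sup (f := fun x => (w x).length) hx
    · rw [derivative_smul hL, ← hw x hx]
  obtain ⟨w, hw, hqw⟩ := Nat.sInf_mem hne q hq
  exact ⟨w, hw, (hchar q hq w).1 hqw⟩

/-- Once the row indices contain characterising words for all states of the canonical automaton, all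
join-irreducible rows are upper rows. -/
theorem Table.IsRegular.joinIrreducibles_subset_upperRows [Infinite 𝔸] (hα : ∀ a : α, FinitelySupported 𝔸 a)
    (hL : Equivariant 𝔸 L) (hres : IsResidualLanguage 𝔸 L) {T : Table α} {n : ℕ}
    (hT : T.IsRegular 𝔸 n) (hn : charLength 𝔸 L ≤ n) :
    joinIrreducibles 𝔸 (T.rows L) ⊆ T.upperRows L := by
  rw [joinIrreducibles_eq_of_generates
    (Table.finitelySupported_of_mem_rows hα hL hT.equivariant) (hT.equivariant_upperRows hL)
    Table.upperRows_subset]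
  · exact joinIrreducibles_subset _
  · rintro _ ⟨t, ht, rfl⟩ e ⟨he, hte⟩
    -- Restricting to the columns turns an irreducible derivative below that of t into an upper row
    -- below row t.
    obtain ⟨q, hq, hqt, heq⟩ := (hres.generates hα hL).2 t e hte
    obtain ⟨w, hw, rfl⟩ := hres.exists_charWord hα hL hq
    refine ⟨T.row L w, ⟨w, ?_, rfl⟩, fun e' he' => ⟨he'.1, hqt he'.2⟩, he, heq⟩
    rw [hT.S_eq]
    exact wordsUpTo_mono hn hw

end Residual

/-! ### Runs of the algorithm -/

section Runs

variable {𝔸 : Type v} {α : Type u} [MulAction (Equiv.Perm 𝔸) α] {L : Set (List α)}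
  {T T₁ T₂ : Table α} {n : ℕ}

theorem Table.IsRegular.union (hT : T.IsRegular 𝔸 n) {U : Set (List α)} (hU : OrbitFinite 𝔸 U)
    (hsuff : ∀ a e, a :: e ∈ U → e ∈ T.E ∪ U) :
    Table.IsRegular 𝔸 ⟨T.S, T.E ∪ U⟩ n where
  S_eq := hT.S_eq
  nil_mem := Or.inl hT.nil_mem
  suffix_mem a e h := h.elim (fun h => Or.inl (hT.suffix_mem a e h)) (hsuff a e)
  orbitFinite := hT.orbitFinite.union hU

theorem isRegular_initial : Table.IsRegular 𝔸 (initialConfig α).table 0 where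
  S_eq := by
    ext w
    change w = [] ↔ w.length ≤ 0
    simp
  nil_mem := rfl
  suffix_mem a e h := by cases h
  orbitFinite := by
    refine ⟨{[]}, ?_⟩
    ext w
    simp only [Finset.mem_singleton, Set.iUnion_iUnion_eq_left, MulAction.mem_orbit_iff]
    exact ⟨fun h => ⟨1, by rw [one_smul]; exact h.symm⟩, fun ⟨_, h⟩ => h.symm⟩

/-- The missing row is not an upper row, so s a lies outside S = Σ^{≤n} and has length exactly n +
1. Hence S becomes Σ^{≤n+1}. -/
theorem ClosePhase.cases (h : ClosePhase 𝔸 L T T₁) (hT : T.IsRegular 𝔸 n) :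
    (T.JoinClosed L 𝔸 ∧ T₁ = T) ∨ (¬ T.JoinClosed L 𝔸 ∧ T₁.IsRegular 𝔸 (n + 1) ∧
      T.S ⊆ T₁.S ∧ T₁.E = T.E ∧ ¬ joinIrreducibles 𝔸 (T.rows L) ⊆ T.upperRows L) := by
  cases h with
  | skip h => exact Or.inl ⟨h, rfl⟩
  | extend s a hcl hs hrow =>
    have hlen : s.length ≤ n := by rw [hT.S_eq] at hs; exact hs
    have hlen' : ¬ (s ++ [a]).length ≤ n := by
      intro h
      refine hrow.2 ⟨s ++ [a], ?_, rfl⟩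
      rw [hT.S_eq]
      exact h
    have heq : (s ++ [a]).length = n + 1 := by
      simp only [List.length_append, List.length_singleton] at hlen' ⊢
      omega
    refine Or.inr ⟨hcl, ⟨?_, hT.nil_mem, hT.suffix_mem, hT.orbitFinite⟩, Set.subset_union_left, rfl,
      fun h => hrow.2 (h hrow.1)⟩
    change T.S ∪ wordsUpTo α (s ++ [a]).length = _
    rw [heq, hT.S_eq, Set.union_eq_right]
    exact wordsUpTo_mono n.le_succ

/-- The new column a :: e refutes an inclusion that held before. The columns stay suffix-closed
because the orbit of e already consists of columns. -/
theorem ConsistencyPhase.cases (h : ConsistencyPhase 𝔸 L T T₁) (hT : T.IsRegular 𝔸 n) :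
    T₁.IsRegular 𝔸 n ∧ T₁.S = T.S ∧ T.E ⊆ T₁.E ∧ ((T.JoinConsistent L ∧ T₁ = T) ∨
      ∃ s₁ ∈ T.S, ∃ s₂ ∈ T.S, T.row L s₁ ⊆ T.row L s₂ ∧ ¬ T₁.row L s₁ ⊆ T₁.row L s₂) := by
  cases h with
  | skip h => exact ⟨hT, rfl, subset_rfl, Or.inl ⟨h, rfl⟩⟩
  | extend s₁ s₂ a e hco hs₁ hs₂ he hsub he₁ he₂ =>
    refine ⟨hT.union (orbitFinite_orbit _) ?_, rfl, Set.subset_union_left,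
      Or.inr ⟨s₁, hs₁, s₂, hs₂, hsub, fun h => he₂ ⟨he, ?_⟩⟩⟩
    · rintro b e' ⟨g, hg⟩
      have : g • e = e' := (List.cons_eq_cons.1 (hg : g • a :: g • e = b :: e')).2
      exact Or.inl (this ▸ hT.equivariant.smul_mem g he)
    · have hmem : a :: e ∈ MulAction.orbit (Equiv.Perm 𝔸) (a :: e) := MulAction.mem_orbit_self _
      have h₁ := he₁.2
      rw [List.append_assoc, List.singleton_append] at h₁ ⊢
      exact (h ⟨Or.inr hmem, h₁⟩).2

theorem isRegular_counterexample (hT : T.IsRegular 𝔸 n) (t : List α) :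
    Table.IsRegular 𝔸
      ⟨T.S, T.E ∪ ⋃ t₀ ∈ {t₀ | t₀ <:+ t}, MulAction.orbit (Equiv.Perm 𝔸) t₀⟩ n := by
  classical
  refine hT.union ⟨t.tails.toFinset, by simp⟩ fun a e h => Or.inr ?_
  simp only [Set.mem_iUnion] at h ⊢
  obtain ⟨t₀, ht₀, g, hg⟩ := h
  cases t₀ with
  | nil => cases hg
  | cons b t₀ =>
    have : g • t₀ = e := (List.cons_eq_cons.1 (hg : g • b :: g • t₀ = a :: e)).2
    exact ⟨t₀, (List.suffix_cons b t₀).trans ht₀, g, this⟩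

/-- The shape of all configurations reachable on an equivariant language. -/
theorem Reachable.isRegular [Infinite 𝔸] (hα : ∀ a : α, FinitelySupported 𝔸 a)
    (hfin : OrbitFinite 𝔸 (Set.univ : Set α)) (hL : Equivariant 𝔸 L) {c : Config α}
    (hc : Reachable 𝔸 L c) :
    (∃ n, c.table.IsRegular 𝔸 n) ∧
      ∀ H, c.output = some H → H.IsNominal 𝔸 ∧ H.IsResidual ∧ H.language = L := by
  induction hc with
  | refl => exact ⟨⟨0, isRegular_initial⟩, fun H h => by cases h⟩
  | tail _ hstep ih =>
    obtain ⟨⟨n, hT⟩, -⟩ := ih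
    cases hstep with
    | body T T₁ T₂ k hn h₁ h₂ =>
      refine ⟨?_, fun H h => by cases h⟩
      rcases h₁.cases hT with ⟨-, rfl⟩ | ⟨-, hT₁, -⟩
      · exact ⟨n, (h₂.cases hT).1⟩
      · exact ⟨n + 1, (h₂.cases hT₁).1⟩
    | counterexample T k t hcl hco ht =>
      exact ⟨⟨n, isRegular_counterexample hT t⟩, fun H h => by cases h⟩
    | accept T k hcl hco hlang =>
      refine ⟨⟨n, hT⟩, fun H h => ?_⟩
      cases h
      exact ⟨hT.isNominal_hypothesis hα hfin hL,
        hT.isResidual_hypothesis hα hfin hL hcl hco hlang, hlang⟩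

/-- A configuration without output is not final. -/
theorem exists_step [Infinite 𝔸] (hα : ∀ a : α, FinitelySupported 𝔸 a)
    (hfin : OrbitFinite 𝔸 (Set.univ : Set α)) (hL : Equivariant 𝔸 L) (hT : T.IsRegular 𝔸 n)
    (k : ℕ) : ∃ c', Step 𝔸 L ⟨T, k, none⟩ c' := by
  have hcons : ∀ T : Table α, ∃ T', ConsistencyPhase 𝔸 L T T' := by
    intro T
    by_cases h : T.JoinConsistent L
    · exact ⟨_, .skip T h⟩
    · have h' := h
      simp only [Table.JoinConsistent, not_forall] at h'
      obtain ⟨s₁, hs₁, s₂, hs₂, a, hsub, hns⟩ := h'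
      obtain ⟨e, he₁, he₂⟩ := Set.not_subset.1 hns
      exact ⟨_, .extend T s₁ s₂ a e h hs₁ hs₂ he₁.1 hsub he₁ he₂⟩
  by_cases hcl : T.JoinClosed L 𝔸
  · by_cases hco : T.JoinConsistent L
    · by_cases hlang : (T.hypothesis L 𝔸).language = L
      · exact ⟨_, .accept T k hcl hco hlang⟩
      · obtain ⟨t, ht⟩ : ∃ t, ¬ (t ∈ L ↔ t ∈ (T.hypothesis L 𝔸).language) := by
          by_contra hcon
          push Not at hcon
          exact hlang (Set.ext fun t => (hcon t).symm)
        exact ⟨_, .counterexample T k t hcl hco ht⟩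
    · obtain ⟨T', hT'⟩ := hcons T
      exact ⟨_, .body T T T' k (fun h => hco h.2) (.skip T hcl) hT'⟩
  · have h := hcl
    rw [hT.joinClosed_iff hα hfin hL] at h
    obtain ⟨r, hr, hru⟩ := Set.not_subset.1 h
    obtain ⟨t, ht | ⟨s, hs, a, rfl⟩, rfl⟩ := hr.1
    · exact absurd ⟨t, ht, rfl⟩ hru
    · obtain ⟨T', hT'⟩ := hcons ⟨T.S ∪ wordsUpTo α (s ++ [a]).length, T.E⟩
      exact ⟨_, .body T _ T' k (fun h => hcl h.1) (.extend T s a hcl hs ⟨hr, hru⟩) hT'⟩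

end Runs

/-! ### A potential for the tables -/

namespace Table

variable {𝔸 : Type v} {α : Type u} [MulAction (Equiv.Perm 𝔸) α] (L : Set (List α))
  (T : Table α)

/-- The pairs of row indices for which the table refutes the inclusion of rows. -/
def separatedPairs : Set (List α × List α) :=
  {p | p.1 ∈ T.S ∧ p.2 ∈ T.rowIndices ∧ ¬ T.row L p.1 ⊆ T.row L p.2}

/-- The indices of the upper rows which are join-irreducible among the upper rows. -/
def irreducibleIndices (𝔸 : Type v) [MulAction (Equiv.Perm 𝔸) α] : Set (List α) :=
  {s | s ∈ T.S ∧ T.row L s ∈ joinIrreducibles 𝔸 (T.upperRows L)}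

variable {L} {T} {T₀ T₁ : Table α} {n m : ℕ}

theorem row_inter (hE : T₀.E ⊆ T₁.E) (t : List α) : T₁.row L t ∩ T₀.E = T₀.row L t := by
  ext e
  exact ⟨fun h => ⟨h.2, h.1.2⟩, fun h => ⟨⟨hE h.1, h.2⟩, h.1⟩⟩

theorem row_subset_of_subset (hE : T₀.E ⊆ T₁.E) {s t : List α} (h : T₁.row L s ⊆ T₁.row L t) :
    T₀.row L s ⊆ T₀.row L t := by
  rw [← row_inter hE, ← row_inter hE t]
  exact Set.inter_subset_inter_left _ h

/-- Old rows are restrictions of new ones, so a refuted inclusion stays refuted. -/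
theorem separatedPairs_mono (hS : T₀.S ⊆ T₁.S) (hE : T₀.E ⊆ T₁.E) :
    T₀.separatedPairs L ⊆ T₁.separatedPairs L := by
  rintro ⟨s, t⟩ ⟨hs, ht, hst⟩
  refine ⟨hS hs, ?_, fun h => hst (row_subset_of_subset hE h)⟩
  rcases ht with ht | ⟨t, ht, a, rfl⟩
  · exact Or.inl (hS ht)
  · exact Or.inr ⟨t, hS ht, a, rfl⟩

theorem IsRegular.equivariant_separatedPairs (hT : T.IsRegular 𝔸 n) (hL : Equivariant 𝔸 L) :
    Equivariant 𝔸 (T.separatedPairs L) := by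
  refine equivariant_of_smul_mem ?_
  rintro g ⟨s, t⟩ ⟨hs, ht, hst⟩
  refine ⟨?_, ?_, ?_⟩
  · rw [hT.S_eq] at hs ⊢
    exact (equivariant_wordsUpTo n).smul_mem g hs
  · rw [hT.rowIndices_eq] at ht ⊢
    exact (equivariant_wordsUpTo (n + 1)).smul_mem g ht
  · rw [Prod.smul_fst, Prod.smul_snd, row_smul hL hT.equivariant, row_smul hL hT.equivariant,
      Set.smul_set_subset_smul_set_iff]
    exact hst

theorem IsRegular.equivariant_irreducibleIndices (hT : T.IsRegular 𝔸 n) (hL : Equivariant 𝔸 L) :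
    Equivariant 𝔸 (T.irreducibleIndices L 𝔸) := by
  refine equivariant_of_smul_mem ?_
  rintro g s ⟨hs, hrow⟩
  refine ⟨?_, ?_⟩
  · rw [hT.S_eq] at hs ⊢
    exact (equivariant_wordsUpTo n).smul_mem g hs
  · rw [row_smul hL hT.equivariant]
    exact (equivariant_joinIrreducibles (hT.equivariant_upperRows hL)).smul_mem g hrow

theorem IsRegular.irreducibleIndices_subset (hT : T.IsRegular 𝔸 n) :
    T.irreducibleIndices L 𝔸 ⊆ wordsUpTo α n := fun _ hs => hT.S_eq ▸ hs.1

theorem IsRegular.separatedPairs_subset (hT : T.IsRegular 𝔸 n) (hnm : n ≤ m) :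
    T.separatedPairs L ⊆ wordsUpTo α m ×ˢ wordsUpTo α (m + 1) := by
  rintro ⟨s, t⟩ ⟨hs, ht, -⟩
  rw [hT.S_eq] at hs
  rw [hT.rowIndices_eq] at ht
  exact ⟨wordsUpTo_mono hnm hs, wordsUpTo_mono (by omega) ht⟩

/-- If a row ceases to be join-irreducible when columns are added, then it has been separated from
another row. -/
theorem exists_separated_of_not_irreducible (hS : T₀.S = T₁.S) (hE : T₀.E ⊆ T₁.E)
    (hE₀ : Equivariant 𝔸 T₀.E) {s : List α} (hs₀ : s ∈ T₀.irreducibleIndices L 𝔸)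
    (hs₁ : s ∉ T₁.irreducibleIndices L 𝔸) :
    ∃ t, (s, t) ∈ T₁.separatedPairs L \ T₀.separatedPairs L := by
  obtain ⟨hs, hrow, hne, hirr⟩ := hs₀
  have hs' : s ∈ T₁.S := hS ▸ hs
  have hne₁ : (T₁.row L s).Nonempty := by
    rw [← row_inter hE] at hne
    exact hne.left
  have hex : ∃ F ⊆ T₁.upperRows L, FinitelySupported 𝔸 F ∧ T₁.row L s = ⋃₀ F ∧
      T₁.row L s ∉ F := by
    by_contra hcon
    push Not at hcon
    exact hs₁ ⟨hs', ⟨s, hs', rfl⟩, hne₁, fun F hF hFs h => hcon F hF hFs h⟩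
  obtain ⟨F, hF, hFs, hsF, hsF'⟩ := hex
  -- Restricted to the old columns, F still decomposes the row, so the old irreducibility gives t
  -- with row t ∈ F and the same old row as s. The new row of t lies properly inside that of s, so
  -- new columns separate s from t.
  have := hirr ((fun f => f ∩ T₀.E) '' F) ?_ ?_ ?_
  · obtain ⟨f, hf, hfs⟩ := this
    obtain ⟨t, ht, rfl⟩ := hF hf
    simp only [row_inter hE] at hfs
    refine ⟨t, ⟨hs', Or.inl ht, fun h => hsF' ?_⟩, fun h => h.2.2 hfs.symm.subset⟩
    have : T₁.row L t ⊆ T₁.row L s := hsF ▸ Set.subset_sUnion_of_mem hf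
    exact subset_antisymm h this ▸ hf
  · rintro _ ⟨f, hf, rfl⟩
    obtain ⟨t, ht, rfl⟩ := hF hf
    exact ⟨t, hS ▸ ht, (row_inter hE t).symm⟩
  · refine hFs.map (fun F : Set (Set (List α)) => (fun f => f ∩ T₀.E) '' F) fun g F => ?_
    ext x
    simp only [Set.mem_image, Set.mem_smul_set]
    constructor
    · rintro ⟨_, ⟨f, hf, rfl⟩, rfl⟩
      refine ⟨_, ⟨f, hf, rfl⟩, ?_⟩
      rw [Set.smul_set_inter, hE₀ g]
    · rintro ⟨_, ⟨f, hf, rfl⟩, rfl⟩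
      refine ⟨_, ⟨f, hf, rfl⟩, ?_⟩
      rw [Set.smul_set_inter, hE₀ g]
  · rw [← row_inter hE, hsF, Set.sUnion_eq_biUnion, Set.iUnion₂_inter, Set.sUnion_image]

/-- A potential that grows between any two equivalence queries. -/
noncomputable def potential (L : Set (List α)) (𝔸 : Type v) [MulAction (Equiv.Perm 𝔸) α]
    (T : Table α) (n : ℕ) : ℕ :=
  2 * (orbits 𝔸 (T.separatedPairs L)).ncard + (orbits 𝔸 (T.irreducibleIndices L 𝔸)).ncard +
    ∑ m ∈ Finset.range n, (orbitCount 𝔸 (wordsUpTo α m) + 1)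

end Table

section

variable {𝔸 : Type v} {X : Type*} [MulAction (Equiv.Perm 𝔸) X]

theorem ncard_orbits_sdiff_add {U V : Set X} (hU : Equivariant 𝔸 U)
    (hUV : U ⊆ V) (hfin : (orbits 𝔸 V).Finite) :
    (orbits 𝔸 (V \ U)).ncard + (orbits 𝔸 U).ncard = (orbits 𝔸 V).ncard := by
  have : orbits 𝔸 (V \ U) = orbits 𝔸 V \ orbits 𝔸 U := by
    ext O
    constructor
    · rintro ⟨x, ⟨hx, hxU⟩, rfl⟩
      exact ⟨⟨x, hx, rfl⟩, fun h => hxU (mem_of_orbit_mem_orbits hU h)⟩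
    · rintro ⟨⟨x, hx, rfl⟩, hxU⟩
      exact ⟨x, ⟨hx, fun h => hxU ⟨x, h, rfl⟩⟩, rfl⟩
  rw [this]
  exact Set.ncard_sdiff_add_ncard_of_subset (orbits_mono hUV) hfin

theorem ncard_orbits_lt {U V : Set X} (hU : Equivariant 𝔸 U)
    (hUV : U ⊆ V) (hfin : (orbits 𝔸 V).Finite) (hne : U ≠ V) :
    (orbits 𝔸 U).ncard < (orbits 𝔸 V).ncard := by
  refine Set.ncard_lt_ncard ⟨orbits_mono hUV, fun h => hne (subset_antisymm hUV fun x hx => ?_)⟩ hfin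
  exact mem_of_orbit_mem_orbits hU (h ⟨x, hx, rfl⟩)

theorem ncard_orbits_le {U V : Set X} (hUV : U ⊆ V) (hfin : (orbits 𝔸 V).Finite) :
    (orbits 𝔸 U).ncard ≤ (orbits 𝔸 V).ncard :=
  Set.ncard_le_ncard (orbits_mono hUV) hfin

end

/-! ### Growth of the potential and termination -/

section

variable {𝔸 : Type v} {α : Type u} [MulAction (Equiv.Perm 𝔸) α] {L : Set (List α)}

theorem finite_orbits_wordsUpTo [Infinite 𝔸] (hα : ∀ a : α, FinitelySupported 𝔸 a)
    (hfin : OrbitFinite 𝔸 (Set.univ : Set α)) (m : ℕ) : (orbits 𝔸 (wordsUpTo α m)).Finite :=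
  (orbitFinite_iff.1 (orbitFinite_wordsUpTo hα hfin m)).2

theorem finite_orbits_wordPairs [Infinite 𝔸] (hα : ∀ a : α, FinitelySupported 𝔸 a)
    (hfin : OrbitFinite 𝔸 (Set.univ : Set α)) (m k : ℕ) :
    (orbits 𝔸 (wordsUpTo α m ×ˢ wordsUpTo α k)).Finite :=
  (orbitFinite_iff.1 ((orbitFinite_wordsUpTo hα hfin m).prod (orbitFinite_wordsUpTo hα hfin k)
    (fun w _ => finitelySupported_list hα w) (fun w _ => finitelySupported_list hα w))).2

/-- The potential grows between two equivalence queries. -/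
theorem Table.potential_lt [Infinite 𝔸] (hα : ∀ a : α, FinitelySupported 𝔸 a)
    (hfin : OrbitFinite 𝔸 (Set.univ : Set α)) (hL : Equivariant 𝔸 L) {T₀ T₁ : Table α} {n₀ n₁ : ℕ}
    (hT₀ : T₀.IsRegular 𝔸 n₀) (hT₁ : T₁.IsRegular 𝔸 n₁) (hn : n₀ ≤ n₁) (hE : T₀.E ⊆ T₁.E)
    (hcl₀ : T₀.JoinClosed L 𝔸) (hcl₁ : T₁.JoinClosed L 𝔸) {t : List α} (ht : t ∈ T₁.E)
    (htL : ¬ (t ∈ L ↔ t ∈ (T₀.hypothesis L 𝔸).language)) :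
    T₀.potential L 𝔸 n₀ < T₁.potential L 𝔸 n₁ := by
  have hD₁fin : (orbits 𝔸 (T₁.separatedPairs L)).Finite :=
    (finite_orbits_wordPairs hα hfin n₁ (n₁ + 1)).subset
      (orbits_mono (hT₁.separatedPairs_subset le_rfl))
  have hJ₀fin : (orbits 𝔸 (T₀.irreducibleIndices L 𝔸)).Finite :=
    (finite_orbits_wordsUpTo hα hfin n₀).subset (orbits_mono hT₀.irreducibleIndices_subset)
  have hJ₁fin : (orbits 𝔸 (T₁.irreducibleIndices L 𝔸)).Finite :=
    (finite_orbits_wordsUpTo hα hfin n₁).subset (orbits_mono hT₁.irreducibleIndices_subset)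
  have hSsub : T₀.S ⊆ T₁.S := by
    rw [hT₀.S_eq, hT₁.S_eq]
    exact wordsUpTo_mono hn
  have hD := separatedPairs_mono (L := L) hSsub hE
  have hDle := ncard_orbits_le hD hD₁fin
  unfold potential
  rcases hn.lt_or_eq with hlt | rfl
  -- If n has grown, all irreducible indices may have been lost; the summand for m = n₀ outweighs
  -- them by one.
  · have h1 : (orbits 𝔸 (T₀.irreducibleIndices L 𝔸)).ncard ≤ orbitCount 𝔸 (wordsUpTo α n₀) :=
      ncard_orbits_le hT₀.irreducibleIndices_subset (finite_orbits_wordsUpTo hα hfin n₀)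
    have h2 : ∑ m ∈ Finset.range (n₀ + 1), (orbitCount 𝔸 (wordsUpTo α m) + 1) ≤
        ∑ m ∈ Finset.range n₁, (orbitCount 𝔸 (wordsUpTo α m) + 1) :=
      Finset.sum_le_sum_of_subset (by simpa using hlt)
    rw [Finset.sum_range_succ] at h2
    omega
  · have hS : T₀.S = T₁.S := hT₀.S_eq.trans hT₁.S_eq.symm
    have hloss : T₀.irreducibleIndices L 𝔸 \ T₁.irreducibleIndices L 𝔸 ⊆
        Prod.fst '' (T₁.separatedPairs L \ T₀.separatedPairs L) := by
      rintro s ⟨hs₀, hs₁⟩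
      obtain ⟨t, ht⟩ := exists_separated_of_not_irreducible hS hE hT₀.equivariant hs₀ hs₁
      exact ⟨(s, t), ht, rfl⟩
    -- If no inclusion has been refuted, no irreducible index is lost. If none were gained either,
    -- both tables would have hypotheses with the same language, but the second is correct on its
    -- column t.
    by_cases hDeq : T₀.separatedPairs L = T₁.separatedPairs L
    · have hJsub : T₀.irreducibleIndices L 𝔸 ⊆ T₁.irreducibleIndices L 𝔸 := by
        rw [hDeq, sdiff_self, Set.bot_eq_empty, Set.image_empty, Set.subset_empty_iff,
          Set.sdiff_eq_empty] at hloss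
        exact hloss
      have hJne : T₀.irreducibleIndices L 𝔸 ≠ T₁.irreducibleIndices L 𝔸 := by
        intro hJeq
        have hrI : T₀.rowIndices = T₁.rowIndices := by rw [rowIndices, rowIndices, hS]
        have hle : ∀ s ∈ T₀.S, ∀ t ∈ T₀.rowIndices,
            T₀.row L s ⊆ T₀.row L t ↔ T₁.row L s ⊆ T₁.row L t := by
          intro s hs t ht
          refine ⟨fun h => ?_, row_subset_of_subset hE⟩
          by_contra hcon
          have : (s, t) ∈ T₁.separatedPairs L := ⟨hS ▸ hs, hrI ▸ ht, hcon⟩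
          rw [← hDeq] at this
          exact this.2.2 h
        have hJ : ∀ s ∈ T₀.S, T₀.row L s ∈ T₀.upperJoinIrreducibles L 𝔸 ↔
            T₁.row L s ∈ T₁.upperJoinIrreducibles L 𝔸 := by
          intro s hs
          rw [hT₀.upperJoinIrreducibles_eq_upper hα hfin hL hcl₀,
            hT₁.upperJoinIrreducibles_eq_upper hα hfin hL hcl₁]
          have := Set.ext_iff.1 hJeq s
          exact ⟨fun h => (this.1 ⟨hs, h⟩).2, fun h => (this.2 ⟨hS ▸ hs, h⟩).2⟩
        have hlang : (T₀.hypothesis L 𝔸).language = (T₁.hypothesis L 𝔸).language :=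
          subset_antisymm
            (language_hypothesis_subset hS hT₀.nil_mem_S hT₁.nil_mem hle hJ)
            (language_hypothesis_subset hS.symm hT₁.nil_mem_S hT₀.nil_mem
              (fun s hs t ht => (hle s (hS ▸ hs) t (hrI ▸ ht)).symm)
              (fun s hs => (hJ s (hS ▸ hs)).symm))
        rw [hlang, hT₁.mem_language_iff hα hfin hL hcl₁ ht] at htL
        exact htL Iff.rfl
      have := ncard_orbits_lt (hT₀.equivariant_irreducibleIndices hL) hJsub hJ₁fin hJne
      omega
    -- The lost indices are first components of newly separated pairs, so they have at most as many
    -- orbits as these pairs. With weight 2 on the pairs, a net gain remains.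
    · have hlt := ncard_orbits_lt (hT₀.equivariant_separatedPairs hL) hD hD₁fin hDeq
      have hadd := ncard_orbits_sdiff_add (hT₀.equivariant_separatedPairs hL) hD hD₁fin
      have hdfin : (orbits 𝔸 (T₁.separatedPairs L \ T₀.separatedPairs L)).Finite :=
        hD₁fin.subset (orbits_mono Set.sdiff_subset)
      have himg := orbits_image (𝔸 := 𝔸) (Prod.fst : List α × List α → List α)
        (fun g x => rfl) hdfin
      have h1 := (ncard_orbits_le hloss himg.1).trans himg.2
      have h2 : orbits 𝔸 (T₀.irreducibleIndices L 𝔸) ⊆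
          orbits 𝔸 (T₀.irreducibleIndices L 𝔸 \ T₁.irreducibleIndices L 𝔸) ∪
            orbits 𝔸 (T₁.irreducibleIndices L 𝔸) := by
        rw [orbits, orbits, orbits, ← Set.image_union, Set.sdiff_union_self]
        exact Set.image_mono Set.subset_union_left
      have h3 := (Set.ncard_le_ncard h2
        ((hJ₀fin.subset (orbits_mono Set.sdiff_subset)).union hJ₁fin)).trans (Set.ncard_union_le _ _)
      omega

/-- The number of orbits of the pairs of row indices of the largest table. -/
noncomputable def pairBound (𝔸 : Type v) (α : Type u) [MulAction (Equiv.Perm 𝔸) α] (l : ℕ) : ℕ :=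
  (orbits 𝔸 (wordsUpTo α l ×ˢ wordsUpTo α (l + 1))).ncard

theorem Table.IsRegular.ncard_separatedPairs_le [Infinite 𝔸] (hα : ∀ a : α, FinitelySupported 𝔸 a)
    (hfin : OrbitFinite 𝔸 (Set.univ : Set α)) {T : Table α} {n l : ℕ}
    (hT : T.IsRegular 𝔸 n) (hn : n ≤ l) :
    (orbits 𝔸 (T.separatedPairs L)).ncard ≤ pairBound 𝔸 α l :=
  ncard_orbits_le (hT.separatedPairs_subset hn) (finite_orbits_wordPairs hα hfin l (l + 1))

theorem orbitCount_wordsUpTo_mono [Infinite 𝔸] (hα : ∀ a : α, FinitelySupported 𝔸 a)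
    (hfin : OrbitFinite 𝔸 (Set.univ : Set α)) {m l : ℕ} (h : m ≤ l) :
    orbitCount 𝔸 (wordsUpTo α m) ≤ orbitCount 𝔸 (wordsUpTo α l) :=
  ncard_orbits_le (wordsUpTo_mono h) (finite_orbits_wordsUpTo hα hfin l)

/-- A bound on the potential of all tables. -/
noncomputable def potentialBound (𝔸 : Type v) (α : Type u) [MulAction (Equiv.Perm 𝔸) α]
    (l : ℕ) : ℕ :=
  2 * pairBound 𝔸 α l + orbitCount 𝔸 (wordsUpTo α l) + l * (orbitCount 𝔸 (wordsUpTo α l) + 1)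

theorem Table.IsRegular.potential_le [Infinite 𝔸] (hα : ∀ a : α, FinitelySupported 𝔸 a)
    (hfin : OrbitFinite 𝔸 (Set.univ : Set α)) {T : Table α} {n l : ℕ}
    (hT : T.IsRegular 𝔸 n) (hn : n ≤ l) : T.potential L 𝔸 n ≤ potentialBound 𝔸 α l := by
  have h1 := hT.ncard_separatedPairs_le (L := L) hα hfin hn
  have h2 : (orbits 𝔸 (T.irreducibleIndices L 𝔸)).ncard ≤ orbitCount 𝔸 (wordsUpTo α l) :=
    ncard_orbits_le (hT.irreducibleIndices_subset.trans (wordsUpTo_mono hn))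
      (finite_orbits_wordsUpTo hα hfin l)
  have h3 : ∑ m ∈ Finset.range n, (orbitCount 𝔸 (wordsUpTo α m) + 1) ≤
      n * (orbitCount 𝔸 (wordsUpTo α l) + 1) := by
    have := Finset.sum_le_card_nsmul (Finset.range n)
      (fun m => orbitCount 𝔸 (wordsUpTo α m) + 1) (orbitCount 𝔸 (wordsUpTo α l) + 1)
      (fun m hm => Nat.succ_le_succ (orbitCount_wordsUpTo_mono hα hfin
        ((Finset.mem_range.1 hm).le.trans hn)))
    simpa using this
  have h4 := Nat.mul_le_mul_right (orbitCount 𝔸 (wordsUpTo α l) + 1) hn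
  unfold potential potentialBound
  omega

/-- The history of a configuration: the data of the last equivalence query. -/
def QueryHistory (𝔸 : Type v) [MulAction (Equiv.Perm 𝔸) α] (L : Set (List α)) (T : Table α)
    (n k : ℕ) : Prop :=
  k = 0 ∨ ∃ T₀ : Table α, ∃ n₀ ≤ n, T₀.IsRegular 𝔸 n₀ ∧ T₀.JoinClosed L 𝔸 ∧ T₀.E ⊆ T.E ∧
    (∃ t ∈ T.E, ¬ (t ∈ L ↔ t ∈ (T₀.hypothesis L 𝔸).language)) ∧ k ≤ T₀.potential L 𝔸 n₀ + 1

theorem QueryHistory.mono {T T' : Table α} {n n' k : ℕ} (h : QueryHistory 𝔸 L T n k)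
    (hn : n ≤ n') (hE : T.E ⊆ T'.E) : QueryHistory 𝔸 L T' n' k := by
  rcases h with h | ⟨T₀, n₀, hn₀, hT₀, hcl, hE₀, ⟨t, ht, htL⟩, hk⟩
  · exact Or.inl h
  · exact Or.inr ⟨T₀, n₀, hn₀.trans hn, hT₀, hcl, hE₀.trans hE, ⟨t, hE ht, htL⟩, hk⟩

theorem QueryHistory.le_potential [Infinite 𝔸] (hα : ∀ a : α, FinitelySupported 𝔸 a)
    (hfin : OrbitFinite 𝔸 (Set.univ : Set α)) (hL : Equivariant 𝔸 L) {T : Table α} {n k : ℕ}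
    (h : QueryHistory 𝔸 L T n k) (hT : T.IsRegular 𝔸 n) (hcl : T.JoinClosed L 𝔸) :
    k ≤ T.potential L 𝔸 n := by
  rcases h with rfl | ⟨T₀, n₀, hn₀, hT₀, hcl₀, hE₀, ⟨t, ht, htL⟩, hk⟩
  · exact Nat.zero_le _
  · have := Table.potential_lt hα hfin hL hT₀ hT hn₀ hE₀ hcl₀ hcl ht htL
    omega

/-- Each step that does not return makes progress. -/
theorem Step.progress [Infinite 𝔸] (hα : ∀ a : α, FinitelySupported 𝔸 a)
    (hfin : OrbitFinite 𝔸 (Set.univ : Set α)) (hL : Equivariant 𝔸 L)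
    (hres : IsResidualLanguage 𝔸 L) {c c' : Config α} (h : Step 𝔸 L c c')
    (hc' : c'.output = none) {n : ℕ} (hT : c.table.IsRegular 𝔸 n) (hn : n ≤ charLength 𝔸 L)
    (hq : QueryHistory 𝔸 L c.table n c.queries) :
    ∃ n' ≤ charLength 𝔸 L, c'.table.IsRegular 𝔸 n' ∧
      QueryHistory 𝔸 L c'.table n' c'.queries ∧
      n + (orbits 𝔸 (c.table.separatedPairs L)).ncard + c.queries <
        n' + (orbits 𝔸 (c'.table.separatedPairs L)).ncard + c'.queries := by
  have hDfin : ∀ {T : Table α} {n}, T.IsRegular 𝔸 n → (orbits 𝔸 (T.separatedPairs L)).Finite :=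
    fun {T n} hT => (finite_orbits_wordPairs hα hfin n (n + 1)).subset
      (orbits_mono (hT.separatedPairs_subset le_rfl))
  -- A closing step raises n, a pure consistency step separates a new orbit of pairs, and a
  -- counterexample raises the query count; no summand ever decreases.
  cases h with
  | body T T₁ T₂ k hnot h₁ h₂ =>
    rcases h₁.cases hT with ⟨hcl, rfl⟩ | ⟨-, hT₁, hS, hE, hJ⟩
    · obtain ⟨hT₂, hS, hE, ⟨hco, -⟩ | ⟨s₁, hs₁, s₂, hs₂, hsub, hnsub⟩⟩ := h₂.cases hT
      · exact absurd ⟨hcl, hco⟩ hnot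
      refine ⟨n, hn, hT₂, hq.mono le_rfl hE, ?_⟩
      have : (orbits 𝔸 (T₁.separatedPairs L)).ncard < (orbits 𝔸 (T₂.separatedPairs L)).ncard :=
        ncard_orbits_lt (hT.equivariant_separatedPairs hL)
        (Table.separatedPairs_mono hS.symm.subset hE) (hDfin hT₂) (fun h => by
          have hmem : (s₁, s₂) ∈ T₂.separatedPairs L :=
            ⟨hS ▸ hs₁, Or.inl (hS ▸ hs₂), hnsub⟩
          rw [← h] at hmem
          exact hmem.2.2 hsub)
      change n + (orbits 𝔸 (T₁.separatedPairs L)).ncard + k <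
        n + (orbits 𝔸 (T₂.separatedPairs L)).ncard + k
      omega
    · obtain ⟨hT₂, hS₂, hE₂, -⟩ := h₂.cases hT₁
      have hn' : n + 1 ≤ charLength 𝔸 L := by
        by_contra hcon
        exact hJ (hT.joinIrreducibles_subset_upperRows hα hL hres (by omega))
      have hE' : T.E ⊆ T₂.E := hE ▸ hE₂
      refine ⟨n + 1, hn', hT₂, hq.mono n.le_succ hE', ?_⟩
      have := ncard_orbits_le (𝔸 := 𝔸) (Table.separatedPairs_mono (L := L)
        (hS.trans hS₂.symm.subset) hE') (hDfin hT₂)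
      simp only
      omega
  | counterexample T k t hcl hco ht =>
    refine ⟨n, hn, isRegular_counterexample hT t, Or.inr ⟨T, n, le_rfl, hT, hcl,
      Set.subset_union_left, ⟨t, Or.inr ?_, ht⟩, ?_⟩, ?_⟩
    · exact Set.mem_biUnion (x := t) (List.suffix_refl t) (MulAction.mem_orbit_self t)
    · have := hq.le_potential hα hfin hL hT hcl
      simp only at this ⊢
      omega
    · have := ncard_orbits_le (𝔸 := 𝔸) (Table.separatedPairs_mono (L := L) (T₀ := T)
        (T₁ := ⟨T.S, T.E ∪ ⋃ t₀ ∈ {t₀ | t₀ <:+ t}, MulAction.orbit (Equiv.Perm 𝔸) t₀⟩)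
        subset_rfl Set.subset_union_left) (hDfin (isRegular_counterexample hT t))
      simp only
      omega
  | accept T k hcl hco hlang => cases hc'

theorem queryHistory_initial : QueryHistory 𝔸 L (initialConfig α).table 0 0 := Or.inl rfl

theorem Step.output_eq_none {c c' : Config α} (h : Step 𝔸 L c c') : c.output = none := by
  cases h <;> rfl

theorem Reachable.invariant [Infinite 𝔸] (hα : ∀ a : α, FinitelySupported 𝔸 a)
    (hfin : OrbitFinite 𝔸 (Set.univ : Set α)) (hL : Equivariant 𝔸 L)
    (hres : IsResidualLanguage 𝔸 L) {c : Config α} (hc : Reachable 𝔸 L c)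
    (hout : c.output = none) : ∃ n ≤ charLength 𝔸 L, c.table.IsRegular 𝔸 n ∧
      QueryHistory 𝔸 L c.table n c.queries := by
  induction hc with
  | refl => exact ⟨0, Nat.zero_le _, isRegular_initial, queryHistory_initial⟩
  | tail _ hstep ih =>
    obtain ⟨n, hn, hT, hq⟩ := ih hstep.output_eq_none
    obtain ⟨n', hn', hT', hq', -⟩ := hstep.progress hα hfin hL hres hout hT hn hq
    exact ⟨n', hn', hT', hq'⟩

theorem QueryHistory.le_bound [Infinite 𝔸] (hα : ∀ a : α, FinitelySupported 𝔸 a)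
    (hfin : OrbitFinite 𝔸 (Set.univ : Set α)) {T : Table α} {n k l : ℕ}
    (h : QueryHistory 𝔸 L T n k) (hn : n ≤ l) : k ≤ potentialBound 𝔸 α l + 1 := by
  rcases h with rfl | ⟨T₀, n₀, hn₀, hT₀, -, -, -, hk⟩
  · exact Nat.zero_le _
  · have := hT₀.potential_le (L := L) hα hfin (hn₀.trans hn)
    omega

/-- The number of equivalence queries on a residual language. -/
theorem Reachable.queries_le [Infinite 𝔸] (hα : ∀ a : α, FinitelySupported 𝔸 a)
    (hfin : OrbitFinite 𝔸 (Set.univ : Set α)) (hL : Equivariant 𝔸 L)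
    (hres : IsResidualLanguage 𝔸 L) {c : Config α} (hc : Reachable 𝔸 L c) :
    c.queries ≤ potentialBound 𝔸 α (charLength 𝔸 L) + 2 := by
  rcases hc.cases_tail with rfl | ⟨c₀, hc₀, hstep⟩
  · exact Nat.zero_le _
  -- The invariant covers configurations without output, so it is applied one step earlier; the last
  -- step may add one query.
  · obtain ⟨n, hn, -, hq⟩ := Reachable.invariant hα hfin hL hres hc₀ hstep.output_eq_none
    have h := hq.le_bound hα hfin hn
    have : c.queries ≤ c₀.queries + 1 := by
      cases hstep <;> simp
    omega

/-- After i steps the measure of `Step.progress` is at least i, whereas each of its three summands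
is bounded in terms of `charLength`. -/
theorem not_exists_infinite_run [Infinite 𝔸] (hα : ∀ a : α, FinitelySupported 𝔸 a)
    (hfin : OrbitFinite 𝔸 (Set.univ : Set α)) (hL : Equivariant 𝔸 L)
    (hres : IsResidualLanguage 𝔸 L) :
    ¬ ∃ f : ℕ → Config α, f 0 = initialConfig α ∧ ∀ i, Step 𝔸 L (f i) (f (i + 1)) := by
  rintro ⟨f, hf₀, hf⟩
  have key : ∀ i, ∃ n ≤ charLength 𝔸 L, (f i).table.IsRegular 𝔸 n ∧
      QueryHistory 𝔸 L (f i).table n (f i).queries ∧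
      i ≤ n + (orbits 𝔸 ((f i).table.separatedPairs L)).ncard + (f i).queries := by
    intro i
    induction i with
    | zero =>
      rw [hf₀]
      exact ⟨0, Nat.zero_le _, isRegular_initial, queryHistory_initial, Nat.zero_le _⟩
    | succ i ih =>
      obtain ⟨n, hn, hT, hq, hi⟩ := ih
      obtain ⟨n', hn', hT', hq', hlt⟩ := (hf i).progress hα hfin hL hres
        (hf (i + 1)).output_eq_none hT hn hq
      exact ⟨n', hn', hT', hq', by omega⟩
  obtain ⟨n, hn, hT, hq, hi⟩ := key (charLength 𝔸 L + pairBound 𝔸 α (charLength 𝔸 L) +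
    (potentialBound 𝔸 α (charLength 𝔸 L) + 1) + 1)
  have h1 := hT.ncard_separatedPairs_le (L := L) hα hfin hn
  have h2 := hq.le_bound hα hfin hn
  omega

theorem everyRunReturns [Infinite 𝔸] (hα : ∀ a : α, FinitelySupported 𝔸 a)
    (hfin : OrbitFinite 𝔸 (Set.univ : Set α)) (hL : Equivariant 𝔸 L)
    (hres : IsResidualLanguage 𝔸 L) : EveryRunReturns 𝔸 L := by
  refine ⟨not_exists_infinite_run hα hfin hL hres, fun c hc hfinal => ?_⟩
  obtain ⟨⟨n, hT⟩, -⟩ := Reachable.isRegular hα hfin hL hc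
  rcases c with ⟨T, k, _ | H⟩
  · obtain ⟨c', hc'⟩ := exists_step hα hfin hL hT k
    exact absurd hc' (hfinal c')
  · exact ⟨H, rfl⟩

end

/-! ### Words whose letters hardly share atoms -/

section Tuples

variable {𝔸 : Type v} [Infinite 𝔸] {X : Type*} [MulAction (Equiv.Perm 𝔸) X]

theorem card_supp_le {d : ℕ} {x : X} (h : SupportedBy 𝔸 d x) : (supp 𝔸 x).card ≤ d :=
  let ⟨_, hs, hx⟩ := h
  (Finset.card_le_card (supp_subset hx)).trans hs

/-- The `k`-th component of the tuple shares no atoms with the others. -/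
def IsolatedAt (𝔸 : Type v) [Infinite 𝔸] {X : Type*} [MulAction (Equiv.Perm 𝔸) X] {l : ℕ}
    (x : Fin l → X) (k : Fin l) : Prop :=
  ∀ j, j ≠ k → Disjoint (supp 𝔸 (x j)) (supp 𝔸 (x k))

/-- Replace the components at the positions in the range of `κ` by the first component. -/
noncomputable def collapse {l d : ℕ} [NeZero l] (x : Fin l → X) (κ : Fin d → Fin l) : Fin l → X :=
  open Classical in fun k => if k ∈ Set.range κ then x 0 else x k

variable {l d : ℕ}

theorem supports_tuple {x : Fin l → X} (hx : ∀ k, FinitelySupported 𝔸 (x k)) (t : Finset 𝔸)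
    (ht : ∀ k, supp 𝔸 (x k) ⊆ t) : MulAction.Supports (Equiv.Perm 𝔸) (t : Set 𝔸) x :=
  fun g hg => funext fun k => supp_supports (hx k) g fun _ ha => hg (ht k ha)

/-- There are at most l * d incidences (k, a) with a in the support of x k, and more than d * (l -
1) atoms. Choosing one incidence (f a, a) per atom leaves fewer than d. A component k sharing an
atom a with another one either has a leftover incidence (k, a), or k = f a and the other component
has one. -/
theorem card_not_isolated_le [NeZero l] {x : Fin l → X} (hx : ∀ k, SupportedBy 𝔸 d (x k))
    (hF : ¬ SupportedBy 𝔸 (d * (l - 1)) x) (H : Finset (Fin l))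
    (hH : ∀ k ∈ H, ¬ IsolatedAt 𝔸 x k) : H.card ≤ 2 * d := by
  classical
  have hl : 1 ≤ l := NeZero.one_le
  let U : Finset 𝔸 := Finset.univ.biUnion fun k => supp 𝔸 (x k)
  have hU : d * (l - 1) < U.card := by
    by_contra hcon
    exact hF ⟨U, not_lt.1 hcon, supports_tuple
      (fun k => let ⟨s, _, hs⟩ := hx k; ⟨s, hs⟩) U
      (fun k => Finset.subset_biUnion_of_mem (fun k => supp 𝔸 (x k)) (Finset.mem_univ k))⟩
  have hf : ∀ a, ∃ k, a ∈ U → a ∈ supp 𝔸 (x k) := by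
    intro a
    by_cases ha : a ∈ U
    · obtain ⟨k, -, hk⟩ := Finset.mem_biUnion.1 ha
      exact ⟨k, fun _ => hk⟩
    · exact ⟨0, fun h => absurd h ha⟩
  choose f hf using hf
  let P : Finset (Fin l × 𝔸) := Finset.univ.biUnion fun k => (supp 𝔸 (x k)).image fun a => (k, a)
  have hP : ∀ k a, (k, a) ∈ P ↔ a ∈ supp 𝔸 (x k) := by
    intro k a
    simp [P]
  have hPcard : P.card ≤ l * d := by
    have := Finset.card_biUnion_le_card_mul (Finset.univ : Finset (Fin l))
      (fun k => (supp 𝔸 (x k)).image fun a => (k, a)) d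
      (fun k _ => Finset.card_image_le.trans (card_supp_le (hx k)))
    simpa using this
  let I : Finset (Fin l × 𝔸) := U.map ⟨fun a => (f a, a), fun a b h => (Prod.mk.inj h).2⟩
  have hI : I ⊆ P := by
    intro p hp
    obtain ⟨a, ha, rfl⟩ := Finset.mem_map.1 hp
    exact (hP _ _).2 (hf a ha)
  have hIcard : I.card = U.card := Finset.card_map _
  have hNC := Finset.card_sdiff_add_card_eq_card hI
  have hsub : H ⊆ (P \ I).image Prod.fst ∪ (P \ I).image (fun p => f p.2) := by
    intro k hk
    have hk' := hH k hk
    simp only [IsolatedAt, not_forall, Finset.not_disjoint_iff] at hk'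
    obtain ⟨j, hjk, a, haj, hak⟩ := hk'
    have hmem : ∀ i, a ∈ supp 𝔸 (x i) → f a ≠ i → (i, a) ∈ P \ I := by
      intro i hi hne
      refine Finset.mem_sdiff.2 ⟨(hP i a).2 hi, fun h => ?_⟩
      obtain ⟨b, -, hb⟩ := Finset.mem_map.1 h
      obtain ⟨h1, rfl⟩ := Prod.mk.inj hb
      exact hne h1
    by_cases hfk : f a = k
    · refine Finset.mem_union_right _ (Finset.mem_image.2 ⟨(j, a), hmem j haj ?_, hfk⟩)
      rw [hfk]
      exact hjk.symm
    · exact Finset.mem_union_left _ (Finset.mem_image.2 ⟨(k, a), hmem k hak hfk, rfl⟩)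
  have h1 := (Finset.card_le_card hsub).trans (Finset.card_union_le _ _)
  have h2 := Finset.card_image_le (s := P \ I) (f := Prod.fst)
  have h3 := Finset.card_image_le (s := P \ I) (f := fun p => f p.2)
  have h4 : l * d = d * (l - 1) + d := by
    obtain ⟨m, rfl⟩ : ∃ m, l = m + 1 := ⟨l - 1, by omega⟩
    simp only [Nat.add_sub_cancel]
    ring
  omega

/-- A repetition of the first component could be omitted, and the other l - 1 components would
support the tuple. -/
theorem eq_zero_of_apply_eq [NeZero l] {x : Fin l → X} (hx : ∀ k, SupportedBy 𝔸 d (x k))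
    (hF : ¬ SupportedBy 𝔸 (d * (l - 1)) x) {k : Fin l} (hk : x k = x 0) : k = 0 := by
  classical
  by_contra hne
  refine hF ⟨(Finset.univ.erase k).biUnion fun j => supp 𝔸 (x j), ?_, ?_⟩
  · have := Finset.card_biUnion_le_card_mul (Finset.univ.erase k)
      (fun j => supp 𝔸 (x j)) d (fun j _ => card_supp_le (hx j))
    rw [Finset.card_erase_of_mem (Finset.mem_univ k), Finset.card_univ, Fintype.card_fin] at this
    rwa [mul_comm]
  · refine supports_tuple (fun k => let ⟨s, _, hs⟩ := hx k; ⟨s, hs⟩) _ fun j => ?_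
    by_cases hj : j = k
    · rw [hj, hk]
      exact Finset.subset_biUnion_of_mem (fun j => supp 𝔸 (x j))
        (Finset.mem_erase.2 ⟨fun h => hne h.symm, Finset.mem_univ _⟩)
    · exact Finset.subset_biUnion_of_mem (fun j => supp 𝔸 (x j))
        (Finset.mem_erase.2 ⟨hj, Finset.mem_univ _⟩)

theorem collapse_zero [NeZero l] (x : Fin l → X) (κ : Fin d → Fin l) : collapse x κ 0 = x 0 := by
  simp [collapse]

theorem collapse_apply_of_mem [NeZero l] (x : Fin l → X) (κ : Fin d → Fin l) (i : Fin d) :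
    collapse x κ (κ i) = x 0 := by
  simp [collapse]

theorem collapse_apply_of_notMem [NeZero l] (x : Fin l → X) (κ : Fin d → Fin l) {k : Fin l}
    (hk : k ∉ Set.range κ) : collapse x κ k = x k := if_neg hk

/-- A tuple is determined up to its orbit by its collapse at isolated positions and by the orbits of
the replaced components. -/
theorem exists_smul_eq_of_collapse [NeZero l] {x y : Fin l → X}
    (hy : ∀ k, FinitelySupported 𝔸 (y k)) {κ : Fin d → Fin l}
    (hxκ : ∀ i, IsolatedAt 𝔸 x (κ i)) (hyκ : ∀ i, IsolatedAt 𝔸 y (κ i)) (g : Equiv.Perm 𝔸)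
    (hg : collapse x κ = g • collapse y κ)
    (hκ : ∀ i, ∃ h : Equiv.Perm 𝔸, x (κ i) = h • y (κ i)) : ∃ π : Equiv.Perm 𝔸, x = π • y := by
  classical
  -- All positions outside κ use the same g, and those in κ share atoms with no other position, so
  -- the componentwise permutations can be glued.
  have hG : ∀ k, ∃ h : Equiv.Perm 𝔸, x k = h • y k ∧ (k ∉ Set.range κ → h = g) := by
    intro k
    by_cases hk : k ∈ Set.range κ
    · obtain ⟨i, rfl⟩ := hk
      obtain ⟨h, hh⟩ := hκ i
      exact ⟨h, hh, fun h' => absurd ⟨i, rfl⟩ h'⟩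
    · refine ⟨g, ?_, fun _ => rfl⟩
      have := congrFun hg k
      rwa [Pi.smul_apply, collapse_apply_of_notMem x κ hk,
        collapse_apply_of_notMem y κ hk] at this
  choose G hGx hGg using hG
  have hsupp : ∀ k, ∀ a ∈ supp 𝔸 (y k), G k a ∈ supp 𝔸 (x k) := fun k a ha => by
    rw [hGx k]
    exact mem_supp_smul (hy k) ha
  obtain ⟨π, hπ⟩ := exists_perm_glue y hy G (by
    intro i j a ha b hb
    by_cases hij : i = j
    · subst hij
      exact (G i).injective.eq_iff.symm
    by_cases hi : i ∈ Set.range κ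
    · obtain ⟨i, rfl⟩ := hi
      exact ⟨fun h => absurd (h ▸ ha) (Finset.disjoint_left.1 (hyκ i j (Ne.symm hij)) hb),
        fun h => absurd (h ▸ hsupp _ _ ha)
          (Finset.disjoint_left.1 (hxκ i j (Ne.symm hij)) (hsupp _ _ hb))⟩
    by_cases hj : j ∈ Set.range κ
    · obtain ⟨j, rfl⟩ := hj
      exact ⟨fun h => absurd (h ▸ hb) (Finset.disjoint_left.1 (hyκ j i hij) ha),
        fun h => absurd (h ▸ hsupp _ _ hb)
          (Finset.disjoint_left.1 (hxκ j i hij) (hsupp _ _ ha))⟩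
    rw [hGg i hi, hGg j hj]
    exact g.injective.eq_iff.symm)
  exact ⟨π, funext fun k => (hGx k).trans (hπ k).symm⟩

/-- There are few orbits of tuples with almost maximal supports. -/
theorem ncard_orbits_large_support [NeZero l] (hX : ∀ x : X, SupportedBy 𝔸 d x)
    (hfin : (orbits 𝔸 (Set.univ : Set X)).Finite)
    (hfinl : (orbits 𝔸 (Set.univ : Set (Fin l → X))).Finite) :
    (orbits 𝔸 {x : Fin l → X | ¬ SupportedBy 𝔸 (d * (l - 1)) x}).ncard * (l - 2 * d) ^ d ≤
      (d + 1) ^ d * ((orbits 𝔸 (Set.univ : Set (Fin l → X))).ncard *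
        (orbits 𝔸 (Set.univ : Set X)).ncard ^ d) := by
  classical
  have hfs : ∀ x : X, FinitelySupported 𝔸 x := fun x => let ⟨s, _, hs⟩ := hX x; ⟨s, hs⟩
  let F : Set (Fin l → X) := {x | ¬ SupportedBy 𝔸 (d * (l - 1)) x}
  have hF : (orbits 𝔸 F).Finite := hfinl.subset (orbits_mono (Set.subset_univ _))
  by_cases hne : Nonempty (Fin l → X)
  swap
  · have : F = ∅ := Set.eq_empty_of_forall_notMem fun x _ => hne ⟨x⟩
    change (orbits 𝔸 F).ncard * _ ≤ _
    rw [this, orbits, Set.image_empty]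
    simp
  have hr : ∀ O : Set (Fin l → X), ∃ x, O ∈ orbits 𝔸 F →
      x ∈ F ∧ MulAction.orbit (Equiv.Perm 𝔸) x = O := by
    intro O
    by_cases hO : O ∈ orbits 𝔸 F
    · obtain ⟨x, hx, hxO⟩ := hO
      exact ⟨x, fun _ => ⟨hx, hxO⟩⟩
    · exact ⟨hne.some, fun h => absurd h hO⟩
  choose r hr using hr
  -- Double counting of pairs (O, κ), where κ is a d-tuple of isolated positions of a representative
  -- of O, repetitions allowed. Each O admits at least (l - 2 * d) ^ d such κ, and φ is at most (d +
  -- 1) ^ d to one.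
  let iso : Set (Fin l → X) → Finset (Fin l) := fun O =>
    Finset.univ.filter fun k => IsolatedAt 𝔸 (r O) k
  let s : Finset ((_ : Set (Fin l → X)) × (Fin d → Fin l)) :=
    hF.toFinset.sigma fun O => Fintype.piFinset fun _ => iso O
  let t : Finset (Set (Fin l → X) × (Fin d → Set X)) :=
    hfinl.toFinset ×ˢ Fintype.piFinset fun _ => hfin.toFinset
  let φ : ((_ : Set (Fin l → X)) × (Fin d → Fin l)) → Set (Fin l → X) × (Fin d → Set X) :=
    fun p => (MulAction.orbit (Equiv.Perm 𝔸) (collapse (r p.1) p.2),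
      fun i => MulAction.orbit (Equiv.Perm 𝔸) (r p.1 (p.2 i)))
  have hs : ∀ p ∈ s, r p.1 ∈ F ∧ MulAction.orbit (Equiv.Perm 𝔸) (r p.1) = p.1 ∧
      ∀ i, IsolatedAt 𝔸 (r p.1) (p.2 i) := by
    rintro ⟨O, κ⟩ hp
    simp only [s, Finset.mem_sigma, Set.Finite.mem_toFinset, Fintype.mem_piFinset, iso,
      Finset.mem_filter, Finset.mem_univ, true_and] at hp
    exact ⟨(hr O hp.1).1, (hr O hp.1).2, hp.2⟩
  have hscard : (orbits 𝔸 F).ncard * (l - 2 * d) ^ d ≤ s.card := by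
    rw [Finset.card_sigma, Set.ncard_eq_toFinset_card _ hF, ← smul_eq_mul]
    refine Finset.card_nsmul_le_sum _ _ _ fun O hO => ?_
    rw [Fintype.card_piFinset_const]
    refine Nat.pow_le_pow_left ?_ _
    have h1 := card_not_isolated_le (x := r O) (fun k => hX _)
      (hr O (hF.mem_toFinset.1 hO)).1
      (Finset.univ.filter fun k => ¬ IsolatedAt 𝔸 (r O) k)
      (fun k hk => (Finset.mem_filter.1 hk).2)
    have h2 := Finset.card_filter_add_card_filter_not (s := (Finset.univ : Finset (Fin l)))
      (fun k => IsolatedAt 𝔸 (r O) k)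
    rw [Finset.card_univ, Fintype.card_fin] at h2
    simp only [iso]
    omega
  have htcard : t.card = (orbits 𝔸 (Set.univ : Set (Fin l → X))).ncard *
      (orbits 𝔸 (Set.univ : Set X)).ncard ^ d := by
    rw [Finset.card_product, Fintype.card_piFinset_const, Set.ncard_eq_toFinset_card _ hfinl,
      Set.ncard_eq_toFinset_card _ hfin]
  have hmaps : ∀ p ∈ s, φ p ∈ t := by
    intro p _
    simp only [φ, t, Finset.mem_product, Set.Finite.mem_toFinset, Fintype.mem_piFinset]
    exact ⟨⟨_, trivial, rfl⟩, fun i => ⟨_, trivial, rfl⟩⟩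
  refine hscard.trans (htcard ▸ ?_)
  refine Finset.card_le_mul_card_image_of_maps_to hmaps _ fun y _ => ?_
  rcases (s.filter fun p => φ p = y).eq_empty_or_nonempty with he | ⟨p₀, hp₀⟩
  · rw [he]
    exact Nat.zero_le _
  obtain ⟨hp₀s, hp₀y⟩ := Finset.mem_filter.1 hp₀
  obtain ⟨hp₀F, -, -⟩ := hs p₀ hp₀s
  let z := collapse (r p₀.1) p₀.2
  -- Every κ in this fibre takes values in E, since the collapse repeats the first component there.
  -- Outside the range of the fixed `p₀.2` only position 0 can lie in E, whence d + 1. Given κ, the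
  -- value of φ determines O.
  let E : Finset (Fin l) := Finset.univ.filter fun k => z k = z 0
  have hE : E.card ≤ d + 1 := by
    have hsub : E ⊆ insert 0 (Finset.univ.image p₀.2) := by
      intro k hk
      have hk' : z k = z 0 := (Finset.mem_filter.1 hk).2
      by_cases hkr : k ∈ Set.range p₀.2
      · obtain ⟨i, rfl⟩ := hkr
        exact Finset.mem_insert_of_mem (Finset.mem_image_of_mem _ (Finset.mem_univ i))
      · have : k = 0 := eq_zero_of_apply_eq (fun k => hX _) hp₀F (by
          simp only [z] at hk'
          rwa [collapse_apply_of_notMem _ _ hkr, collapse_zero] at hk')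
        rw [this]
        exact Finset.mem_insert_self _ _
    have h1 := Finset.card_image_le (s := (Finset.univ : Finset (Fin d))) (f := p₀.2)
    rw [Finset.card_univ, Fintype.card_fin] at h1
    have h2 := (Finset.card_le_card hsub).trans (Finset.card_insert_le _ _)
    omega
  have hcard : (Fintype.piFinset fun _ : Fin d => E).card ≤ (d + 1) ^ d := by
    rw [Fintype.card_piFinset_const]
    exact Nat.pow_le_pow_left hE _
  refine (Finset.card_le_card_of_injOn (fun p => p.2) ?_ ?_).trans hcard
  · intro p hp
    obtain ⟨hps, hpy⟩ := Finset.mem_filter.1 hp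
    have h1 : MulAction.orbit (Equiv.Perm 𝔸) (collapse (r p.1) p.2) =
        MulAction.orbit (Equiv.Perm 𝔸) z := congrArg Prod.fst (hpy.trans hp₀y.symm)
    obtain ⟨g, hg⟩ := orbit_eq_iff_exists.1 h1
    simp only [Finset.mem_coe, Fintype.mem_piFinset, E, Finset.mem_filter, Finset.mem_univ,
      true_and]
    intro i
    have h2 := congrFun hg (p.2 i)
    have h3 := congrFun hg 0
    rw [collapse_apply_of_mem, Pi.smul_apply] at h2
    rw [collapse_zero, Pi.smul_apply] at h3
    exact smul_left_cancel g (h2.symm.trans h3)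
  · rintro ⟨O, κ⟩ hp ⟨O', κ'⟩ hp' hκ
    obtain rfl : κ = κ' := hκ
    obtain ⟨hps, hpy⟩ := Finset.mem_filter.1 hp
    obtain ⟨hps', hpy'⟩ := Finset.mem_filter.1 hp'
    obtain ⟨-, hO, hiso⟩ := hs _ hps
    obtain ⟨-, hO', hiso'⟩ := hs _ hps'
    have heq := hpy.trans hpy'.symm
    obtain ⟨g, hg⟩ := orbit_eq_iff_exists.1 (congrArg Prod.fst heq)
    have hlet := fun i => orbit_eq_iff_exists.1 (congrFun (congrArg Prod.snd heq) i)
    have := orbit_eq_iff_exists.2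
      (exists_smul_eq_of_collapse (fun k => hfs _) hiso hiso' g hg hlet)
    rw [hO, hO'] at this
    obtain rfl : O = O' := this
    rfl

end Tuples

/-! ### The number of equivalence queries -/

section Counting

variable {𝔸 : Type v} {α : Type u} [MulAction (Equiv.Perm 𝔸) α]

theorem SupportedBy.map {X Y : Type*} [MulAction (Equiv.Perm 𝔸) X] [MulAction (Equiv.Perm 𝔸) Y]
    {k : ℕ} {x : X} (hx : SupportedBy 𝔸 k x) (f : X → Y)
    (hf : ∀ (g : Equiv.Perm 𝔸) x, f (g • x) = g • f x) : SupportedBy 𝔸 k (f x) :=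
  let ⟨s, hsk, hs⟩ := hx
  ⟨s, hsk, fun g hg => by rw [← hf, hs g hg]⟩

theorem supportedBy_atomDim (hα : ∀ a : α, FinitelySupported 𝔸 a)
    (hfin : OrbitFinite 𝔸 (Set.univ : Set α)) (a : α) :
    SupportedBy 𝔸 (atomDim 𝔸 (Set.univ : Set α)) a :=
  Nat.sInf_mem (s := {k | ∀ x ∈ (Set.univ : Set α), ∃ s : Finset 𝔸, s.card ≤ k ∧
    MulAction.Supports (Equiv.Perm 𝔸) (s : Set 𝔸) x})
    (hfin.exists_supportedBy fun a _ => hα a) a trivial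

theorem supportedBy_list [Infinite 𝔸] {d : ℕ} (hd : ∀ a : α, SupportedBy 𝔸 d a) (w : List α) :
    SupportedBy 𝔸 (d * w.length) w := by
  induction w with
  | nil => exact ⟨∅, Nat.zero_le _, fun g _ => rfl⟩
  | cons a w ih =>
    refine (((hd a).prodMk ih).map (fun p => p.1 :: p.2) (fun g x => rfl)).mono ?_
    rw [List.length_cons]
    exact le_of_eq (by ring)

theorem supportedBy_of_mem_wordsUpTo [Infinite 𝔸] {d l : ℕ} (hd : ∀ a : α, SupportedBy 𝔸 d a) {w : List α}
    (hw : w ∈ wordsUpTo α l) : SupportedBy 𝔸 (d * l) w :=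
  (supportedBy_list hd w).mono (Nat.mul_le_mul_left d hw)

/-- The orbits of triples consisting of two words and a letter. -/
theorem ncard_orbits_triples [Infinite 𝔸] {d k : ℕ} (hd : ∀ a : α, SupportedBy 𝔸 d a)
    (hfin : (orbits 𝔸 (Set.univ : Set α)).Finite) {U V : Set (List α)}
    (hU : (orbits 𝔸 U).Finite) (hV : (orbits 𝔸 V).Finite)
    (hUk : ∀ w ∈ U, SupportedBy 𝔸 k w) (hVk : ∀ w ∈ V, SupportedBy 𝔸 k w) :
    (orbits 𝔸 ((U ×ˢ V) ×ˢ (Set.univ : Set α))).Finite ∧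
      (orbits 𝔸 ((U ×ˢ V) ×ˢ (Set.univ : Set α))).ncard ≤
        (orbits 𝔸 U).ncard * (orbits 𝔸 V).ncard * pairOrbits 𝔸 k *
          (orbits 𝔸 (Set.univ : Set α)).ncard * (2 * k + 1) ^ d := by
  have h1 := orbits_prod hU hV hUk hVk
  have h2 := orbits_prod (k := k + k) (m := d) h1.1 hfin
    (fun p hp => (hUk _ hp.1).prodMk (hVk _ hp.2)) (fun a _ => hd a)
  refine ⟨h2.1, h2.2.trans ?_⟩
  rw [← pairOrbits_eq] at h1
  refine Nat.mul_le_mul (Nat.mul_le_mul_right _ h1.2) ?_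
  rw [two_mul]
  exact (injectivePairs_orbits _ _).2

/-- Words with almost maximal supports are rare among all words. -/
theorem exists_large_support_bound [Infinite 𝔸] {d : ℕ} (hd : ∀ a : α, SupportedBy 𝔸 d a)
    (hfin : OrbitFinite 𝔸 (Set.univ : Set α)) : ∃ C, ∀ l, 0 < l →
      (orbits 𝔸 {w | w ∈ wordsUpTo α l ∧ ¬ SupportedBy 𝔸 (d * (l - 1)) w}).ncard *
        (2 * (d * l) + 1) ^ d ≤ C * (orbits 𝔸 (wordsUpTo α l)).ncard := by
  have hα : ∀ a : α, FinitelySupported 𝔸 a := fun a => let ⟨s, _, hs⟩ := hd a; ⟨s, hs⟩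
  have hfin' := (orbitFinite_iff.1 hfin).2
  let c := (orbits 𝔸 (Set.univ : Set α)).ncard
  -- The second summand serves l ≤ 2d, where 2dl + 1 ≤ 4d² + 1. The first serves l > 2d, where 2dl +
  -- 1 ≤ (4d² + 2d + 1)(l - 2d).
  refine ⟨(4 * d ^ 2 + 2 * d + 1) ^ d * ((d + 1) ^ d * c ^ d) + (4 * d ^ 2 + 1) ^ d,
    fun l hl => ?_⟩
  let F : Set (List α) := {w | w ∈ wordsUpTo α l ∧ ¬ SupportedBy 𝔸 (d * (l - 1)) w}
  let W := (orbits 𝔸 (wordsUpTo α l)).ncard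
  change (orbits 𝔸 F).ncard * _ ≤ _ * W
  have hFW : (orbits 𝔸 F).ncard ≤ W :=
    ncard_orbits_le (fun w hw => hw.1) (finite_orbits_wordsUpTo hα hfin l)
  rcases le_or_gt l (2 * d) with hle | hgt
  · have h1 : (2 * (d * l) + 1) ^ d ≤ (4 * d ^ 2 + 1) ^ d := by
      refine Nat.pow_le_pow_left ?_ d
      nlinarith
    calc (orbits 𝔸 F).ncard * (2 * (d * l) + 1) ^ d ≤ W * (4 * d ^ 2 + 1) ^ d :=
          Nat.mul_le_mul hFW h1
      _ = (4 * d ^ 2 + 1) ^ d * W := mul_comm _ _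
      _ ≤ _ := Nat.mul_le_mul_right W (Nat.le_add_left _ _)
  · have : NeZero l := ⟨hl.ne'⟩
    have hofFn : ∀ (g : Equiv.Perm 𝔸) (x : Fin l → α), List.ofFn (g • x) = g • List.ofFn x :=
      fun g x => by
        change _ = (List.ofFn x).map (fun a => g • a)
        rw [List.map_ofFn]
        rfl
    have htuples := orbits_separating (𝔸 := 𝔸) (U := (Set.univ : Set (Fin l → α)))
      (fun x => MulAction.orbit (Equiv.Perm 𝔸) (List.ofFn x))
      (finite_orbits_wordsUpTo hα hfin l)
      (fun x _ => ⟨List.ofFn x, by simp [wordsUpTo], rfl⟩) (fun x _ y _ hxy => by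
        obtain ⟨g, hg⟩ := orbit_eq_iff_exists.1 hxy
        exact ⟨g, List.ofFn_injective (hg.trans (hofFn g y).symm)⟩)
    let F' : Set (Fin l → α) := {x | ¬ SupportedBy 𝔸 (d * (l - 1)) x}
    have hF' : (orbits 𝔸 F').Finite := htuples.1.subset (orbits_mono (Set.subset_univ _))
    -- Words shorter than l have supports of size at most d(l - 1), so F contains only words of
    -- length exactly l.
    have hFsub : F ⊆ List.ofFn '' F' := by
      rintro w ⟨hw, hwF⟩
      have hlen : w.length = l := by
        by_contra hne
        have hw' : w.length ≤ l := hw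
        exact hwF (supportedBy_of_mem_wordsUpTo hd (show w.length ≤ l - 1 by omega))
      subst hlen
      refine ⟨w.get, fun h => hwF ?_, List.ofFn_get w⟩
      have := h.map _ hofFn
      rwa [List.ofFn_get] at this
    have himg := orbits_image (𝔸 := 𝔸) List.ofFn hofFn hF'
    have h1 := (ncard_orbits_le hFsub himg.1).trans himg.2
    have h2 := ncard_orbits_large_support (l := l) hd hfin' htuples.1
    have h3 : 2 * (d * l) + 1 ≤ (4 * d ^ 2 + 2 * d + 1) * (l - 2 * d) := by
      obtain ⟨j, rfl⟩ : ∃ j, l = 2 * d + 1 + j := ⟨l - (2 * d + 1), by omega⟩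
      have : 2 * d + 1 + j - 2 * d = j + 1 := by omega
      rw [this]
      nlinarith [Nat.zero_le (d ^ 2 * j)]
    calc (orbits 𝔸 F).ncard * (2 * (d * l) + 1) ^ d
        ≤ (orbits 𝔸 F').ncard * ((4 * d ^ 2 + 2 * d + 1) * (l - 2 * d)) ^ d :=
          Nat.mul_le_mul h1 (Nat.pow_le_pow_left h3 d)
      _ = (4 * d ^ 2 + 2 * d + 1) ^ d * ((orbits 𝔸 F').ncard * (l - 2 * d) ^ d) := by
          rw [mul_pow]; ring
      _ ≤ (4 * d ^ 2 + 2 * d + 1) ^ d * ((d + 1) ^ d * (W * c ^ d)) :=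
          Nat.mul_le_mul_left _ (h2.trans
            (Nat.mul_le_mul_left _ (Nat.mul_le_mul_right _ htuples.2)))
      _ = (4 * d ^ 2 + 2 * d + 1) ^ d * ((d + 1) ^ d * c ^ d) * W := by ring
      _ ≤ _ := Nat.mul_le_mul_right W (Nat.le_add_right _ _)

/-- The orbits of triples of two words of length at most `l` and a letter. -/
theorem exists_triples_bound [Infinite 𝔸] {d : ℕ} (hd : ∀ a : α, SupportedBy 𝔸 d a)
    (hfin : OrbitFinite 𝔸 (Set.univ : Set α)) : ∃ C, ∀ l,
      (orbits 𝔸 ((wordsUpTo α l ×ˢ wordsUpTo α l) ×ˢ (Set.univ : Set α))).ncard ≤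
        C * ((orbits 𝔸 (wordsUpTo α l)).ncard ^ 2 * pairOrbits 𝔸 (d * l)) := by
  have hα : ∀ a : α, FinitelySupported 𝔸 a := fun a => let ⟨s, _, hs⟩ := hd a; ⟨s, hs⟩
  have hfin' := (orbitFinite_iff.1 hfin).2
  obtain ⟨C, hC⟩ := exists_large_support_bound hd hfin
  let c := (orbits 𝔸 (Set.univ : Set α)).ncard
  -- The summands account for two words of small support, for one of the words in F (on either
  -- side), and for l = 0.
  refine ⟨c * 2 ^ d + 2 * (c * C) + c, fun l => ?_⟩
  have hWfin := finite_orbits_wordsUpTo hα hfin l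
  let W := (orbits 𝔸 (wordsUpTo α l)).ncard
  let p := pairOrbits 𝔸 (d * l)
  change _ ≤ _ * (W ^ 2 * p)
  rcases Nat.eq_zero_or_pos l with rfl | hl
  · have h := (ncard_orbits_triples hd hfin' hWfin hWfin
      (fun w hw => supportedBy_of_mem_wordsUpTo hd hw)
      (fun w hw => supportedBy_of_mem_wordsUpTo hd hw)).2
    refine h.trans ?_
    change W * W * p * c * (2 * (d * 0) + 1) ^ d ≤ _
    rw [mul_zero, mul_zero, zero_add, one_pow, mul_one]
    calc W * W * p * c = c * (W ^ 2 * p) := by ring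
      _ ≤ _ := Nat.mul_le_mul_right _ (Nat.le_add_left _ _)
  let F : Set (List α) := {w | w ∈ wordsUpTo α l ∧ ¬ SupportedBy 𝔸 (d * (l - 1)) w}
  let A : Set (List α) := {w | w ∈ wordsUpTo α l ∧ SupportedBy 𝔸 (d * (l - 1)) w}
  have hF : (orbits 𝔸 F).Finite := hWfin.subset (orbits_mono fun w hw => hw.1)
  have hA : (orbits 𝔸 A).Finite := hWfin.subset (orbits_mono fun w hw => hw.1)
  have hAW : (orbits 𝔸 A).ncard ≤ W := ncard_orbits_le (fun w hw => hw.1) hWfin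
  have hWk : ∀ w ∈ wordsUpTo α l, SupportedBy 𝔸 (d * l) w :=
    fun w hw => supportedBy_of_mem_wordsUpTo hd hw
  have hFk : ∀ w ∈ F, SupportedBy 𝔸 (d * l) w := fun w hw => hWk w hw.1
  have t1 := ncard_orbits_triples hd hfin' hA hA (fun w hw => hw.2) (fun w hw => hw.2)
  have t2 := ncard_orbits_triples hd hfin' hF hWfin hFk hWk
  have t3 := ncard_orbits_triples hd hfin' hWfin hF hWk hFk
  have hsub : orbits 𝔸 ((wordsUpTo α l ×ˢ wordsUpTo α l) ×ˢ (Set.univ : Set α)) ⊆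
      orbits 𝔸 ((A ×ˢ A) ×ˢ (Set.univ : Set α)) ∪
        (orbits 𝔸 ((F ×ˢ wordsUpTo α l) ×ˢ (Set.univ : Set α)) ∪
          orbits 𝔸 ((wordsUpTo α l ×ˢ F) ×ˢ (Set.univ : Set α))) := by
    rw [orbits, orbits, orbits, orbits, ← Set.image_union, ← Set.image_union]
    refine Set.image_mono ?_
    rintro ⟨⟨s, u⟩, a⟩ ⟨⟨hs, hu⟩, -⟩
    by_cases hsF : s ∈ F
    · exact Or.inr (Or.inl ⟨⟨hsF, hu⟩, trivial⟩)
    by_cases huF : u ∈ F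
    · exact Or.inr (Or.inr ⟨⟨hs, huF⟩, trivial⟩)
    exact Or.inl ⟨⟨⟨hs, not_not.1 fun h => hsF ⟨hs, h⟩⟩, hu, not_not.1 fun h => huF ⟨hu, h⟩⟩,
      trivial⟩
  have h0 := (Set.ncard_le_ncard hsub (t1.1.union (t2.1.union t3.1))).trans
    ((Set.ncard_union_le _ _).trans (Nat.add_le_add_left (Set.ncard_union_le _ _) _))
  -- This growth of p pays for the additional letter when both words have small support.
  have hp : (d * (l - 1) + 2) ^ d * pairOrbits 𝔸 (d * (l - 1)) ≤ p := by
    have := pairOrbits_add (𝔸 := 𝔸) (d * (l - 1)) d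
    have h : d * (l - 1) + d = d * l := by
      obtain ⟨m, rfl⟩ : ∃ m, l = m + 1 := ⟨l - 1, by omega⟩
      rw [Nat.add_sub_cancel]
      ring
    rwa [h] at this
  have b1 : (orbits 𝔸 ((A ×ˢ A) ×ˢ (Set.univ : Set α))).ncard ≤ c * 2 ^ d * (W ^ 2 * p) := by
    refine t1.2.trans ?_
    have hpow : (2 * (d * (l - 1)) + 1) ^ d ≤ 2 ^ d * (d * (l - 1) + 2) ^ d := by
      rw [← mul_pow]
      exact Nat.pow_le_pow_left (by omega) d
    calc (orbits 𝔸 A).ncard * (orbits 𝔸 A).ncard * pairOrbits 𝔸 (d * (l - 1)) * c *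
          (2 * (d * (l - 1)) + 1) ^ d
        ≤ W * W * pairOrbits 𝔸 (d * (l - 1)) * c * (2 ^ d * (d * (l - 1) + 2) ^ d) := by
          gcongr
      _ = c * 2 ^ d * (W ^ 2 * ((d * (l - 1) + 2) ^ d * pairOrbits 𝔸 (d * (l - 1)))) := by ring
      _ ≤ _ := by gcongr
  have hCl : (orbits 𝔸 F).ncard * (2 * (d * l) + 1) ^ d ≤ C * W := hC l hl
  have b2 : (orbits 𝔸 ((F ×ˢ wordsUpTo α l) ×ˢ (Set.univ : Set α))).ncard ≤
      c * C * (W ^ 2 * p) := by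
    refine t2.2.trans ?_
    calc (orbits 𝔸 F).ncard * W * p * c * (2 * (d * l) + 1) ^ d
        = ((orbits 𝔸 F).ncard * (2 * (d * l) + 1) ^ d) * (W * p * c) := by ring
      _ ≤ C * W * (W * p * c) := Nat.mul_le_mul_right _ hCl
      _ = _ := by ring
  have b3 : (orbits 𝔸 ((wordsUpTo α l ×ˢ F) ×ˢ (Set.univ : Set α))).ncard ≤
      c * C * (W ^ 2 * p) := by
    refine t3.2.trans ?_
    calc W * (orbits 𝔸 F).ncard * p * c * (2 * (d * l) + 1) ^ d
        = ((orbits 𝔸 F).ncard * (2 * (d * l) + 1) ^ d) * (W * p * c) := by ring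
      _ ≤ C * W * (W * p * c) := Nat.mul_le_mul_right _ hCl
      _ = _ := by ring
  calc _ ≤ c * 2 ^ d * (W ^ 2 * p) + (c * C * (W ^ 2 * p) + c * C * (W ^ 2 * p)) :=
        h0.trans (Nat.add_le_add b1 (Nat.add_le_add b2 b3))
    _ = (c * 2 ^ d + 2 * (c * C)) * (W ^ 2 * p) := by ring
    _ ≤ _ := Nat.mul_le_mul_right _ (Nat.le_add_right _ _)

/-- A word of length at most l + 1 is one of length at most l, possibly followed by one letter.
Pairs without the extra letter give the 1 in C + 1, those with it are images of triples. -/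
theorem exists_pairBound_le [Infinite 𝔸] (hα : ∀ a : α, FinitelySupported 𝔸 a)
    (hfin : OrbitFinite 𝔸 (Set.univ : Set α)) : ∃ C, ∀ l, pairBound 𝔸 α l ≤
      C * (orbitCount 𝔸 (wordsUpTo α l) ^ 2 *
        pairOrbits 𝔸 (atomDim 𝔸 (Set.univ : Set α) * l)) := by
  have hd := supportedBy_atomDim hα hfin
  set d := atomDim 𝔸 (Set.univ : Set α)
  obtain ⟨C, hC⟩ := exists_triples_bound hd hfin
  refine ⟨C + 1, fun l => ?_⟩
  have hWfin := finite_orbits_wordsUpTo hα hfin l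
  have hWk : ∀ w ∈ wordsUpTo α l, SupportedBy 𝔸 (d * l) w :=
    fun w hw => supportedBy_of_mem_wordsUpTo hd hw
  have h1 := orbits_prod hWfin hWfin hWk hWk
  have h2 := orbits_image (𝔸 := 𝔸)
    (fun x : (List α × List α) × α => (x.1.1, x.1.2 ++ [x.2]))
    (fun g x => Prod.ext rfl (smul_append g x.1.2 [x.2]).symm)
    (ncard_orbits_triples hd (orbitFinite_iff.1 hfin).2 hWfin hWfin hWk hWk).1
  have hsub : wordsUpTo α l ×ˢ wordsUpTo α (l + 1) ⊆ wordsUpTo α l ×ˢ wordsUpTo α l ∪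
      (fun x : (List α × List α) × α => (x.1.1, x.1.2 ++ [x.2])) ''
        ((wordsUpTo α l ×ˢ wordsUpTo α l) ×ˢ Set.univ) := by
    rintro ⟨s, t⟩ ⟨hs, ht⟩
    rw [← wordsUpTo_succ] at ht
    rcases ht with ht | ⟨u, hu, a, rfl⟩
    · exact Or.inl ⟨hs, ht⟩
    · exact Or.inr ⟨((s, u), a), ⟨⟨hs, hu⟩, trivial⟩, rfl⟩
  have h3 := orbits_mono (𝔸 := 𝔸) hsub
  rw [orbits, orbits, Set.image_union] at h3
  have h4 := (Set.ncard_le_ncard h3 (h1.1.union h2.1)).trans (Set.ncard_union_le _ _)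
  refine h4.trans ((Nat.add_le_add h1.2 (h2.2.trans (hC l))).trans (le_of_eq ?_))
  rw [← pairOrbits_eq, ← orbitCount_eq]
  ring

/-- Length is invariant and, as there is a letter, takes all l + 1 values. -/
theorem length_lt_orbitCount_wordsUpTo [Infinite 𝔸] (hα : ∀ a : α, FinitelySupported 𝔸 a)
    (hfin : OrbitFinite 𝔸 (Set.univ : Set α)) (a : α) (l : ℕ) :
    l < orbitCount 𝔸 (wordsUpTo α l) := by
  have := ncard_le_orbits_of_invariant (𝔸 := 𝔸) (U := wordsUpTo α l) (T := Set.Iic l)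
    List.length (finite_orbits_wordsUpTo hα hfin l)
    (fun m hm => ⟨List.replicate m a, by simpa [wordsUpTo] using hm, by simp⟩) length_smul
  rw [Set.ncard_eq_toFinset_card'] at this
  simpa [orbitCount_eq] using this

theorem charLength_eq_zero_of_isEmpty [IsEmpty α] (L : Set (List α)) : charLength 𝔸 L = 0 := by
  refine Nat.sInf_eq_zero.2 (or_iff_not_imp_right.2 fun h => ?_)
  obtain ⟨l, hl⟩ := Set.nonempty_iff_ne_empty.2 h
  intro q hq
  obtain ⟨w, -, hw⟩ := hl q hq
  cases w with
  | nil => exact ⟨[], Nat.zero_le 0, hw⟩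
  | cons a w => exact isEmptyElim a

/-- The number of equivalence queries is bounded in terms of the longest shortest characterising
word. -/
theorem exists_potentialBound_le [Infinite 𝔸] (hα : ∀ a : α, FinitelySupported 𝔸 a)
    (hfin : OrbitFinite 𝔸 (Set.univ : Set α)) : ∃ C, ∀ L : Set (List α),
      potentialBound 𝔸 α (charLength 𝔸 L) + 2 ≤
        C * (orbitCount 𝔸 (wordsUpTo α (charLength 𝔸 L)) ^ 2 *
          pairOrbits 𝔸 (atomDim 𝔸 (Set.univ : Set α) * charLength 𝔸 L)) := by
  obtain ⟨C, hC⟩ := exists_pairBound_le hα hfin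
  -- With l ≤ W and 1 ≤ W, p, the terms besides the pairs are W + l(W + 1) + 2 ≤ W² + 2W + 2 ≤ 5W²p.
  refine ⟨2 * C + 5, fun L => ?_⟩
  have h := hC (charLength 𝔸 L)
  have hl : charLength 𝔸 L ≤ orbitCount 𝔸 (wordsUpTo α (charLength 𝔸 L)) := by
    rcases isEmpty_or_nonempty α with _ | ⟨⟨a⟩⟩
    · rw [charLength_eq_zero_of_isEmpty]
      exact Nat.zero_le _
    · exact (length_lt_orbitCount_wordsUpTo hα hfin a _).le
  have hW : 0 < orbitCount 𝔸 (wordsUpTo α (charLength 𝔸 L)) := by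
    rw [orbitCount_eq, Set.ncard_pos (finite_orbits_wordsUpTo hα hfin _)]
    exact ⟨_, [], Nat.zero_le _, rfl⟩
  have hp := pairOrbits_pos (𝔸 := 𝔸) (atomDim 𝔸 (Set.univ : Set α) * charLength 𝔸 L)
  unfold potentialBound
  generalize charLength 𝔸 L = l at *
  generalize orbitCount 𝔸 (wordsUpTo α l) = W at *
  generalize pairOrbits 𝔸 (atomDim 𝔸 (Set.univ : Set α) * l) = p at *
  have h1 : W ^ 2 ≤ W ^ 2 * p := Nat.le_mul_of_pos_right _ hp
  have h2 : W ≤ W ^ 2 := Nat.le_self_pow two_ne_zero W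
  have h3 : l * (W + 1) ≤ W ^ 2 + W := (Nat.mul_le_mul_right _ hl).trans (le_of_eq (by ring))
  have h4 : (2 * C + 5) * (W ^ 2 * p) = 2 * (C * (W ^ 2 * p)) + 5 * (W ^ 2 * p) := by ring
  omega

end Counting

end NominalLearning

/-! ### The learning theorem -/

open NominalLearning in
theorem theorem5p5 {𝔸 : Type v} [Countable 𝔸] [Infinite 𝔸] {α : Type u}
    [MulAction (Equiv.Perm 𝔸) α] (hα : ∀ a : α, FinitelySupported 𝔸 a)
    (hfin : OrbitFinite 𝔸 (Set.univ : Set α)) :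
    ∃ C : ℕ, ∀ L : Set (List α), Equivariant 𝔸 L →
      -- on residual languages every run returns, within the claimed number of queries
      (IsResidualLanguage 𝔸 L →
        EveryRunReturns 𝔸 L ∧
        ∀ c : Config α, Reachable 𝔸 L c →
          OrbitFinite 𝔸 c.table.membershipQueries ∧
          c.queries ≤ C * (charLength 𝔸 L +
            orbitCount 𝔸 (wordsUpTo α (charLength 𝔸 L)) ^ 2 *
              pairOrbits 𝔸 (atomDim 𝔸 (Set.univ : Set α) * charLength 𝔸 L))) ∧
      -- whatever a run returns is a residual nominal automaton for the target language
      (∀ (c : Config α) (H : Automaton α (Set (List α))), Reachable 𝔸 L c → c.output = some H →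
        H.IsNominal 𝔸 ∧ H.IsResidual ∧ H.language = L) ∧
      -- on a language that is not residual no run returns
      (¬ IsResidualLanguage 𝔸 L → ∀ c : Config α, Reachable 𝔸 L c → c.output = none) := by
  obtain ⟨C, hC⟩ := exists_potentialBound_le hα hfin
  refine ⟨C, fun L hL => ⟨fun hres => ⟨everyRunReturns hα hfin hL hres, fun c hc => ?_⟩, ?_, ?_⟩⟩
  · obtain ⟨⟨n, hT⟩, -⟩ := Reachable.isRegular hα hfin hL hc
    exact ⟨hT.orbitFinite_membershipQueries hα hfin,
      ((Reachable.queries_le hα hfin hL hres hc).trans (hC L)).trans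
        -- The product term alone already bounds the number of queries; the summand l is added only
        -- for the stated form.
        (Nat.mul_le_mul_left C (Nat.le_add_left _ _))⟩
  · intro c H hc hH
    exact (Reachable.isRegular hα hfin hL hc).2 H hH
  · intro hnres c hc
    rcases hout : c.output with _ | H
    · rfl
    · obtain ⟨h1, h2, h3⟩ := (Reachable.isRegular hα hfin hL hc).2 H hout
      exact absurd ⟨_, inferInstance, H, h1, h2, h3⟩ hnres
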